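/- Let $N\ge 1$ be an integer, and let $\mathscr M_+(\mathbb R^N)$ be the set of finite positive Borel measures on $\mathbb R^N$. A measure in $\mathscr M_+(\mathbb R^N)$ is said to belong to $W^{1,1}_{\mathrm{loc}}(\mathbb R^N,\mathbb R_+)$, and is identified with its density $u$, if it has a non-negative density $u\in W^{1,1}_{\mathrm{loc}}(\mathbb R^N)$ with respect to Lebesgue measure. For $s\le 1$ let $w_s(u)=u^s$ for $u>0$, $w_s(0)=0$, let $f_s(u,\xi)=w_s(u)+|\xi|^2$ for $u\ge 0$, $\xi\in\mathbb R^N$ (and $f_s=+\infty$ for $u<0$), and let $$H_{f_s}(m)=\inf\Big\{\int_{\mathbb R^N} f_s(u,\nabla u)\,dx \;:\; u\in W^{1,1}_{\mathrm{loc}}\cap L^1(\mathbb R^N),\ \int_{\mathbb R^N} u=m\Big\}\in[0,+\infty].$$ For $H:\mathbb R_+\to[0,+\infty]$ such that $H'(0^+)=\lim_{m\to0^+}H(m)/m\in[0,+\infty]$ exists, the $H$-mass of $\mu\in\mathscr M_+(\mathbb R^N)$ is $$\mathbf M^H(\mu)=\sum_{x\in\mathbb R^N}H(\mu(\{x\}))+H'(0^+)\,\mu^d(\mathbb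 R^N),$$ where $\mu^d$ is the diffuse (non-atomic) part of $\mu$ and $\infty\cdot 0=0$; the $\alpha$-mass is $\mathbf M^\alpha=\mathbf M^{t\mapsto t^\alpha}$. (i) Let $s<1$ and let $W:\mathbb R_+\to\mathbb R_+$ be such that: $W$ is lower semicontinuous; $\{W=0\}=\{0\}$; $W(u)\sim u^s$ as $u\to+\infty$; $\sup_{u>0}W(u)/u^s<+\infty$; and $\liminf_{u\to0^+}W(u)/u>0$. Let $\rho=\frac{N(1-s)}{(N+2)+N(1-s)}$ and, for $\varepsilon>0$ and $u\in\mathscr M_+(\mathbb R^N)$, $$\mathcal W_\varepsilon(u)=\int_{\mathbb R^N}\varepsilon^{-\rho}\big(W(u)+\varepsilon|\nabla u|^2\big)\,dx\ \text{ if } u\in W^{1,1}_{\mathrm{loc}}(\mathbb R^N,\mathbb R_+),\qquad \mathcal W_\varepsilon(u)=+\infty\ \text{ otherwise.}$$ Then $(\mathcal W_\varepsilon)_{\varepsilon>0}$ $\Gamma$-converges to $\mathbf M^{H_{f_s}}$ as $\varepsilon\to0^+$ on $\mathscr M_+(\mathbb R^N)$, both for the weak convergence of measures (duality with continuous functions vanishing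 at infinity) and for the narrow convergence (duality with bounded continuous functions). That is, for each of these two convergences: if $u_\varepsilon\to u$ as $\varepsilon\to0^+$, then $\mathbf M^{H_{f_s}}(u)\le\liminf_{\varepsilon\to0^+}\mathcal W_\varepsilon(u_\varepsilon)$; and for every $u$ there is a family $u_\varepsilon\to u$ with $\limsup_{\varepsilon\to0^+}\mathcal W_\varepsilon(u_\varepsilon)\le\mathbf M^{H_{f_s}}(u)$. (ii) For every $s\le1$ the limit $H_{f_s}'(0^+)=\lim_{m\to0^+}H_{f_s}(m)/m$ exists in $[0,+\infty]$, so that $\mathbf M^{H_{f_s}}$ is well defined. (iii) If $s\in(-2,1]$, then $\mathbf M^{H_{f_s}}$ is a non-trivial multiple of the $\alpha$-mass: there is $c\in(0,+\infty)$ with $\mathbf M^{H_{f_s}}=c\,\mathbf M^\alpha$ on $\mathscr M_+(\mathbb R^N)$, where $\alpha=\frac{1-s/2+s/N}{1-s/2+1/N}$. -/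

import Mathlib

open MeasureTheory Filter Topology
open scoped ENNReal NNReal ContDiff ZeroAtInfty

noncomputable section

namespace Droplets

/-- The space `ℝ^N` with its Euclidean norm and Lebesgue measure. -/
abbrev Space (N : ℕ) : Type := EuclideanSpace ℝ (Fin N)

/-- `u ∈ W^{1,1}_loc(ℝ^N)` with weak gradient `g`: both are locally integrable and
`∫ u ∂ᵢφ = - ∫ gᵢ φ` for all test functions `φ ∈ C_c^∞(ℝ^N)` and all `i`. -/
structure IsW11loc {N : ℕ} (u : Space N → ℝ) (g : Space N → Space N) : Prop where
  locallyIntegrable : LocallyIntegrable u volume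
  locallyIntegrable_grad : LocallyIntegrable g volume
  integral_eq : ∀ φ : Space N → ℝ, ContDiff ℝ ∞ φ → HasCompactSupport φ → ∀ i : Fin N,
    ∫ x, u x * fderiv ℝ φ x (EuclideanSpace.single i 1) = - ∫ x, g x i * φ x

/-- The minimal cost function `H_f(m)`: the infimum of `∫ f(u, ∇u)` over all
`u ∈ W^{1,1}_loc ∩ L^1(ℝ^N)` with `∫ u = m` (for a Lagrangian `f(u, ξ)` that does not depend on
the position). -/
def minimalCost {N : ℕ} (f : ℝ → Space N → ℝ≥0∞) (m : ℝ) : ℝ≥0∞ :=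
  ⨅ (u : Space N → ℝ) (g : Space N → Space N) (_ : IsW11loc u g)
    (_ : Integrable u volume) (_ : ∫ x, u x = m), ∫⁻ x, f (u x) (g x)

/-- The Lagrangian `f_s(u, ξ) = w_s(u) + |ξ|²` for `u ≥ 0`, where `w_s(u) = u^s` for `u > 0` and
`w_s(0) = 0`; a Lagrangian given on `u ≥ 0` only is extended by `+∞` to `u < 0`. -/
def powerLagrangian (N : ℕ) (s : ℝ) (u : ℝ) (ξ : Space N) : ℝ≥0∞ :=
  if u < 0 then ⊤
  else (if u = 0 then 0 else ENNReal.ofReal (u ^ s)) + ENNReal.ofReal (‖ξ‖ ^ 2)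

/-- The slope at the origin `H'(0⁺) = lim_{m → 0⁺} H(m) / m`; written as an upper limit, which is
the limit whenever the latter exists. -/
def slopeZero (H : ℝ → ℝ≥0∞) : ℝ≥0∞ :=
  limsup (fun m : ℝ => H m / ENNReal.ofReal m) (𝓝[>] 0)

/-- The `H`-mass `∑_x H(μ({x})) + H'(0⁺) μ^d(ℝ^N)` of a finite positive measure `μ`, where `μ^d` is
the diffuse part of `μ`, i.e. the restriction of `μ` to the complement of its set of atoms. -/
def HMass {N : ℕ} (H : ℝ → ℝ≥0∞) (μ : FiniteMeasure (Space N)) : ℝ≥0∞ :=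
  ∑' x : Space N, H ((μ : Measure (Space N)).real {x})
    + slopeZero H * (μ : Measure (Space N)) {x | (μ : Measure (Space N)) {x} = 0}

/-- The `α`-mass, i.e. the `H`-mass for `H(m) = m^α`. -/
def alphaMass {N : ℕ} (α : ℝ) (μ : FiniteMeasure (Space N)) : ℝ≥0∞ :=
  HMass (fun m : ℝ => ENNReal.ofReal (m ^ α)) μ

/-- The exponent `ρ(s, N) = N(1-s) / ((N+2) + N(1-s))`. -/
def dropletExponent (N : ℕ) (s : ℝ) : ℝ :=
  N * (1 - s) / ((N + 2) + N * (1 - s))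

/-- The Cahn-Hilliard functional
`W_ε(μ) = ∫ ε^{-ρ} (W(u) + ε |∇u|²)` if `μ` has a density `u ∈ W^{1,1}_loc(ℝ^N, ℝ_+)`, and `+∞`
otherwise. The density and its weak gradient are unique almost everywhere, so that the infimum
below is over the empty set or over copies of the same value. -/
def dropletEnergy {N : ℕ} (W : ℝ≥0 → ℝ≥0) (s ε : ℝ) (μ : FiniteMeasure (Space N)) : ℝ≥0∞ :=
  ⨅ (u : Space N → ℝ) (g : Space N → Space N) (_ : IsW11loc u g) (_ : ∀ x, 0 ≤ u x)
    (_ : (μ : Measure (Space N)) = volume.withDensity (fun x => ENNReal.ofReal (u x))),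
    ∫⁻ x, ENNReal.ofReal (ε ^ (-dropletExponent N s))
      * ((W (u x).toNNReal : ℝ≥0∞) + ENNReal.ofReal (ε * ‖g x‖ ^ 2))

/-- Narrow convergence of `μ_ε` to `μ` as `ε → 0⁺`: duality with bounded continuous functions,
which is the topology of `FiniteMeasure`. -/
def NarrowConverges {N : ℕ} (μs : ℝ → FiniteMeasure (Space N)) (μ : FiniteMeasure (Space N)) :
    Prop :=
  Tendsto μs (𝓝[>] 0) (𝓝 μ)

/-- Weak convergence of `μ_ε` to `μ` as `ε → 0⁺`: duality with continuous functions vanishing at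
infinity. -/
def WeakConverges {N : ℕ} (μs : ℝ → FiniteMeasure (Space N)) (μ : FiniteMeasure (Space N)) :
    Prop :=
  ∀ φ : C₀(Space N, ℝ), Tendsto (fun ε => ∫ x, φ x ∂(μs ε : Measure (Space N))) (𝓝[>] 0)
    (𝓝 (∫ x, φ x ∂(μ : Measure (Space N))))

/-- `Γ`-convergence of `F_ε` to `F₀` as `ε → 0⁺` with respect to a notion of convergence of
families: the lower bound along every convergent family, and for every point a recovery family.
(Only the values at `ε > 0` matter.) -/
def GammaConverges {X : Type*} (conv : (ℝ → X) → X → Prop) (F : ℝ → X → ℝ≥0∞)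
    (F₀ : X → ℝ≥0∞) : Prop :=
  (∀ (v : ℝ → X) (u : X), conv v u → F₀ u ≤ liminf (fun ε => F ε (v ε)) (𝓝[>] 0)) ∧
    ∀ u : X, ∃ v : ℝ → X, conv v u ∧ limsup (fun ε => F ε (v ε)) (𝓝[>] 0) ≤ F₀ u

end Droplets

end

open MeasureTheory Filter Topology
open scoped ENNReal NNReal ContDiff ZeroAtInfty

noncomputable section

namespace Droplets

variable {N : ℕ} {u v : Space N → ℝ} {g k : Space N → Space N}

/-! Let `δ = ε ^ (1 / (N + 2 + N (1 - s)))` and write a density as `u = δ ^ (-N) v (· / δ)`. This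
preserves the mass and turns the droplet functional into `∫ δ ^ (N s) W (δ ^ (-N) v) + |∇v|²`, whose
potential tends to `v ^ s`. Small droplets therefore cost, in the limit, the value of `H = H_{f_s}`
at their mass, and distant droplets do not interact.

Rescaling amplitude and length of a competitor shows `H(m) = H(1) m ^ α` (`powerCost_eq`). Nash's
inequality gives `H(1) > 0` (`powerCost_one_pos`); moreover `H(1)` is finite if `s > -2`
(`powerCost_one_lt_top`) and infinite if `s ≤ -2` (`powerCost_one_eq_top`). This settles the slope
at the origin and the comparison with the `α`-mass. If `s < 1` then `α < 1` and the slope is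
infinite, so a diffuse part makes the limit functional infinite.

The lower bound is local: near a compact set `C` the energy eventually exceeds every number below
`H(μ(C))`. If `s > -2` (`IsDropletPotential.eventually_lt_of_neg_two_lt`), the blow-up `v` is
controlled only above a threshold `τ → 0`. A cutoff in space (`exists_localization`) and a
truncation of heights between `τ` and `√τ` (`exists_truncation`) produce a true competitor for `H`.
Both produce singular factors, tamed by averaging over the level of the cutoff or truncation; the
singularities are integrable for a suitable choice of exponents, which exists because `s > -2`. If
`s ≤ -2` (`IsDropletPotential.eventually_lt_of_le_neg_two`), the inequality `|∇ log v| ≤ v ^ s +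
|∇v|²` for `v ≤ 1` yields a capacity estimate that makes every positive mass infinitely expensive.
Adding the local bounds over disjoint compact sets, either atoms or small pieces of the diffuse
part, gives `IsDropletPotential.HMass_le_liminf`.

For recovery families, compactly supported, almost optimal profiles are placed at finitely many
atoms, and a diagonal argument exhausts all atoms (`IsDropletPotential.exists_recovery`). -/

/-! ### Weak gradients: limits, translations and difference quotients -/

theorem IsW11loc.congr_ae (h : IsW11loc u g) (huv : u =ᵐ[volume] v) (hgk : g =ᵐ[volume] k) :
    IsW11loc v k where
  locallyIntegrable := h.locallyIntegrable.mono
    (h.locallyIntegrable.aestronglyMeasurable.congr huv)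
    (huv.mono fun x hx => by rw [hx])
  locallyIntegrable_grad := h.locallyIntegrable_grad.mono
    (h.locallyIntegrable_grad.aestronglyMeasurable.congr hgk)
    (hgk.mono fun x hx => by rw [hx])
  integral_eq φ hφ hc i := by
    have h1 : ∫ x, u x * fderiv ℝ φ x (EuclideanSpace.single i 1) =
        ∫ x, v x * fderiv ℝ φ x (EuclideanSpace.single i 1) :=
      integral_congr_ae (huv.mono fun x hx => by simp only [hx])
    have h2 : ∫ x, g x i * φ x = ∫ x, k x i * φ x :=
      integral_congr_ae (hgk.mono fun x hx => by simp only [hx])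
    rw [← h1, ← h2]
    exact h.integral_eq φ hφ hc i

theorem locallyIntegrable_coord (h : LocallyIntegrable g volume) (i : Fin N) :
    LocallyIntegrable (fun x => g x i) volume := by
  refine h.mono ?_ (Eventually.of_forall fun x => PiLp.norm_apply_le _ i)
  exact (EuclideanSpace.proj (𝕜 := ℝ) i).continuous.comp_aestronglyMeasurable
    h.aestronglyMeasurable

theorem integrable_mul_of_hasCompactSupport {f φ : Space N → ℝ}
    (hf : LocallyIntegrable f volume) (hφ : Continuous φ) (hc : HasCompactSupport φ) :
    Integrable (fun x => f x * φ x) volume :=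
  hf.integrable_smul_right_of_hasCompactSupport hφ hc

/-- Weak gradients are stable under dominated almost everywhere limits. -/
theorem IsW11loc.of_tendsto {un : ℕ → Space N → ℝ} {gn : ℕ → Space N → Space N}
    {U G : Space N → ℝ} (h : ∀ n, IsW11loc (un n) (gn n))
    (hU : LocallyIntegrable U volume) (hG : LocallyIntegrable G volume)
    (hunU : ∀ n, ∀ᵐ x, ‖un n x‖ ≤ U x) (hgnG : ∀ n, ∀ᵐ x, ‖gn n x‖ ≤ G x)
    (hu : ∀ᵐ x, Tendsto (fun n => un n x) atTop (𝓝 (u x)))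
    (hg : ∀ᵐ x, Tendsto (fun n => gn n x) atTop (𝓝 (g x))) : IsW11loc u g := by
  have hum : AEStronglyMeasurable u volume := aestronglyMeasurable_of_tendsto_ae atTop
    (fun n => (h n).locallyIntegrable.aestronglyMeasurable) hu
  have hgm : AEStronglyMeasurable g volume := aestronglyMeasurable_of_tendsto_ae atTop
    (fun n => (h n).locallyIntegrable_grad.aestronglyMeasurable) hg
  refine ⟨hU.mono hum ?_, hG.mono hgm ?_, fun φ hφ hc i => ?_⟩
  · filter_upwards [hu, ae_all_iff.2 hunU] with x h1 h2
    exact (le_of_tendsto h1.norm (Eventually.of_forall h2)).trans (le_abs_self _)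
  · filter_upwards [hg, ae_all_iff.2 hgnG] with x h1 h2
    exact (le_of_tendsto h1.norm (Eventually.of_forall h2)).trans (le_abs_self _)
  have hd : Continuous fun x => fderiv ℝ φ x (EuclideanSpace.single i 1) :=
    (hφ.continuous_fderiv (by simp)).clm_apply continuous_const
  have hdc : HasCompactSupport fun x => fderiv ℝ φ x (EuclideanSpace.single i 1) :=
    hc.fderiv_apply ℝ _
  have t1 : Tendsto (fun n => ∫ x, un n x * fderiv ℝ φ x (EuclideanSpace.single i 1)) atTop
      (𝓝 (∫ x, u x * fderiv ℝ φ x (EuclideanSpace.single i 1))) := by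
    refine tendsto_integral_of_dominated_convergence
      (fun x => ‖U x * fderiv ℝ φ x (EuclideanSpace.single i 1)‖)
      (fun n => ?_) ?_ (fun n => ?_) ?_
    · exact (integrable_mul_of_hasCompactSupport (h n).locallyIntegrable
        hd hdc).aestronglyMeasurable
    · exact (integrable_mul_of_hasCompactSupport hU hd hdc).norm
    · filter_upwards [hunU n] with x hx
      rw [norm_mul, norm_mul]
      exact mul_le_mul_of_nonneg_right (hx.trans (le_abs_self _)) (norm_nonneg _)
    · filter_upwards [hu] with x hx
      exact hx.mul_const _
  have t2 : Tendsto (fun n => ∫ x, gn n x i * φ x) atTop (𝓝 (∫ x, g x i * φ x)) := by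
    refine tendsto_integral_of_dominated_convergence (fun x => ‖G x * φ x‖)
      (fun n => ?_) ?_ (fun n => ?_) ?_
    · exact (integrable_mul_of_hasCompactSupport
        (locallyIntegrable_coord (h n).locallyIntegrable_grad i)
        hφ.continuous hc).aestronglyMeasurable
    · exact (integrable_mul_of_hasCompactSupport hG hφ.continuous hc).norm
    · filter_upwards [hgnG n] with x hx
      rw [norm_mul, norm_mul]
      exact mul_le_mul_of_nonneg_right
        (((PiLp.norm_apply_le _ i).trans hx).trans (le_abs_self _)) (norm_nonneg _)
    · filter_upwards [hg] with x hx
      exact (((EuclideanSpace.proj (𝕜 := ℝ) i).continuous.tendsto _).comp hx).mul_const _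
  refine tendsto_nhds_unique t1 ?_
  simp_rw [fun n => (h n).integral_eq φ hφ hc i]
  exact t2.neg

theorem IsW11loc.integral_mul_fderiv (h : IsW11loc u g) {φ : Space N → ℝ} (hφ : ContDiff ℝ ∞ φ)
    (hc : HasCompactSupport φ) (e : Space N) :
    ∫ x, u x * fderiv ℝ φ x e = - ∫ x, inner ℝ (g x) e * φ x := by
  have he : e = ∑ i, e i • EuclideanSpace.single i (1 : ℝ) := by
    ext j
    simp [Finset.sum_apply, Pi.single_apply]
  have h1 : ∀ x, u x * fderiv ℝ φ x e =
      ∑ i, e i * (u x * fderiv ℝ φ x (EuclideanSpace.single i 1)) := fun x => by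
    conv_lhs => rw [he, map_sum]
    rw [Finset.mul_sum]
    refine Finset.sum_congr rfl fun i _ => ?_
    rw [map_smul, smul_eq_mul]; ring
  have h2 : ∀ x, inner ℝ (g x) e * φ x = ∑ i, e i * (g x i * φ x) := fun x => by
    rw [PiLp.inner_apply, Finset.sum_mul]
    refine Finset.sum_congr rfl fun i _ => ?_
    simp; ring
  simp_rw [h1, h2]
  rw [integral_finsetSum, integral_finsetSum, ← Finset.sum_neg_distrib]
  · refine Finset.sum_congr rfl fun i _ => ?_
    rw [integral_const_mul, integral_const_mul, h.integral_eq φ hφ hc i, mul_neg]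
  · intro i _
    exact (integrable_mul_of_hasCompactSupport
        (locallyIntegrable_coord h.locallyIntegrable_grad i) hφ.continuous hc).const_mul _
  · intro i _
    exact (integrable_mul_of_hasCompactSupport h.locallyIntegrable
      ((hφ.continuous_fderiv (by simp)).clm_apply continuous_const)
      (hc.fderiv_apply ℝ _)).const_mul _

theorem measurable_translate_inner (hgm : Measurable g) (e : Space N) :
    Measurable fun p : Space N × ℝ => inner ℝ (g (p.1 + p.2 • e)) e := by
  have : Measurable fun p : Space N × ℝ => g (p.1 + p.2 • e) := hgm.comp (by fun_prop)
  fun_prop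

/-- Tonelli for translates along a segment. -/
theorem lintegral_lintegral_translate_le {f : Space N → ℝ≥0∞} (hf : Measurable f) {A A' : Set (Space N)}
    (hA : MeasurableSet A) (hA' : MeasurableSet A') (e : Space N)
    (hAA' : ∀ x ∈ A, ∀ t ∈ Set.Icc (0 : ℝ) 1, x + t • e ∈ A') :
    ∫⁻ x in A, ∫⁻ t in Set.Icc (0 : ℝ) 1, f (x + t • e) ≤ ∫⁻ x in A', f x := by
  rw [lintegral_lintegral_swap]
  · calc ∫⁻ t in Set.Icc (0 : ℝ) 1, ∫⁻ x in A, f (x + t • e)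
        ≤ ∫⁻ _ in Set.Icc (0 : ℝ) 1, ∫⁻ x in A', f x := by
          refine setLIntegral_mono' measurableSet_Icc fun t ht => ?_
          rw [← lintegral_indicator hA, ← lintegral_indicator hA',
            ← lintegral_add_right_eq_self (A'.indicator fun x => f x) (t • e)]
          refine lintegral_mono fun x => ?_
          by_cases hx : x ∈ A
          · rw [Set.indicator_of_mem hx, Set.indicator_of_mem (hAA' x hx t ht)]
          · rw [Set.indicator_of_notMem hx]; exact zero_le
      _ = ∫⁻ x in A', f x := by simp
  · exact (hf.comp (by fun_prop : Measurable fun p : Space N × ℝ => p.1 + p.2 • e)).aemeasurable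

theorem segment_mem_closedBall {x e : Space N} {r : ℝ} (hx : x ∈ Metric.closedBall (0 : Space N) r)
    {t : ℝ} (ht : t ∈ Set.Icc (0 : ℝ) 1) : x + t • e ∈ Metric.closedBall (0 : Space N) (r + ‖e‖) := by
  rw [mem_closedBall_zero_iff] at hx ⊢
  refine (norm_add_le _ _).trans (add_le_add hx ?_)
  rw [norm_smul, Real.norm_of_nonneg ht.1]
  exact mul_le_of_le_one_left (norm_nonneg _) ht.2

/-- Joint integrability on a ball times the unit interval, which permits Fubini for averages of `g`
along segments. -/
theorem integrable_translate_prod (hgm : Measurable g) (hg : LocallyIntegrable g volume)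
    (e : Space N) (r : ℝ) :
    Integrable (fun p : Space N × ℝ => inner ℝ (g (p.1 + p.2 • e)) e)
      ((volume.restrict (Metric.closedBall 0 r)).prod (volume.restrict (Set.Icc (0 : ℝ) 1))) := by
  refine ⟨(measurable_translate_inner hgm e).aestronglyMeasurable, ?_⟩
  rw [HasFiniteIntegral, lintegral_prod _ (measurable_translate_inner hgm e).enorm.aemeasurable]
  have hm : Measurable fun x => ‖inner ℝ (g x) e‖ₑ := by fun_prop
  refine (lintegral_lintegral_translate_le hm measurableSet_closedBall
    measurableSet_closedBall e fun x hx t ht => segment_mem_closedBall hx ht).trans_lt ?_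
  have h1 : IntegrableOn (fun x => inner ℝ (g x) e) (Metric.closedBall (0 : Space N) (r + ‖e‖)) :=
    (hg.integrableOn_isCompact (isCompact_closedBall _ _)).inner_const e
  exact h1.2

theorem locallyIntegrable_of_closedBall {E : Type*} [NormedAddCommGroup E] {f : Space N → E}
    (h : ∀ r : ℝ, IntegrableOn f (Metric.closedBall 0 r)) : LocallyIntegrable f volume := by
  rw [locallyIntegrable_iff]
  intro K hK
  obtain ⟨r, hr⟩ := hK.isBounded.subset_closedBall 0
  exact (h r).mono_set hr

theorem tsupport_subset_closedBall {φ : Space N → ℝ} (hc : HasCompactSupport φ) :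
    ∃ r : ℝ, 0 < r ∧ ∀ x, x ∉ Metric.closedBall (0 : Space N) r → φ x = 0 := by
  obtain ⟨r, hr⟩ := hc.isCompact.isBounded.subset_closedBall 0
  refine ⟨max r 1, by positivity, fun x hx => image_eq_zero_of_notMem_tsupport fun h => hx ?_⟩
  exact Metric.closedBall_subset_closedBall (le_max_left _ _) (hr h)

theorem locallyIntegrable_translate {y : Space N → ℝ} (hy : LocallyIntegrable y volume)
    (e : Space N) : LocallyIntegrable (fun x => y (x + e)) volume := by
  have := (locallyIntegrable_map_homeomorph (μ := volume) (f := y) (Homeomorph.addRight e)).1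
  rw [show Measure.map (Homeomorph.addRight e) (volume : Measure (Space N)) = volume from
    map_add_right_eq_self volume _] at this
  exact this hy

/-- A function with a weak gradient satisfies the fundamental theorem of calculus along almost every
segment in a given direction. -/
theorem IsW11loc.translate_sub (h : IsW11loc u g) (hgm : Measurable g) (e : Space N) :
    ∀ᵐ x, u (x + e) - u x = ∫ t in Set.Icc (0 : ℝ) 1, inner ℝ (g (x + t • e)) e := by
  have hue := locallyIntegrable_translate h.locallyIntegrable e
  have hR : LocallyIntegrable
      (fun x => ∫ t in Set.Icc (0 : ℝ) 1, inner ℝ (g (x + t • e)) e) volume :=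
    locallyIntegrable_of_closedBall fun r =>
      (integrable_translate_prod hgm h.locallyIntegrable_grad e r).integral_prod_left
  -- Both sides are tested against `φ`. Translations and the weak derivative are moved onto `φ`, and
  -- the integral over `t` of `fderiv ℝ φ (x - t • e) e` equals `φ x - φ (x - e)`.
  refine ae_eq_of_integral_contDiff_smul_eq (hue.sub h.locallyIntegrable) hR fun φ hφ hc => ?_
  obtain ⟨r, hr0, hr⟩ := tsupport_subset_closedBall hc
  have hφc := hφ.continuous
  have hdiff : Differentiable ℝ φ := hφ.differentiable (by simp)
  simp only [smul_eq_mul]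
  -- the right-hand side
  have e1 : ∫ x, φ x * ∫ t in Set.Icc (0 : ℝ) 1, inner ℝ (g (x + t • e)) e =
      ∫ t in Set.Icc (0 : ℝ) 1, ∫ x, φ x * inner ℝ (g (x + t • e)) e := by
    have : Integrable (fun p : Space N × ℝ => φ p.1 * inner ℝ (g (p.1 + p.2 • e)) e)
        (volume.prod (volume.restrict (Set.Icc (0 : ℝ) 1))) := by
      have h1 := integrable_translate_prod hgm h.locallyIntegrable_grad e r
      have h2 : Measure.prod (volume.restrict (Metric.closedBall (0 : Space N) r))
          (volume.restrict (Set.Icc (0 : ℝ) 1)) =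
          (volume.prod (volume.restrict (Set.Icc (0 : ℝ) 1))).restrict
            (Metric.closedBall (0 : Space N) r ×ˢ Set.univ) := by
        rw [← Measure.prod_restrict, Measure.restrict_univ]
      rw [h2, ← IntegrableOn] at h1
      obtain ⟨C, hC⟩ := hφc.bounded_above_of_compact_support hc
      have h3 : IntegrableOn (fun p : Space N × ℝ => φ p.1 * inner ℝ (g (p.1 + p.2 • e)) e)
          (Metric.closedBall (0 : Space N) r ×ˢ Set.univ)
          (volume.prod (volume.restrict (Set.Icc (0 : ℝ) 1))) := by
        refine h1.bdd_mul (c := C) ?_ (Eventually.of_forall fun p => hC p.1)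
        exact (hφc.comp continuous_fst).aestronglyMeasurable
      refine h3.integrable_of_forall_notMem_eq_zero fun p hp => ?_
      have : p.1 ∉ Metric.closedBall (0 : Space N) r := fun h => hp ⟨h, trivial⟩
      rw [hr _ this, zero_mul]
    rw [← integral_integral_swap (f := fun x t => φ x * inner ℝ (g (x + t • e)) e) this]
    simp_rw [integral_const_mul]
  have e2 : ∀ t : ℝ, ∫ x, φ x * inner ℝ (g (x + t • e)) e =
      - ∫ x, u x * fderiv ℝ φ (x - t • e) e := fun t => by
    have hs : ContDiff ℝ ∞ fun x => φ (x - t • e) := hφ.comp (contDiff_id.sub contDiff_const)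
    have hsc : HasCompactSupport fun x => φ (x - t • e) :=
      hc.comp_homeomorph (Homeomorph.subRight (t • e))
    have := h.integral_mul_fderiv hs hsc e
    simp_rw [fun x => show fderiv ℝ (fun x => φ (x - t • e)) x = fderiv ℝ φ (x - t • e) from
      fderiv_comp_sub (t • e)] at this
    rw [this, neg_neg,
      ← integral_add_right_eq_self (fun x => inner ℝ (g x) e * φ (x - t • e)) (t • e)]
    simp only [add_sub_cancel_right]
    exact integral_congr_ae (Eventually.of_forall fun x => mul_comm _ _)
  -- the left-hand side
  have e3 : ∫ t in Set.Icc (0 : ℝ) 1, ∫ x, u x * fderiv ℝ φ (x - t • e) e =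
      ∫ x, u x * (φ x - φ (x - e)) := by
    have hfc : Continuous fun x => fderiv ℝ φ x e :=
      (hφ.continuous_fderiv (by simp)).clm_apply continuous_const
    obtain ⟨C, hC⟩ := hfc.bounded_above_of_compact_support (hc.fderiv_apply ℝ e)
    have : Integrable (fun p : Space N × ℝ => u p.1 * fderiv ℝ φ (p.1 - p.2 • e) e)
        (volume.prod (volume.restrict (Set.Icc (0 : ℝ) 1))) := by
      have h1 : Integrable (fun p : Space N × ℝ => u p.1)
          ((volume.restrict (Metric.closedBall (0 : Space N) (r + ‖e‖))).prod
          (volume.restrict (Set.Icc (0 : ℝ) 1))) :=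
        (show Integrable u (volume.restrict (Metric.closedBall (0 : Space N) (r + ‖e‖))) from
          h.locallyIntegrable.integrableOn_isCompact (isCompact_closedBall _ _)).comp_fst _
      have h3 : Integrable (fun p : Space N × ℝ => u p.1 * fderiv ℝ φ (p.1 - p.2 • e) e)
          ((volume.restrict (Metric.closedBall (0 : Space N) (r + ‖e‖))).prod
          (volume.restrict (Set.Icc (0 : ℝ) 1))) := by
        refine h1.mul_bdd (c := C) ?_ (Eventually.of_forall fun p => hC _)
        exact (hfc.comp (by fun_prop :
          Continuous fun p : Space N × ℝ => p.1 - p.2 • e)).aestronglyMeasurable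
      rw [Measure.prod_restrict] at h3
      have h4 : (volume : Measure (Space N)).prod (volume.restrict (Set.Icc (0 : ℝ) 1)) =
          (volume.prod volume).restrict (Set.univ ×ˢ Set.Icc (0 : ℝ) 1) := by
        rw [← Measure.prod_restrict, Measure.restrict_univ]
      rw [h4]
      refine IntegrableOn.of_forall_sdiff_eq_zero h3 (MeasurableSet.univ.prod measurableSet_Icc) ?_
      rintro ⟨x, t⟩ ⟨⟨_, ht⟩, hx⟩
      have hx' : x ∉ Metric.closedBall (0 : Space N) (r + ‖e‖) := fun h => hx ⟨h, ht⟩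
      have : x - t • e ∉ tsupport φ := fun hm => by
        have hb : x - t • e ∈ Metric.closedBall (0 : Space N) r := by
          have : tsupport φ ⊆ Metric.closedBall (0 : Space N) r := by
            refine closure_minimal (fun y hy => ?_) Metric.isClosed_closedBall
            by_contra hcon
            exact hy (hr y hcon)
          exact this hm
        have := segment_mem_closedBall (e := e) hb ht
        simp only [sub_add_cancel] at this
        exact hx' this
      have h0 : fderiv ℝ φ (x - t • e) = 0 := by
        have := (tsupport_fderiv_subset ℝ (f := φ))
        exact image_eq_zero_of_notMem_tsupport fun h => ‹x - t • e ∉ tsupport φ› (this h)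
      simp [h0]
    rw [← integral_integral_swap (f := fun x t => u x * fderiv ℝ φ (x - t • e) e) this]
    refine integral_congr_ae (Eventually.of_forall fun x => ?_)
    simp only
    rw [integral_const_mul]
    congr 1
    have hder : ∀ t ∈ Set.uIcc (0 : ℝ) 1,
        HasDerivAt (fun t : ℝ => - φ (x - t • e)) (fderiv ℝ φ (x - t • e) e) t := fun t _ => by
      have h1 : HasDerivAt (fun t : ℝ => x - t • e) (-e) t := by
        simpa using ((hasDerivAt_id t).smul_const e).const_sub x
      have h2 := ((hdiff (x - t • e)).hasFDerivAt.comp_hasDerivAt t h1).neg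
      rw [map_neg, neg_neg] at h2
      exact h2
    rw [integral_Icc_eq_integral_Ioc, ← intervalIntegral.integral_of_le zero_le_one,
      intervalIntegral.integral_eq_sub_of_hasDerivAt hder]
    · simp; ring
    · exact (hfc.comp (by fun_prop : Continuous fun t : ℝ => x - t • e)).intervalIntegrable _ _
  rw [e1]
  simp_rw [e2]
  rw [integral_neg, e3, ← integral_neg]
  have e4 : ∫ x, φ x * u (x + e) = ∫ x, φ (x - e) * u x := by
    rw [← integral_add_right_eq_self (fun x => φ (x - e) * u x) e]
    simp
  have i1 : Integrable (fun x => φ x * u (x + e)) :=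
    hue.integrable_smul_left_of_hasCompactSupport hφc hc
  have i2 : Integrable (fun x => φ x * u x) :=
    h.locallyIntegrable.integrable_smul_left_of_hasCompactSupport hφc hc
  have i3 : Integrable (fun x => φ (x - e) * u x) :=
    h.locallyIntegrable.integrable_smul_left_of_hasCompactSupport
      (hφc.comp (by fun_prop)) (hc.comp_homeomorph (Homeomorph.subRight e))
  simp only [mul_sub]
  rw [integral_sub i1 i2, e4, ← integral_sub i3 i2]
  refine integral_congr_ae (Eventually.of_forall fun x => ?_)
  simp only; ring

/-- Continuity in `L¹` of composition with the measure preserving maps `x ↦ x + e`, evaluated at `e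
= 0`. -/
theorem tendsto_lintegral_translate_sub {f : Space N → ℝ} (hf : Integrable f volume) :
    Tendsto (fun e : Space N => ∫⁻ x, ‖f (x + e) - f x‖ₑ) (𝓝 0) (𝓝 0) := by
  have hmp : ∀ e : Space N, MeasurePreserving (fun x : Space N => x + e) volume volume :=
    fun e => measurePreserving_add_right volume e
  let G : Space N → C(Space N, Space N) := fun e => ⟨fun x => x + e, by fun_prop⟩
  have hG : Continuous G := ContinuousMap.continuous_of_continuous_uncurry G
    (show Continuous fun p : Space N × Space N => p.2 + p.1 by fun_prop)
  have hm : MemLp f 1 volume := memLp_one_iff_integrable.2 hf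
  have hc := (continuous_const (y := hm.toLp f)).compMeasurePreservingLp hG
    (fun e => hmp e) ENNReal.one_ne_top
  have h1 := (tendsto_iff_edist_tendsto_0.1 (hc.tendsto 0))
  refine h1.congr fun e => ?_
  have e0 : Lp.compMeasurePreserving (G 0) (hmp 0) (hm.toLp f) = hm.toLp f := by
    rw [Lp.toLp_compMeasurePreserving hm]
    congr 1
    funext x
    simp [G]
  rw [e0, Lp.toLp_compMeasurePreserving hm, Lp.edist_toLp_toLp, eLpNorm_one_eq_lintegral_enorm]
  rfl

theorem LocallyIntegrable.tendsto_lintegral_translate_sub {f : Space N → ℝ}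
    (hf : LocallyIntegrable f volume) (r : ℝ) :
    Tendsto (fun e : Space N => ∫⁻ x in Metric.closedBall 0 r, ‖f (x + e) - f x‖ₑ)
      (𝓝 0) (𝓝 0) := by
  have hi : Integrable ((Metric.closedBall (0 : Space N) (r + 1)).indicator f) volume :=
    (integrable_indicator_iff measurableSet_closedBall).2
      (hf.integrableOn_isCompact (isCompact_closedBall _ _))
  refine tendsto_of_tendsto_of_tendsto_of_le_of_le' tendsto_const_nhds
    (Droplets.tendsto_lintegral_translate_sub hi) (Eventually.of_forall fun _ => zero_le) ?_
  filter_upwards [Metric.closedBall_mem_nhds (0 : Space N) one_pos] with e he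
  refine (setLIntegral_mono' measurableSet_closedBall fun x hx => ?_).trans
    (setLIntegral_le_lintegral _ _)
  rw [mem_closedBall_zero_iff] at he hx
  rw [Set.indicator_of_mem, Set.indicator_of_mem]
  · rw [mem_closedBall_zero_iff]; linarith
  · rw [mem_closedBall_zero_iff]
    exact (norm_add_le _ _).trans (add_le_add hx he)

/-- Difference quotients converge locally in `L¹` to the directional weak derivative. -/
theorem IsW11loc.tendsto_slope (h : IsW11loc u g) (hgm : Measurable g) (e : Space N) (r : ℝ) :
    Tendsto (fun t : ℝ => ∫⁻ x in Metric.closedBall 0 r,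
      ‖t⁻¹ * (u (x + t • e) - u x) - inner ℝ (g x) e‖ₑ) (𝓝[>] 0) (𝓝 0) := by
  have hfm : Measurable fun x => inner ℝ (g x) e := by fun_prop
  have hf : LocallyIntegrable (fun x => inner ℝ (g x) e) volume :=
    locallyIntegrable_of_closedBall fun r =>
      (h.locallyIntegrable_grad.integrableOn_isCompact (isCompact_closedBall _ _)).inner_const e
  have hT := LocallyIntegrable.tendsto_lintegral_translate_sub hf r
  rw [ENNReal.tendsto_nhds_zero] at hT ⊢
  intro η hη
  obtain ⟨ρ, hρ, hball⟩ := Metric.eventually_nhds_iff_ball.1 (hT η hη)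
  have hev : ∀ᶠ t : ℝ in 𝓝[>] 0, ∀ s ∈ Set.Icc (0 : ℝ) 1, (s * t) • e ∈ Metric.ball (0 : Space N) ρ := by
    have h1 : Tendsto (fun t : ℝ => t * ‖e‖) (𝓝[>] 0) (𝓝 0) := by
      have : Tendsto (fun t : ℝ => t * ‖e‖) (𝓝 0) (𝓝 (0 * ‖e‖)) := tendsto_id.mul_const _
      rw [zero_mul] at this
      exact this.mono_left nhdsWithin_le_nhds
    filter_upwards [h1.eventually_lt_const hρ, self_mem_nhdsWithin] with t ht (ht0 : 0 < t) s hs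
    rw [mem_ball_zero_iff, norm_smul, Real.norm_of_nonneg (mul_nonneg hs.1 ht0.le)]
    refine lt_of_le_of_lt ?_ ht
    exact mul_le_mul_of_nonneg_right (mul_le_of_le_one_left ht0.le hs.2) (norm_nonneg _)
  filter_upwards [hev, self_mem_nhdsWithin] with t ht (ht0 : 0 < t)
  have hint := (integrable_translate_prod hgm h.locallyIntegrable_grad (t • e) r).prod_right_ae
  -- By the fundamental theorem of calculus the error is the average over `s ∈ [0, 1]` of `⟨g (x + s
  -- t e) - g x, e⟩`; Tonelli and the continuity of translations in `L¹` make it small.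
  calc ∫⁻ x in Metric.closedBall 0 r, ‖t⁻¹ * (u (x + t • e) - u x) - inner ℝ (g x) e‖ₑ
      ≤ ∫⁻ x in Metric.closedBall 0 r, ∫⁻ s in Set.Icc (0 : ℝ) 1,
          ‖inner ℝ (g (x + (s * t) • e)) e - inner ℝ (g x) e‖ₑ := by
        refine lintegral_mono_ae ?_
        filter_upwards [ae_restrict_of_ae (h.translate_sub hgm (t • e)), hint] with x hx hxi
        have hxi' : Integrable (fun s : ℝ => inner ℝ (g (x + (s * t) • e)) e)
            (volume.restrict (Set.Icc (0 : ℝ) 1)) := by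
          refine (hxi.const_mul t⁻¹).congr (Eventually.of_forall fun s => ?_)
          simp only [inner_smul_right, smul_smul]
          field_simp
        have : t⁻¹ * (u (x + t • e) - u x) - inner ℝ (g x) e =
            ∫ s in Set.Icc (0 : ℝ) 1, (inner ℝ (g (x + (s * t) • e)) e - inner ℝ (g x) e) := by
          rw [integral_sub hxi' (integrable_const _), hx, ← integral_const_mul]
          congr 1
          · refine integral_congr_ae (Eventually.of_forall fun s => ?_)
            simp only [inner_smul_right, smul_smul]
            field_simp
          · simp
        rw [this]
        exact enorm_integral_le_lintegral_enorm _
    _ = ∫⁻ s in Set.Icc (0 : ℝ) 1, ∫⁻ x in Metric.closedBall 0 r,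
          ‖inner ℝ (g (x + (s * t) • e)) e - inner ℝ (g x) e‖ₑ := by
        rw [lintegral_lintegral_swap]
        have h1 : Measurable fun p : Space N × ℝ => g (p.1 + (p.2 * t) • e) :=
          hgm.comp (by fun_prop)
        have h2 : Measurable fun p : Space N × ℝ => g p.1 := hgm.comp measurable_fst
        refine Measurable.aemeasurable ?_
        simp only [Function.uncurry_def]
        fun_prop
    _ ≤ ∫⁻ _ in Set.Icc (0 : ℝ) 1, η :=
        setLIntegral_mono' measurableSet_Icc fun s hs => hball _ (ht s hs)
    _ = η := by simp

/-- A change of variables moves the difference quotient onto `φ`, with `e` replaced by `-e`. There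
it converges since `φ` is Lipschitz, and `y` may be cut to a ball, where it is integrable. -/
theorem tendsto_integral_slope_mul {y φ : Space N → ℝ} (hy : LocallyIntegrable y volume)
    (hφ : ContDiff ℝ 1 φ) (hc : HasCompactSupport φ) (e : Space N) :
    Tendsto (fun t : ℝ => ∫ x, (t⁻¹ * (y (x + t • e) - y x)) * φ x) (𝓝[>] 0)
      (𝓝 (- ∫ x, y x * fderiv ℝ φ x e)) := by
  obtain ⟨r, hr0, hr⟩ := tsupport_subset_closedBall hc
  obtain ⟨C, hC⟩ := hφ.lipschitzWith_of_hasCompactSupport hc (by simp)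
  have hφc := hφ.continuous
  set B := Metric.closedBall (0 : Space N) (r + ‖e‖) with hB
  have hi : Integrable (B.indicator y) volume :=
    (integrable_indicator_iff measurableSet_closedBall).2
      (hy.integrableOn_isCompact (isCompact_closedBall _ _))
  have key := hC.integral_inv_smul_sub_mul_tendsto_integral_lineDeriv_mul (μ := volume) hi (-e)
  have hlim : ∫ x, lineDeriv ℝ φ x (-e) * B.indicator y x = - ∫ x, y x * fderiv ℝ φ x e := by
    rw [← integral_neg]
    refine integral_congr_ae (Eventually.of_forall fun x => ?_)
    simp only
    rw [((hφ.differentiable (by simp)) x).lineDeriv_eq_fderiv, map_neg]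
    by_cases hx : x ∈ B
    · rw [Set.indicator_of_mem hx]; ring
    · have : fderiv ℝ φ x = 0 := by
        refine image_eq_zero_of_notMem_tsupport fun h' => hx ?_
        have h1 := tsupport_fderiv_subset ℝ h'
        have h2 : tsupport φ ⊆ Metric.closedBall (0 : Space N) r := by
          refine closure_minimal (fun y hy => ?_) Metric.isClosed_closedBall
          by_contra hcon
          exact hy (hr y hcon)
        exact Metric.closedBall_subset_closedBall (by linarith [norm_nonneg e]) (h2 h1)
      simp [this]
  rw [hlim] at key
  refine key.congr' ?_
  have hev : ∀ᶠ t : ℝ in 𝓝[>] 0, t ≤ 1 :=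
    nhdsWithin_le_nhds (eventually_le_nhds zero_lt_one)
  filter_upwards [hev, self_mem_nhdsWithin] with t ht1 (ht0 : 0 < t)
  have hyt := locallyIntegrable_translate hy (t • e)
  have e1 : ∀ x, (t⁻¹ • (φ (x + t • -e) - φ x)) * B.indicator y x =
      t⁻¹ * (φ (x - t • e) * y x - φ x * y x) := fun x => by
    rw [smul_neg, ← sub_eq_add_neg, smul_eq_mul]
    by_cases hx : x ∈ B
    · rw [Set.indicator_of_mem hx]; ring
    · rw [Set.indicator_of_notMem hx]
      have h1 : φ x = 0 := hr _ fun h' => hx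
        (Metric.closedBall_subset_closedBall (by linarith [norm_nonneg e]) h')
      have h2 : φ (x - t • e) = 0 := hr _ fun h' => hx <| by
        have := segment_mem_closedBall (e := e) h' ⟨ht0.le, ht1⟩
        simpa [hB] using this
      rw [h1, h2]; ring
  simp_rw [e1]
  have e2 : ∀ x, t⁻¹ * (y (x + t • e) - y x) * φ x =
      t⁻¹ * (φ x * y (x + t • e) - φ x * y x) := fun x => by ring
  simp_rw [e2]
  rw [integral_const_mul, integral_const_mul, integral_sub, integral_sub]
  · congr 2
    rw [← integral_add_right_eq_self (fun x => φ (x - t • e) * y x) (t • e)]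
    simp
  · exact hyt.integrable_smul_left_of_hasCompactSupport hφc hc
  · exact hy.integrable_smul_left_of_hasCompactSupport hφc hc
  · exact hy.integrable_smul_left_of_hasCompactSupport
      (hφc.comp (by fun_prop)) (hc.comp_homeomorph (Homeomorph.subRight (t • e)))
  · exact hy.integrable_smul_left_of_hasCompactSupport hφc hc

theorem tendsto_integral_mul_of_tendsto_lintegral {ι : Type*} {l : Filter ι}
    {F : ι → Space N → ℝ} {f φ : Space N → ℝ} {r : ℝ}
    (hF : ∀ i, LocallyIntegrable (F i) volume) (hf : LocallyIntegrable f volume)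
    (hφ : Continuous φ) (hc : HasCompactSupport φ)
    (hr : ∀ x, x ∉ Metric.closedBall (0 : Space N) r → φ x = 0)
    (h : Tendsto (fun i => ∫⁻ x in Metric.closedBall 0 r, ‖F i x - f x‖ₑ) l (𝓝 0)) :
    Tendsto (fun i => ∫ x, F i x * φ x) l (𝓝 (∫ x, f x * φ x)) := by
  obtain ⟨C, hC⟩ := hφ.bounded_above_of_compact_support hc
  refine tendsto_integral_of_L1 _
    (integrable_mul_of_hasCompactSupport hf hφ hc).aestronglyMeasurable
    (Eventually.of_forall fun i => integrable_mul_of_hasCompactSupport (hF i) hφ hc) ?_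
  have h2 : Tendsto (fun i => ENNReal.ofReal C *
      ∫⁻ x in Metric.closedBall 0 r, ‖F i x - f x‖ₑ) l (𝓝 0) := by
    have := ENNReal.Tendsto.const_mul (a := ENNReal.ofReal C) h (Or.inr ENNReal.ofReal_ne_top)
    rwa [mul_zero] at this
  refine tendsto_of_tendsto_of_tendsto_of_le_of_le tendsto_const_nhds h2 (fun _ => zero_le)
    fun i => ?_
  simp only
  rw [← lintegral_indicator measurableSet_closedBall, ← lintegral_const_mul' _ _ ENNReal.ofReal_ne_top]
  refine lintegral_mono fun x => ?_
  rw [← sub_mul, enorm_mul, mul_comm]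
  by_cases hx : x ∈ Metric.closedBall (0 : Space N) r
  · rw [Set.indicator_of_mem hx]
    gcongr
    rw [← ofReal_norm]
    exact ENNReal.ofReal_le_ofReal (hC x)
  · rw [hr x hx]; simp

theorem locallyIntegrable_slope {y : Space N → ℝ} (hy : LocallyIntegrable y volume)
    (e : Space N) (t : ℝ) :
    LocallyIntegrable (fun x => t⁻¹ * (y (x + t • e) - y x)) volume :=
  ((locallyIntegrable_translate hy _).sub hy).smul t⁻¹

/-- The integration by parts formula holds for test functions of class `C¹`. -/
theorem IsW11loc.integral_mul_fderiv_of_contDiff_one (h : IsW11loc u g) (hgm : Measurable g)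
    {φ : Space N → ℝ} (hφ : ContDiff ℝ 1 φ) (hc : HasCompactSupport φ) (e : Space N) :
    ∫ x, u x * fderiv ℝ φ x e = - ∫ x, inner ℝ (g x) e * φ x := by
  obtain ⟨r, hr0, hr⟩ := tsupport_subset_closedBall hc
  have hf : LocallyIntegrable (fun x => inner ℝ (g x) e) volume :=
    locallyIntegrable_of_closedBall fun r =>
      (h.locallyIntegrable_grad.integrableOn_isCompact (isCompact_closedBall _ _)).inner_const e
  have h1 := tendsto_integral_slope_mul h.locallyIntegrable hφ hc e
  have h2 := tendsto_integral_mul_of_tendsto_lintegral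
    (fun t => locallyIntegrable_slope h.locallyIntegrable e t) hf hφ.continuous hc hr
    (h.tendsto_slope hgm e r)
  -- Both are limits of the integral of the difference quotient of `u` against `φ`, and neither
  -- needs more than `C¹`. Cutoffs of class `C¹` can thus be multiplied into test functions.
  rw [← tendsto_nhds_unique h1 h2, neg_neg]

/-! ### Chain and product rules, including singular derivatives -/

theorem inner_single_one (x : Space N) (i : Fin N) :
    inner ℝ x (EuclideanSpace.single i (1 : ℝ)) = x i := by
  simp [EuclideanSpace.inner_single_right]

/-- Dominated convergence with a dominating sequence that itself converges in `L¹`: the truncated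
difference `‖Q n - q‖ - C ‖D n - d‖` is bounded by the fixed integrable function `2 C ‖d‖`. -/
theorem tendsto_lintegral_of_tendsto_ae_of_le {α : Type*} [MeasurableSpace α] {μ : Measure α}
    {D Q : ℕ → α → ℝ} {d q : α → ℝ} {C : ℝ≥0} (hD : ∀ n, AEStronglyMeasurable (D n) μ)
    (hQ : ∀ n, AEStronglyMeasurable (Q n) μ) (hd : Integrable d μ)
    (hDd : Tendsto (fun n => ∫⁻ x, ‖D n x - d x‖ₑ ∂μ) atTop (𝓝 0))
    (hDae : ∀ᵐ x ∂μ, Tendsto (fun n => D n x) atTop (𝓝 (d x)))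
    (hQae : ∀ᵐ x ∂μ, Tendsto (fun n => Q n x) atTop (𝓝 (q x)))
    (hle : ∀ n x, ‖Q n x‖ₑ ≤ C * ‖D n x‖ₑ) :
    Tendsto (fun n => ∫⁻ x, ‖Q n x - q x‖ₑ ∂μ) atTop (𝓝 0) := by
  have hqm : AEStronglyMeasurable q μ := aestronglyMeasurable_of_tendsto_ae atTop hQ hQae
  have hqd : ∀ᵐ x ∂μ, ‖q x‖ₑ ≤ C * ‖d x‖ₑ := by
    filter_upwards [hDae, hQae] with x h1 h2
    exact le_of_tendsto_of_tendsto' h2.enorm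
      (ENNReal.Tendsto.const_mul h1.enorm (Or.inr ENNReal.coe_ne_top)) fun n => hle n x
  have hF : Tendsto (fun n => ∫⁻ x, (‖Q n x - q x‖ₑ - C * ‖D n x - d x‖ₑ) ∂μ) atTop
      (𝓝 (∫⁻ _, 0 ∂μ)) := by
    refine tendsto_lintegral_of_dominated_convergence' (fun x => 2 * C * ‖d x‖ₑ)
      (fun n => ?_) (fun n => ?_) ?_ ?_
    · exact ((hQ n).sub hqm).enorm.sub
        (((hD n).sub hd.aestronglyMeasurable).enorm.const_mul _)
    · filter_upwards [hqd] with x hx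
      rw [tsub_le_iff_right]
      calc ‖Q n x - q x‖ₑ ≤ ‖Q n x‖ₑ + ‖q x‖ₑ := enorm_sub_le
        _ ≤ C * ‖D n x‖ₑ + C * ‖d x‖ₑ := add_le_add (hle n x) hx
        _ ≤ C * (‖D n x - d x‖ₑ + ‖d x‖ₑ) + C * ‖d x‖ₑ := by
          gcongr
          calc ‖D n x‖ₑ = ‖(D n x - d x) + d x‖ₑ := by rw [sub_add_cancel]
            _ ≤ _ := enorm_add_le _ _
        _ = 2 * C * ‖d x‖ₑ + C * ‖D n x - d x‖ₑ := by ring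
    · rw [lintegral_const_mul' _ _ (by finiteness)]
      exact ENNReal.mul_ne_top (by finiteness) hd.2.ne
    · filter_upwards [hQae] with x hx
      have h0 : Tendsto (fun n => ‖Q n x - q x‖ₑ) atTop (𝓝 0) := by
        have := (hx.sub_const (q x)).enorm
        simpa using this
      exact tendsto_of_tendsto_of_tendsto_of_le_of_le tendsto_const_nhds h0 (fun _ => zero_le)
        fun n => tsub_le_self
  have hG : Tendsto (fun n => C * ∫⁻ x, ‖D n x - d x‖ₑ ∂μ) atTop (𝓝 0) := by
    have := ENNReal.Tendsto.const_mul (a := (C : ℝ≥0∞)) hDd (Or.inr ENNReal.coe_ne_top)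
    rwa [mul_zero] at this
  have hsum := hF.add hG
  rw [lintegral_zero, add_zero] at hsum
  refine tendsto_of_tendsto_of_tendsto_of_le_of_le tendsto_const_nhds hsum (fun _ => zero_le)
    fun n => ?_
  simp only
  rw [← lintegral_const_mul' _ _ ENNReal.coe_ne_top, ← lintegral_add_right']
  · exact lintegral_mono fun x => le_tsub_add
  · exact ((hD n).sub hd.aestronglyMeasurable).enorm.const_mul _

/-- Chain rule for a Lipschitz function that is differentiable everywhere. -/
theorem IsW11loc.comp_lipschitz (h : IsW11loc u g) (hgm : Measurable g) {T T' : ℝ → ℝ} {C : ℝ≥0}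
    (hT : LipschitzWith C T) (hT' : ∀ r, HasDerivAt T (T' r) r) :
    IsW11loc (fun x => T (u x)) (fun x => T' (u x) • g x) := by
  have hTm : Measurable T' := by
    rw [show T' = deriv T from funext fun r => (hT' r).deriv.symm]
    exact measurable_deriv T
  have hTC : ∀ r, ‖T' r‖ ≤ C := fun r => by
    rw [← (hT' r).deriv]; exact norm_deriv_le_of_lipschitz hT
  have hum := h.locallyIntegrable.aestronglyMeasurable
  have hTu : LocallyIntegrable (fun x => T (u x)) volume := by
    have hn : LocallyIntegrable (fun x => ‖u x‖) volume := h.locallyIntegrable.mono hum.norm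
      (Eventually.of_forall fun x => (norm_norm _).le)
    refine ((locallyIntegrable_const ‖T 0‖).add (hn.smul (C : ℝ))).mono
      (hT.continuous.comp_aestronglyMeasurable hum) (Eventually.of_forall fun x => ?_)
    have h1 := hT.dist_le_mul (u x) 0
    rw [dist_eq_norm, dist_zero_right] at h1
    have h2 : ‖T (u x)‖ ≤ ‖T 0‖ + C * ‖u x‖ := by
      calc ‖T (u x)‖ = ‖T 0 + (T (u x) - T 0)‖ := by rw [add_sub_cancel]
        _ ≤ _ := (norm_add_le _ _).trans (by gcongr)
    exact h2.trans (le_abs_self _)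
  have hT'm : AEStronglyMeasurable (fun x => T' (u x)) volume :=
    (hTm.comp_aemeasurable hum.aemeasurable).aestronglyMeasurable
  refine ⟨hTu, ?_, fun φ hφ hc i => ?_⟩
  · refine (h.locallyIntegrable_grad.smul (C : ℝ)).mono
      (hT'm.smul h.locallyIntegrable_grad.aestronglyMeasurable) (Eventually.of_forall fun x => ?_)
    rw [norm_smul, Pi.smul_apply, norm_smul]
    exact mul_le_mul_of_nonneg_right ((hTC _).trans (le_abs_self _)) (norm_nonneg _)
  obtain ⟨r, hr0, hr⟩ := tsupport_subset_closedBall hc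
  set e : Space N := EuclideanSpace.single i 1 with he
  have hf : LocallyIntegrable (fun x => inner ℝ (g x) e) volume :=
    locallyIntegrable_of_closedBall fun r =>
      (h.locallyIntegrable_grad.integrableOn_isCompact (isCompact_closedBall _ _)).inner_const e
  have hφ1 : ContDiff ℝ 1 φ := hφ.of_le (by simp)
  have tt : Tendsto (fun n : ℕ => 1 / ((n : ℝ) + 1)) atTop (𝓝[>] 0) :=
    tendsto_nhdsWithin_iff.2 ⟨tendsto_one_div_add_atTop_nhds_zero_nat,
      Eventually.of_forall fun n => Set.mem_Ioi.2 (by positivity)⟩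
  have hDm : ∀ t : ℝ, LocallyIntegrable (fun x => t⁻¹ * (u (x + t • e) - u x)) volume :=
    fun t => locallyIntegrable_slope h.locallyIntegrable e t
  have hQm : ∀ t : ℝ, LocallyIntegrable (fun x => t⁻¹ * (T (u (x + t • e)) - T (u x))) volume :=
    fun t => locallyIntegrable_slope hTu e t
  have hL := (h.tendsto_slope hgm e r).comp tt
  -- Along a subsequence the difference quotients of `u` converge almost everywhere. There those of
  -- `T ∘ u` converge by differentiability of `T`, and the Lipschitz bound dominates them by those
  -- of `u`.
  obtain ⟨ns, hns, hae⟩ := (tendstoInMeasure_of_tendsto_eLpNorm (p := 1) one_ne_zero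
    (μ := volume.restrict (Metric.closedBall (0 : Space N) r))
    (f := fun (n : ℕ) x => (1 / ((n : ℝ) + 1))⁻¹ * (u (x + (1 / ((n : ℝ) + 1)) • e) - u x))
    (g := fun x => inner ℝ (g x) e)
    (fun n => (hDm _).aestronglyMeasurable.restrict) hf.aestronglyMeasurable.restrict
    (by simpa only [eLpNorm_one_eq_lintegral_enorm] using! hL)).exists_seq_tendsto_ae
  set tn : ℕ → ℝ := fun n => 1 / ((ns n : ℝ) + 1) with htn
  have htn0 : Tendsto tn atTop (𝓝[>] 0) := tt.comp hns.tendsto_atTop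
  have htn0' : Tendsto tn atTop (𝓝 0) := htn0.mono_right nhdsWithin_le_nhds
  have hQae : ∀ᵐ x ∂(volume.restrict (Metric.closedBall (0 : Space N) r)),
      Tendsto (fun n => (tn n)⁻¹ * (T (u (x + tn n • e)) - T (u x))) atTop
        (𝓝 (T' (u x) * inner ℝ (g x) e)) := by
    filter_upwards [hae] with x hx
    have hd : Tendsto (fun n => u (x + tn n • e) - u x) atTop (𝓝 0) := by
      have h1 := htn0'.mul hx
      rw [zero_mul] at h1
      refine h1.congr fun n => ?_
      have : (ns n : ℝ) + 1 ≠ 0 := by positivity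
      simp only [htn]
      field_simp
    have := (hasFDerivWithinAt_univ.2 (hT' (u x)).hasFDerivAt).lim (c := fun n => (tn n)⁻¹)
      (l := atTop) (d := fun n => u (x + tn n • e) - u x) hd
      (Eventually.of_forall fun _ => trivial) hx
    simpa [mul_comm] using this
  have hlim := tendsto_lintegral_of_tendsto_ae_of_le (C := C)
    (μ := volume.restrict (Metric.closedBall (0 : Space N) r))
    (D := fun n x => (tn n)⁻¹ * (u (x + tn n • e) - u x))
    (Q := fun n x => (tn n)⁻¹ * (T (u (x + tn n • e)) - T (u x)))
    (fun n => (hDm _).aestronglyMeasurable.restrict)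
    (fun n => (hQm _).aestronglyMeasurable.restrict)
    (hf.integrableOn_isCompact (isCompact_closedBall _ _))
    (hL.comp hns.tendsto_atTop) hae hQae (fun n x => by
      rw [enorm_mul, enorm_mul, mul_left_comm]
      gcongr
      have := hT (u (x + tn n • e)) (u x)
      rwa [edist_eq_enorm_sub, edist_eq_enorm_sub] at this)
  have hfT : LocallyIntegrable (fun x => T' (u x) * inner ℝ (g x) e) volume := by
    refine (hf.smul (C : ℝ)).mono (hT'm.mul hf.aestronglyMeasurable)
      (Eventually.of_forall fun x => ?_)
    rw [norm_mul, Pi.smul_apply, norm_smul]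
    exact mul_le_mul_of_nonneg_right ((hTC _).trans (le_abs_self _)) (norm_nonneg _)
  have h1 := (tendsto_integral_slope_mul hTu hφ1 hc e).comp htn0
  have h2 := tendsto_integral_mul_of_tendsto_lintegral (fun n => hQm (tn n)) hfT hφ.continuous hc hr
    hlim
  have h3 := tendsto_nhds_unique h1 h2
  rw [← neg_eq_iff_eq_neg, h3]
  refine integral_congr_ae (Eventually.of_forall fun x => ?_)
  simp only [he, inner_single_one, PiLp.smul_apply, smul_eq_mul]

/-- Product rule with a factor of class `C¹`. -/
theorem IsW11loc.mul_contDiff (h : IsW11loc u g) (hgm : Measurable g) {χ : Space N → ℝ}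
    (hχ : ContDiff ℝ 1 χ) :
    IsW11loc (fun x => χ x * u x) (fun x => χ x • g x + u x • gradient χ x) := by
  have hχc := hχ.continuous
  have hgc : Continuous (gradient χ) :=
    (InnerProductSpace.toDual ℝ (Space N)).symm.continuous.comp (hχ.continuous_fderiv (by simp))
  have hin : ∀ x e, inner ℝ (gradient χ x) e = fderiv ℝ χ x e := fun x e => by
    simp [gradient]
  have l1 : LocallyIntegrable (fun x => χ x * u x) volume := by
    rw [locallyIntegrable_iff]
    intro K hK
    exact (h.locallyIntegrable.integrableOn_isCompact hK).continuousOn_mul hχc.continuousOn hK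
  have l2 : LocallyIntegrable (fun x => χ x • g x) volume := by
    rw [locallyIntegrable_iff]
    intro K hK
    exact (h.locallyIntegrable_grad.integrableOn_isCompact hK).continuousOn_smul hχc.continuousOn hK
  have l3 : LocallyIntegrable (fun x => u x • gradient χ x) volume := by
    rw [locallyIntegrable_iff]
    intro K hK
    exact (h.locallyIntegrable.integrableOn_isCompact hK).smul_continuousOn hgc.continuousOn hK
  refine ⟨l1, l2.add l3, fun φ hφ hc i => ?_⟩
  have hφ1 : ContDiff ℝ 1 φ := hφ.of_le (by simp)
  have hcc : HasCompactSupport fun x => χ x * φ x := hc.mul_left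
  -- The weak gradient of `u` is tested against `χ φ`, which is only of class `C¹`.
  have key := h.integral_mul_fderiv_of_contDiff_one hgm (hχ.mul hφ1) hcc
    (EuclideanSpace.single i 1)
  have hfd : ∀ x, fderiv ℝ (fun x => χ x * φ x) x (EuclideanSpace.single i 1) =
      χ x * fderiv ℝ φ x (EuclideanSpace.single i 1) + φ x * gradient χ x i := fun x => by
    rw [fderiv_fun_mul (hχ.differentiable (by simp) x) (hφ1.differentiable (by simp) x)]
    simp only [add_apply, smul_apply, smul_eq_mul]
    rw [← hin, inner_single_one]
  simp_rw [hfd, inner_single_one] at key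
  have i1 : Integrable fun x => χ x * u x * fderiv ℝ φ x (EuclideanSpace.single i 1) :=
    integrable_mul_of_hasCompactSupport l1
      ((hφ.continuous_fderiv (by simp)).clm_apply continuous_const) (hc.fderiv_apply ℝ _)
  have i2 : Integrable fun x => (u x • gradient χ x) i * φ x :=
    integrable_mul_of_hasCompactSupport (locallyIntegrable_coord l3 i) hφ.continuous hc
  have i3 : Integrable fun x => (χ x • g x) i * φ x :=
    integrable_mul_of_hasCompactSupport (locallyIntegrable_coord l2 i) hφ.continuous hc
  have k1 : ∫ x, u x * (χ x * fderiv ℝ φ x (EuclideanSpace.single i 1) + φ x * gradient χ x i) =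
      (∫ x, χ x * u x * fderiv ℝ φ x (EuclideanSpace.single i 1)) +
        ∫ x, (u x • gradient χ x) i * φ x := by
    rw [← integral_add i1 i2]
    refine integral_congr_ae (Eventually.of_forall fun x => ?_)
    simp only [PiLp.smul_apply, smul_eq_mul]; ring
  have k2 : ∫ x, (χ x • g x + u x • gradient χ x) i * φ x =
      (∫ x, (χ x • g x) i * φ x) + ∫ x, (u x • gradient χ x) i * φ x := by
    rw [← integral_add i3 i2]
    refine integral_congr_ae (Eventually.of_forall fun x => ?_)
    simp only [PiLp.add_apply]; ring
  have k3 : ∫ x, g x i * (χ x * φ x) = ∫ x, (χ x • g x) i * φ x :=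
    integral_congr_ae (Eventually.of_forall fun x => by
      simp only [PiLp.smul_apply, smul_eq_mul]; ring)
  rw [k1, k3] at key
  rw [k2]
  linarith

/-- `T` vanishes up to `t` and is a continuous primitive of a nonnegative function `θ` that is
continuous beyond `t`, but possibly singular at `t`. -/
structure IsSingularPrimitive (t : ℝ) (T θ : ℝ → ℝ) : Prop where
  eq_zero : ∀ r ≤ t, T r = 0
  deriv_eq_zero : ∀ r ≤ t, θ r = 0
  deriv_nonneg : ∀ r, 0 ≤ θ r
  continuousOn_deriv : ContinuousOn θ (Set.Ioi t)
  continuous : Continuous T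
  hasDerivAt : ∀ r, t < r → HasDerivAt T (θ r) r

/-- The derivative is capped at `n` and multiplied by a ramp that rises from `0` to `1` over a
length `1 / n` beyond `t`. The result is continuous, bounded by `θ` and equal to `θ r` for large
`n`; its primitives are Lipschitz and stay below `T`. -/
theorem IsSingularPrimitive.exists_approx {t : ℝ} {T θ : ℝ → ℝ} (h : IsSingularPrimitive t T θ) :
    ∃ Tn θn : ℕ → ℝ → ℝ, (∀ n, Continuous (θn n)) ∧ (∀ n r, HasDerivAt (Tn n) (θn n r) r) ∧
      (∀ n r, 0 ≤ θn n r ∧ θn n r ≤ θ r) ∧ (∀ n r, 0 ≤ Tn n r ∧ Tn n r ≤ T r) ∧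
      (∀ n : ℕ, LipschitzWith n (Tn n)) ∧ (∀ r, Tendsto (fun n => θn n r) atTop (𝓝 (θ r))) ∧
      (∀ r, Tendsto (fun n => Tn n r) atTop (𝓝 (T r))) := by
  set θn : ℕ → ℝ → ℝ := fun n r => min 1 (n * max (r - t) 0) * min (θ r) n with hθn
  have hc0 : ∀ (n : ℕ) r, 0 ≤ min 1 ((n : ℝ) * max (r - t) 0) := fun n r =>
    le_min zero_le_one (mul_nonneg n.cast_nonneg (le_max_right _ _))
  have hc1 : ∀ (n : ℕ) r, min 1 ((n : ℝ) * max (r - t) 0) ≤ 1 := fun n r => min_le_left _ _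
  have hm0 : ∀ (n : ℕ) r, 0 ≤ min (θ r) n := fun n r => le_min (h.deriv_nonneg r) (by positivity)
  have h0 : ∀ n r, 0 ≤ θn n r := fun n r => mul_nonneg (hc0 n r) (hm0 n r)
  have hle : ∀ n r, θn n r ≤ θ r := fun n r =>
    (mul_le_of_le_one_left (hm0 n r) (hc1 n r)).trans (min_le_left _ _)
  have hlen : ∀ (n : ℕ) r, θn n r ≤ n := fun n r =>
    (mul_le_of_le_one_left (hm0 n r) (hc1 n r)).trans (min_le_right _ _)
  have hz : ∀ n r, r ≤ t → θn n r = 0 := fun n r hr => by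
    simp [hθn, max_eq_right (sub_nonpos.2 hr)]
  have hcont : ∀ n, Continuous (θn n) := fun n => by
    rw [continuous_iff_continuousAt]
    intro r
    rcases lt_trichotomy r t with hr | hr | hr
    · refine (continuousAt_const (y := (0 : ℝ))).congr ?_
      filter_upwards [Iio_mem_nhds hr] with y hy
      exact (hz n y (le_of_lt hy)).symm
    · subst hr
      rw [ContinuousAt, hz n r le_rfl]
      have hb : Tendsto (fun y => (n : ℝ) * max (y - r) 0 * n) (𝓝 r) (𝓝 0) := by
        have : Continuous fun y => (n : ℝ) * max (y - r) 0 * n := by fun_prop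
        simpa using this.tendsto r
      refine tendsto_of_tendsto_of_tendsto_of_le_of_le tendsto_const_nhds hb (h0 n) fun y => ?_
      exact mul_le_mul (min_le_right _ _) (min_le_right _ _) (hm0 n y) (by positivity)
    · have h1 : ContinuousAt θ r := h.continuousOn_deriv.continuousAt (Ioi_mem_nhds hr)
      have h2 : ContinuousAt (fun r : ℝ => min 1 ((n : ℝ) * max (r - t) 0)) r := by fun_prop
      exact h2.mul (h1.min continuousAt_const)
  have hlimθ : ∀ r, Tendsto (fun n => θn n r) atTop (𝓝 (θ r)) := fun r => by
    rcases le_or_gt r t with hr | hr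
    · simp_rw [fun n => hz n r hr, h.deriv_eq_zero r hr]
      exact tendsto_const_nhds
    · refine tendsto_const_nhds.congr' ?_
      obtain ⟨n1, hn1⟩ := exists_nat_ge (θ r)
      obtain ⟨n2, hn2⟩ := exists_nat_ge (1 / (r - t))
      filter_upwards [eventually_ge_atTop n1, eventually_ge_atTop n2] with n h1 h2
      have h1' : θ r ≤ n := hn1.trans (by exact_mod_cast h1)
      have h2' : 1 / (r - t) ≤ n := hn2.trans (by exact_mod_cast h2)
      have hp : 0 < r - t := sub_pos.2 hr
      rw [div_le_iff₀ hp] at h2'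
      simp only [hθn]
      rw [max_eq_left hp.le, min_eq_left h2', min_eq_left h1', one_mul]
  set Tn : ℕ → ℝ → ℝ := fun n r => ∫ y in t..r, θn n y with hTn
  have hder : ∀ n r, HasDerivAt (Tn n) (θn n r) r := fun n r =>
    ((hcont n).integral_hasStrictDerivAt t r).hasDerivAt
  have hTz : ∀ n r, r ≤ t → Tn n r = 0 := fun n r hr => by
    simp only [hTn]
    rw [intervalIntegral.integral_congr (g := fun _ => 0), intervalIntegral.integral_zero]
    intro y hy
    rw [Set.uIcc_of_ge hr] at hy
    exact hz n y hy.2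
  -- A nonnegative derivative of a continuous function is integrable up to the endpoint, however
  -- singular it is there.
  have hint : ∀ r, t < r → IntervalIntegrable θ volume t r := fun r hr =>
    intervalIntegral.intervalIntegrable_deriv_of_nonneg h.continuous.continuousOn
      (fun x hx => h.hasDerivAt x (by simpa [hr.le] using hx.1)) fun x _ => h.deriv_nonneg x
  have hTeq : ∀ r, t < r → T r = ∫ y in t..r, θ y := fun r hr => by
    rw [intervalIntegral.integral_eq_sub_of_hasDerivAt_of_le hr.le h.continuous.continuousOn
      (fun x hx => h.hasDerivAt x hx.1) (hint r hr), h.eq_zero t le_rfl, sub_zero]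
  refine ⟨Tn, θn, hcont, hder, fun n r => ⟨h0 n r, hle n r⟩, fun n r => ?_, fun n => ?_, hlimθ,
    fun r => ?_⟩
  · rcases le_or_gt r t with hr | hr
    · rw [hTz n r hr, h.eq_zero r hr]; exact ⟨le_rfl, le_rfl⟩
    · refine ⟨intervalIntegral.integral_nonneg hr.le fun y _ => h0 n y, ?_⟩
      rw [hTeq r hr]
      exact intervalIntegral.integral_mono_on hr.le ((hcont n).intervalIntegrable _ _) (hint r hr)
        fun y _ => hle n y
  · refine lipschitzWith_of_nnnorm_deriv_le (fun r => (hder n r).differentiableAt) fun r => ?_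
    rw [(hder n r).deriv, ← NNReal.coe_le_coe, coe_nnnorm, Real.norm_of_nonneg (h0 n r)]
    exact hlen n r
  · rcases le_or_gt r t with hr | hr
    · simp_rw [fun n => hTz n r hr, h.eq_zero r hr]
      exact tendsto_const_nhds
    · rw [hTeq r hr]
      refine intervalIntegral.tendsto_integral_filter_of_dominated_convergence θ
        (Eventually.of_forall fun n => (hcont n).aestronglyMeasurable)
        (Eventually.of_forall fun n => Eventually.of_forall fun y _ => ?_) (hint r hr)
        (Eventually.of_forall fun y _ => hlimθ y)
      rw [Real.norm_of_nonneg (h0 n y)]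
      exact hle n y

/-- Chain rule for a primitive with a possibly singular derivative. -/
theorem IsW11loc.comp_singularPrimitive (h : IsW11loc u g) (hgm : Measurable g) {t : ℝ}
    {T θ : ℝ → ℝ} (hT : IsSingularPrimitive t T θ)
    (h1 : LocallyIntegrable (fun x => T (u x)) volume)
    (h2 : LocallyIntegrable (fun x => θ (u x) • g x) volume) :
    IsW11loc (fun x => T (u x)) (fun x => θ (u x) • g x) := by
  obtain ⟨Tn, θn, hc, hd, hθ, hTb, hL, hl1, hl2⟩ := hT.exists_approx
  have h2n : LocallyIntegrable (fun x => ‖θ (u x) • g x‖) volume :=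
    h2.mono h2.aestronglyMeasurable.norm (Eventually.of_forall fun x => (norm_norm _).le)
  refine IsW11loc.of_tendsto (fun n => h.comp_lipschitz hgm (hL n) (hd n)) h1 h2n
    (fun n => Eventually.of_forall fun x => ?_) (fun n => Eventually.of_forall fun x => ?_)
    (Eventually.of_forall fun x => hl2 _) (Eventually.of_forall fun x => (hl1 _).smul_const _)
  · rw [Real.norm_of_nonneg (hTb n _).1]
    exact (hTb n _).2
  · rw [norm_smul, norm_smul, Real.norm_of_nonneg (hθ n _).1,
      Real.norm_of_nonneg (hT.deriv_nonneg _)]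
    exact mul_le_mul_of_nonneg_right (hθ n _).2 (norm_nonneg _)

/-- Product rule with a cutoff obtained from a primitive with a possibly singular derivative. -/
theorem IsW11loc.mul_singularPrimitive (h : IsW11loc u g) (hgm : Measurable g) {t : ℝ}
    {F θ : ℝ → ℝ} (hF : IsSingularPrimitive t F θ) {χ : Space N → ℝ} (hχ : ContDiff ℝ 1 χ)
    (h1 : LocallyIntegrable (fun x => F (χ x) * u x) volume)
    (h2 : LocallyIntegrable (fun x => F (χ x) • g x) volume)
    (h3 : LocallyIntegrable (fun x => (u x * θ (χ x)) • gradient χ x) volume) :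
    IsW11loc (fun x => F (χ x) * u x)
      (fun x => F (χ x) • g x + (u x * θ (χ x)) • gradient χ x) := by
  obtain ⟨Fn, θn, hc, hd, hθ, hFb, hL, hl1, hl2⟩ := hF.exists_approx
  have hF0 : ∀ r, 0 ≤ F r := fun r => (hFb 0 r).1.trans (hFb 0 r).2
  have hFn : ∀ n, ContDiff ℝ 1 (Fn n) := fun n => by
    rw [contDiff_one_iff_deriv]
    refine ⟨fun r => (hd n r).differentiableAt, ?_⟩
    rw [show deriv (Fn n) = θn n from funext fun r => (hd n r).deriv]
    exact hc n
  have hgr : ∀ n x, gradient (fun x => Fn n (χ x)) x = θn n (χ x) • gradient χ x := fun n x => by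
    have hx := (hχ.differentiable (by simp) x).hasFDerivAt
    have := ((hd n (χ x)).comp_hasFDerivAt x hx).fderiv
    simp only [gradient]
    rw [show fderiv ℝ (fun x => Fn n (χ x)) x = θn n (χ x) • fderiv ℝ χ x from this, map_smul]
  have n1 := h1.mono h1.aestronglyMeasurable.norm (Eventually.of_forall fun x => (norm_norm _).le)
  have n2 := h2.mono h2.aestronglyMeasurable.norm (Eventually.of_forall fun x => (norm_norm _).le)
  have n3 := h3.mono h3.aestronglyMeasurable.norm (Eventually.of_forall fun x => (norm_norm _).le)
  refine IsW11loc.of_tendsto (fun n => h.mul_contDiff hgm ((hFn n).comp hχ)) n1 (n2.add n3)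
    (fun n => Eventually.of_forall fun x => ?_) (fun n => Eventually.of_forall fun x => ?_)
    (Eventually.of_forall fun x => (hl2 _).mul_const _) (Eventually.of_forall fun x => ?_)
  · rw [norm_mul, norm_mul, Function.comp_apply, Real.norm_of_nonneg (hFb n _).1,
      Real.norm_of_nonneg (hF0 _)]
    exact mul_le_mul_of_nonneg_right (hFb n _).2 (norm_nonneg _)
  · refine (norm_add_le _ _).trans (add_le_add ?_ ?_)
    · simp only
      rw [norm_smul, norm_smul, Function.comp_apply, Real.norm_of_nonneg (hFb n _).1,
        Real.norm_of_nonneg (hF0 _)]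
      exact mul_le_mul_of_nonneg_right (hFb n _).2 (norm_nonneg _)
    · simp only
      rw [show (Fn n ∘ χ) = fun x => Fn n (χ x) from rfl, hgr, smul_smul, norm_smul, norm_smul,
        norm_mul, norm_mul, Real.norm_of_nonneg (hθ n _).1, Real.norm_of_nonneg (hF.deriv_nonneg _)]
      gcongr
      exact (hθ n _).2
  · refine ((hl2 _).smul_const _).add ?_
    simp_rw [show ∀ n, (Fn n ∘ χ) = fun x => Fn n (χ x) from fun n => rfl, hgr, smul_smul]
    exact ((hl1 _).const_mul _).smul_const _

/-- The difference quotients of a constant vanish, and so does their limit `-∫ c ∂ᵢφ`. -/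
theorem isW11loc_const (c : ℝ) : IsW11loc (fun _ : Space N => c) (fun _ => 0) := by
  refine ⟨locallyIntegrable_const c, locallyIntegrable_const 0, fun φ hφ hc i => ?_⟩
  have h1 := tendsto_integral_slope_mul (locallyIntegrable_const c) (hφ.of_le (by simp)) hc
    (EuclideanSpace.single i 1)
  simp only [sub_self, mul_zero, zero_mul, integral_zero] at h1
  have h2 := tendsto_nhds_unique h1 tendsto_const_nhds
  rw [neg_eq_zero.1 h2]
  simp

theorem isW11loc_of_contDiff {χ : Space N → ℝ} (hχ : ContDiff ℝ 1 χ) :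
    IsW11loc χ (gradient χ) := by
  simpa using (isW11loc_const (N := N) 1).mul_contDiff measurable_const hχ

theorem IsW11loc.add (h : IsW11loc u g) (h' : IsW11loc v k) :
    IsW11loc (fun x => u x + v x) (fun x => g x + k x) := by
  refine ⟨h.locallyIntegrable.add h'.locallyIntegrable,
    h.locallyIntegrable_grad.add h'.locallyIntegrable_grad, fun φ hφ hc i => ?_⟩
  have hd : Continuous fun x => fderiv ℝ φ x (EuclideanSpace.single i 1) :=
    (hφ.continuous_fderiv (by simp)).clm_apply continuous_const
  have hdc : HasCompactSupport fun x => fderiv ℝ φ x (EuclideanSpace.single i 1) :=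
    hc.fderiv_apply ℝ _
  simp only [PiLp.add_apply, add_mul]
  rw [integral_add (integrable_mul_of_hasCompactSupport h.locallyIntegrable hd hdc)
      (integrable_mul_of_hasCompactSupport h'.locallyIntegrable hd hdc),
    integral_add (integrable_mul_of_hasCompactSupport
      (locallyIntegrable_coord h.locallyIntegrable_grad i) hφ.continuous hc)
      (integrable_mul_of_hasCompactSupport
      (locallyIntegrable_coord h'.locallyIntegrable_grad i) hφ.continuous hc),
    h.integral_eq φ hφ hc i, h'.integral_eq φ hφ hc i]
  ring

theorem IsW11loc.const_mul (h : IsW11loc u g) (a : ℝ) :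
    IsW11loc (fun x => a * u x) (fun x => a • g x) := by
  refine ⟨h.locallyIntegrable.smul a, h.locallyIntegrable_grad.smul a, fun φ hφ hc i => ?_⟩
  simp only [PiLp.smul_apply, smul_eq_mul, mul_assoc]
  rw [integral_const_mul, integral_const_mul, h.integral_eq φ hφ hc i, mul_neg]

theorem isW11loc_sum {ι : Type*} (s : Finset ι) {un : ι → Space N → ℝ}
    {gn : ι → Space N → Space N} (h : ∀ i ∈ s, IsW11loc (un i) (gn i)) :
    IsW11loc (fun x => ∑ i ∈ s, un i x) (fun x => ∑ i ∈ s, gn i x) := by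
  classical
  induction s using Finset.induction_on with
  | empty => simpa using isW11loc_const (N := N) 0
  | insert a s ha ih =>
    simp_rw [Finset.sum_insert ha]
    exact (h a (Finset.mem_insert_self _ _)).add
      (ih fun i hi => h i (Finset.mem_insert_of_mem hi))

/-! ### Rescaling of integrals and weak gradients -/

/-- The homeomorphism `x ↦ k (x - b)`. -/
def affineHomeo (k : ℝ) (hk : 0 < k) (b : Space N) : Space N ≃ₜ Space N :=
  (Homeomorph.subRight b).trans (Homeomorph.smulOfNeZero k hk.ne')

theorem affineHomeo_apply {k : ℝ} (hk : 0 < k) (b x : Space N) :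
    affineHomeo k hk b x = k • (x - b) := rfl

theorem map_affineHomeo {k : ℝ} (hk : 0 < k) (b : Space N) :
    Measure.map (affineHomeo k hk b) (volume : Measure (Space N)) =
      ENNReal.ofReal ((k ^ N)⁻¹) • volume := by
  have h1 : Measure.map (fun x : Space N => x - b) volume = volume :=
    (measurePreserving_sub_right volume b).map_eq
  have h2 := Measure.map_addHaar_smul (volume : Measure (Space N)) hk.ne'
  rw [show (affineHomeo k hk b : Space N → Space N) = (fun x => k • x) ∘ fun x => x - b from rfl,
    ← Measure.map_map (by fun_prop) (by fun_prop), h1, h2, finrank_euclideanSpace_fin,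
    abs_of_pos (by positivity)]

theorem lintegral_affine {k : ℝ} (hk : 0 < k) (b : Space N) (f : Space N → ℝ≥0∞) :
    ∫⁻ x, f (k • (x - b)) = ENNReal.ofReal ((k ^ N)⁻¹) * ∫⁻ x, f x := by
  have := lintegral_map_equiv (μ := volume) f (affineHomeo k hk b).toMeasurableEquiv
  rw [show ((affineHomeo k hk b).toMeasurableEquiv : Space N → Space N) = affineHomeo k hk b
    from rfl, map_affineHomeo hk b, lintegral_smul_measure, smul_eq_mul] at this
  exact this.symm

theorem integral_affine {k : ℝ} (hk : 0 < k) (b : Space N) (f : Space N → ℝ) :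
    ∫ x, f (k • (x - b)) = (k ^ N)⁻¹ * ∫ x, f x := by
  have := integral_map_equiv (μ := volume) (affineHomeo k hk b).toMeasurableEquiv f
  rw [show ((affineHomeo k hk b).toMeasurableEquiv : Space N → Space N) = affineHomeo k hk b
    from rfl, map_affineHomeo hk b, integral_smul_measure, ENNReal.toReal_ofReal (by positivity),
    smul_eq_mul] at this
  exact this.symm

theorem locallyIntegrable_affine {E : Type*} [NormedAddCommGroup E] {f : Space N → E}
    (hf : LocallyIntegrable f volume) {k : ℝ} (hk : 0 < k) (b : Space N) :
    LocallyIntegrable (fun x => f (k • (x - b))) volume := by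
  refine (locallyIntegrable_map_homeomorph (μ := volume) (f := f) (affineHomeo k hk b)).1 ?_
  rw [map_affineHomeo hk b]
  intro x
  obtain ⟨s, hs, h⟩ := hf x
  refine ⟨s, hs, ?_⟩
  rw [IntegrableOn, Measure.restrict_smul]
  exact h.smul_measure ENNReal.ofReal_ne_top

theorem integrable_affine {E : Type*} [NormedAddCommGroup E] {f : Space N → E}
    (hf : Integrable f volume) {k : ℝ} (hk : 0 < k) (b : Space N) :
    Integrable (fun x => f (k • (x - b))) volume := by
  refine (integrable_map_equiv (μ := volume) (affineHomeo k hk b).toMeasurableEquiv f).1 ?_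
  rw [show ((affineHomeo k hk b).toMeasurableEquiv : Space N → Space N) = affineHomeo k hk b
    from rfl, map_affineHomeo hk b]
  exact hf.smul_measure ENNReal.ofReal_ne_top

/-- Weak gradients of rescaled functions. -/
theorem IsW11loc.affine (h : IsW11loc u g) (a : ℝ) {k : ℝ} (hk : 0 < k) (b : Space N) :
    IsW11loc (fun x => a * u (k • (x - b))) (fun x => (a * k) • g (k • (x - b))) := by
  have key : IsW11loc (fun x => u (k • (x - b))) (fun x => k • g (k • (x - b))) := by
    refine ⟨locallyIntegrable_affine h.locallyIntegrable hk b,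
      (locallyIntegrable_affine h.locallyIntegrable_grad hk b).smul k, fun φ hφ hc i => ?_⟩
    set ψ : Space N → ℝ := fun y => φ (k⁻¹ • y + b) with hψ
    have hψφ : ∀ x, ψ (k • (x - b)) = φ x := fun x => by
      simp [hψ, smul_smul, inv_mul_cancel₀ hk.ne']
    have hψs : ContDiff ℝ ∞ ψ := hφ.comp (by fun_prop)
    have hψc : HasCompactSupport ψ := by
      have : ψ = φ ∘ (affineHomeo k hk b).symm := by
        funext y
        have := hψφ ((affineHomeo k hk b).symm y)
        rw [← affineHomeo_apply hk, Homeomorph.apply_symm_apply] at this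
        rw [this]; rfl
      rw [this]
      exact hc.comp_homeomorph _
    have hd : ∀ x e, fderiv ℝ φ x e = k * fderiv ℝ ψ (k • (x - b)) e := fun x e => by
      have h1 : HasFDerivAt (fun x : Space N => k • (x - b))
          (k • ContinuousLinearMap.id ℝ (Space N)) x :=
        ((hasFDerivAt_id x).sub_const b).const_smul k
      have h2 := ((hψs.differentiable (by simp)) (k • (x - b))).hasFDerivAt.comp x h1
      rw [show (ψ ∘ fun x : Space N => k • (x - b)) = φ from funext hψφ] at h2
      rw [h2.fderiv]
      simp
    have h1 := integral_affine hk b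
      (fun y => u y * (k * fderiv ℝ ψ y (EuclideanSpace.single i 1)))
    have h2 := integral_affine hk b (fun y => (k * g y i) * ψ y)
    simp only [hψφ, ← hd] at h1 h2
    simp only [PiLp.smul_apply, smul_eq_mul]
    rw [h1, h2]
    simp_rw [mul_left_comm _ k, mul_assoc k]
    rw [integral_const_mul, integral_const_mul, h.integral_eq ψ hψs hψc i]
    ring
  have := key.const_mul a
  simpa only [smul_smul] using this

/-! ### Translation estimates and Nash's inequality -/

theorem ennreal_add_sq_le (a b : ℝ≥0∞) : (a + b) ^ 2 ≤ 2 * a ^ 2 + 2 * b ^ 2 := by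
  rcases eq_or_ne a ⊤ with rfl | ha
  · simp
  rcases eq_or_ne b ⊤ with rfl | hb
  · simp
  lift a to ℝ≥0 using ha
  lift b to ℝ≥0 using hb
  norm_cast
  rw [← NNReal.coe_le_coe]
  push_cast
  nlinarith [sq_nonneg ((a : ℝ) - b)]

theorem sq_lintegral_le {α : Type*} [MeasurableSpace α] {μ : Measure α} {f : α → ℝ≥0∞}
    (hf : AEMeasurable f μ) : (∫⁻ x, f x ∂μ) ^ 2 ≤ μ Set.univ * ∫⁻ x, f x ^ 2 ∂μ := by
  have h := ENNReal.lintegral_mul_le_Lp_mul_Lq μ Real.HolderConjugate.two_two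
    (aemeasurable_const (b := (1 : ℝ≥0∞))) hf
  simp only [Pi.mul_apply, one_mul, lintegral_const, ENNReal.rpow_two, one_pow] at h
  calc (∫⁻ x, f x ∂μ) ^ 2
      ≤ (μ Set.univ ^ (1 / 2 : ℝ) * (∫⁻ x, f x ^ 2 ∂μ) ^ (1 / 2 : ℝ)) ^ 2 := by gcongr
    _ = μ Set.univ * ∫⁻ x, f x ^ 2 ∂μ := by
      rw [mul_pow, ← ENNReal.rpow_natCast, ← ENNReal.rpow_natCast, ← ENNReal.rpow_mul,
        ← ENNReal.rpow_mul]
      norm_num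

theorem IsW11loc.enorm_translate_sub_le (h : IsW11loc u g) (hgm : Measurable g) (e : Space N) :
    ∀ᵐ x, ‖u (x + e) - u x‖ₑ ≤ ‖e‖ₑ * ∫⁻ t in Set.Icc (0 : ℝ) 1, ‖g (x + t • e)‖ₑ := by
  filter_upwards [h.translate_sub hgm e] with x hx
  rw [hx]
  refine (enorm_integral_le_lintegral_enorm _).trans ?_
  rw [← lintegral_const_mul' _ _ enorm_ne_top]
  refine lintegral_mono fun t => ?_
  rw [← ofReal_norm, ← ofReal_norm, ← ofReal_norm, ← ENNReal.ofReal_mul (norm_nonneg _)]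
  refine ENNReal.ofReal_le_ofReal ?_
  rw [mul_comm]
  exact norm_inner_le_norm _ _

theorem IsW11loc.lintegral_translate_sub_le (h : IsW11loc u g) (hgm : Measurable g)
    {A A' : Set (Space N)} (hA : MeasurableSet A) (hA' : MeasurableSet A') (e : Space N)
    (hAA' : ∀ x ∈ A, ∀ t ∈ Set.Icc (0 : ℝ) 1, x + t • e ∈ A') :
    ∫⁻ x in A, ‖u (x + e) - u x‖ₑ ≤ ‖e‖ₑ * ∫⁻ x in A', ‖g x‖ₑ := by
  calc ∫⁻ x in A, ‖u (x + e) - u x‖ₑ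
      ≤ ∫⁻ x in A, ‖e‖ₑ * ∫⁻ t in Set.Icc (0 : ℝ) 1, ‖g (x + t • e)‖ₑ :=
        lintegral_mono_ae (ae_restrict_of_ae (h.enorm_translate_sub_le hgm e))
    _ = ‖e‖ₑ * ∫⁻ x in A, ∫⁻ t in Set.Icc (0 : ℝ) 1, ‖g (x + t • e)‖ₑ :=
        lintegral_const_mul' _ _ enorm_ne_top
    _ ≤ _ := by
        exact mul_le_mul_right (lintegral_lintegral_translate_le hgm.enorm hA hA' e hAA') _

theorem IsW11loc.lintegral_translate_sub_sq_le (h : IsW11loc u g) (hgm : Measurable g)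
    {A A' : Set (Space N)} (hA : MeasurableSet A) (hA' : MeasurableSet A') (e : Space N)
    (hAA' : ∀ x ∈ A, ∀ t ∈ Set.Icc (0 : ℝ) 1, x + t • e ∈ A') :
    ∫⁻ x in A, ‖u (x + e) - u x‖ₑ ^ 2 ≤ ‖e‖ₑ ^ 2 * ∫⁻ x in A', ‖g x‖ₑ ^ 2 := by
  calc ∫⁻ x in A, ‖u (x + e) - u x‖ₑ ^ 2
      ≤ ∫⁻ x in A, ‖e‖ₑ ^ 2 * ∫⁻ t in Set.Icc (0 : ℝ) 1, ‖g (x + t • e)‖ₑ ^ 2 := by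
        refine lintegral_mono_ae (ae_restrict_of_ae ?_)
        filter_upwards [h.enorm_translate_sub_le hgm e] with x hx
        refine (pow_le_pow_left' hx 2).trans ?_
        rw [mul_pow]
        gcongr
        have h1 := sq_lintegral_le (μ := volume.restrict (Set.Icc (0 : ℝ) 1))
          (f := fun t => ‖g (x + t • e)‖ₑ)
          (hgm.comp (by fun_prop : Measurable fun t : ℝ => x + t • e)).enorm.aemeasurable
        simpa using h1
    _ = ‖e‖ₑ ^ 2 * ∫⁻ x in A, ∫⁻ t in Set.Icc (0 : ℝ) 1, ‖g (x + t • e)‖ₑ ^ 2 :=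
        lintegral_const_mul' _ _ (by finiteness)
    _ ≤ _ := by
        exact mul_le_mul_right (lintegral_lintegral_translate_le (hgm.enorm.pow_const 2) hA hA' e
          hAA') _

theorem lintegral_translate_le {f : Space N → ℝ≥0∞} {A A' : Set (Space N)} (hA : MeasurableSet A)
    (hA' : MeasurableSet A') {e : Space N} (hAA' : ∀ x ∈ A, x + e ∈ A') :
    ∫⁻ x in A, f (x + e) ≤ ∫⁻ x in A', f x := by
  rw [← lintegral_indicator hA, ← lintegral_indicator hA',
    ← lintegral_add_right_eq_self (A'.indicator fun x => f x) e]
  refine lintegral_mono fun x => ?_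
  by_cases hx : x ∈ A
  · rw [Set.indicator_of_mem hx, Set.indicator_of_mem (hAA' x hx)]
  · rw [Set.indicator_of_notMem hx]; exact zero_le

theorem segment_mem_of_closedBall {A A' : Set (Space N)} {r : ℝ}
    (hAA' : ∀ x ∈ A, ∀ e : Space N, ‖e‖ ≤ r → x + e ∈ A') {e : Space N} (he : ‖e‖ ≤ r) :
    ∀ x ∈ A, ∀ t ∈ Set.Icc (0 : ℝ) 1, x + t • e ∈ A' := fun x hx t ht => by
  refine hAA' x hx _ ?_
  rw [norm_smul, Real.norm_of_nonneg ht.1]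
  exact (mul_le_of_le_one_left (norm_nonneg _) ht.2).trans he

/-- A local form of Nash's inequality. -/
theorem IsW11loc.nash (h : IsW11loc u g) (hum : Measurable u) (hgm : Measurable g)
    {A A' : Set (Space N)} (hA : MeasurableSet A) (hA' : MeasurableSet A') {r : ℝ} (hr : 0 < r)
    (hAA' : ∀ x ∈ A, ∀ e : Space N, ‖e‖ ≤ r → x + e ∈ A') :
    ∫⁻ x in A, ‖u x‖ₑ ^ 2 ≤ 2 * ENNReal.ofReal (r ^ 2) * (∫⁻ x in A', ‖g x‖ₑ ^ 2) +
      2 * (volume (Metric.closedBall (0 : Space N) r))⁻¹ * (∫⁻ x in A', ‖u x‖ₑ) ^ 2 := by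
  set B := Metric.closedBall (0 : Space N) r with hB
  have hBm : MeasurableSet B := measurableSet_closedBall
  set β := volume B with hβ
  have hβ0 : β ≠ 0 := (Metric.measure_closedBall_pos volume _ hr).ne'
  have hβt : β ≠ ⊤ := measure_closedBall_lt_top.ne
  set G := ∫⁻ x in A', ‖g x‖ₑ ^ 2 with hG
  set M := ∫⁻ x in A', ‖u x‖ₑ with hM
  have hm1 : Measurable fun p : Space N × Space N => u (p.1 + p.2) := hum.comp (by fun_prop)
  have hm2 : Measurable fun p : Space N × Space N => u p.1 := hum.comp measurable_fst
  -- The triangle inequality `|u x| ≤ |u (x + e) - u x| + |u (x + e)|` is averaged over `e ∈ B` and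
  -- squared. In the square of the second integral one factor is bounded by `M`; the other one is
  -- kept for the integration in `x`.
  have hpt : ∀ x ∈ A, β ^ 2 * ‖u x‖ₑ ^ 2 ≤
      2 * β * (∫⁻ e in B, ‖u (x + e) - u x‖ₑ ^ 2) + 2 * M * ∫⁻ e in B, ‖u (x + e)‖ₑ := by
    intro x hx
    have hx1 : Measurable fun e => u (x + e) := hum.comp (by fun_prop)
    have h1 : β * ‖u x‖ₑ ≤ (∫⁻ e in B, ‖u (x + e) - u x‖ₑ) + ∫⁻ e in B, ‖u (x + e)‖ₑ := by
      rw [← lintegral_add_right _ hx1.enorm]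
      calc β * ‖u x‖ₑ = ∫⁻ _ in B, ‖u x‖ₑ := by
            rw [setLIntegral_const, mul_comm]
        _ ≤ _ := lintegral_mono fun e => by
            calc ‖u x‖ₑ = ‖(u x - u (x + e)) + u (x + e)‖ₑ := by rw [sub_add_cancel]
              _ ≤ _ := enorm_add_le _ _
              _ = _ := by rw [enorm_sub_rev]
    have h2 : ∫⁻ e in B, ‖u (x + e)‖ₑ ≤ M := by
      have := lintegral_translate_le (f := fun y => ‖u y‖ₑ) (e := x) hBm hA' (fun e he => by
        rw [add_comm]; exact hAA' x hx e (mem_closedBall_zero_iff.1 he))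
      simpa only [add_comm x] using this
    calc β ^ 2 * ‖u x‖ₑ ^ 2 = (β * ‖u x‖ₑ) ^ 2 := by ring
      _ ≤ ((∫⁻ e in B, ‖u (x + e) - u x‖ₑ) + ∫⁻ e in B, ‖u (x + e)‖ₑ) ^ 2 := by gcongr
      _ ≤ _ := ennreal_add_sq_le _ _
      _ ≤ 2 * (β * ∫⁻ e in B, ‖u (x + e) - u x‖ₑ ^ 2) + 2 * (M * ∫⁻ e in B, ‖u (x + e)‖ₑ) := by
        gcongr
        · have := sq_lintegral_le (μ := volume.restrict B) (f := fun e => ‖u (x + e) - u x‖ₑ)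
            (hx1.sub_const _).enorm.aemeasurable
          simpa using this
        · rw [sq]; gcongr
      _ = _ := by ring
  have hint : β ^ 2 * ∫⁻ x in A, ‖u x‖ₑ ^ 2 ≤
      2 * β * (β * (ENNReal.ofReal (r ^ 2) * G)) + 2 * M * (β * M) := by
    have hm3 : Measurable fun x => ∫⁻ e in B, ‖u (x + e)‖ₑ :=
      Measurable.lintegral_prod_right' (f := fun p : Space N × Space N => ‖u (p.1 + p.2)‖ₑ) hm1.enorm
    have hm4 : Measurable fun x => ∫⁻ e in B, ‖u (x + e) - u x‖ₑ ^ 2 :=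
      Measurable.lintegral_prod_right'
        (f := fun p : Space N × Space N => ‖u (p.1 + p.2) - u p.1‖ₑ ^ 2)
        ((hm1.sub hm2).enorm.pow_const 2)
    calc β ^ 2 * ∫⁻ x in A, ‖u x‖ₑ ^ 2 = ∫⁻ x in A, β ^ 2 * ‖u x‖ₑ ^ 2 :=
          (lintegral_const_mul' _ _ (by finiteness)).symm
      _ ≤ ∫⁻ x in A, (2 * β * (∫⁻ e in B, ‖u (x + e) - u x‖ₑ ^ 2) +
            2 * M * ∫⁻ e in B, ‖u (x + e)‖ₑ) := setLIntegral_mono' hA hpt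
      _ = 2 * β * (∫⁻ x in A, ∫⁻ e in B, ‖u (x + e) - u x‖ₑ ^ 2) +
            2 * M * ∫⁻ x in A, ∫⁻ e in B, ‖u (x + e)‖ₑ := by
          rw [lintegral_add_right _ (hm3.const_mul _), lintegral_const_mul _ hm4,
            lintegral_const_mul _ hm3]
      _ ≤ _ := by
          gcongr
          · rw [lintegral_lintegral_swap ((hm1.sub hm2).enorm.pow_const 2).aemeasurable]
            calc ∫⁻ e in B, ∫⁻ x in A, ‖u (x + e) - u x‖ₑ ^ 2
                ≤ ∫⁻ _ in B, ENNReal.ofReal (r ^ 2) * G := by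
                  refine setLIntegral_mono' hBm fun e he => ?_
                  have he' : ‖e‖ ≤ r := mem_closedBall_zero_iff.1 he
                  refine (h.lintegral_translate_sub_sq_le hgm hA hA' e
                    (segment_mem_of_closedBall hAA' he')).trans ?_
                  gcongr
                  rw [← ofReal_norm, ← ENNReal.ofReal_pow (norm_nonneg _)]
                  exact ENNReal.ofReal_le_ofReal (pow_le_pow_left₀ (norm_nonneg _) he' 2)
              _ = _ := by rw [setLIntegral_const, mul_comm]
          · rw [lintegral_lintegral_swap hm1.enorm.aemeasurable]
            calc ∫⁻ e in B, ∫⁻ x in A, ‖u (x + e)‖ₑ ≤ ∫⁻ _ in B, M := by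
                  refine setLIntegral_mono' hBm fun e he => ?_
                  exact lintegral_translate_le (f := fun y => ‖u y‖ₑ) hA hA' fun x hx =>
                    hAA' x hx e (mem_closedBall_zero_iff.1 he)
              _ = _ := by rw [setLIntegral_const, mul_comm]
  have hβi : β * β⁻¹ = 1 := ENNReal.mul_inv_cancel hβ0 hβt
  calc ∫⁻ x in A, ‖u x‖ₑ ^ 2 = (β * β⁻¹) ^ 2 * ∫⁻ x in A, ‖u x‖ₑ ^ 2 := by rw [hβi]; simp
    _ = β⁻¹ ^ 2 * (β ^ 2 * ∫⁻ x in A, ‖u x‖ₑ ^ 2) := by ring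
    _ ≤ β⁻¹ ^ 2 * (2 * β * (β * (ENNReal.ofReal (r ^ 2) * G)) + 2 * M * (β * M)) := by gcongr
    _ = (β * β⁻¹) ^ 2 * (2 * ENNReal.ofReal (r ^ 2) * G) + (β * β⁻¹) * (2 * β⁻¹ * M ^ 2) := by ring
    _ = _ := by rw [hβi]; simp

/-! ### The power cost: competitors, scaling, positivity -/

/-- The potential `u ↦ u ^ s`, set to zero for `u ≤ τ`. -/
def cutPower (s τ u : ℝ) : ℝ≥0∞ := if u ≤ τ then 0 else ENNReal.ofReal (u ^ s)

theorem measurable_cutPower (s τ : ℝ) : Measurable (cutPower s τ) :=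
  Measurable.ite measurableSet_Iic measurable_const (by fun_prop)

theorem powerLagrangian_of_nonneg (s : ℝ) {a : ℝ} (ha : 0 ≤ a) (ξ : Space N) :
    powerLagrangian N s a ξ = cutPower s 0 a + ‖ξ‖ₑ ^ 2 := by
  rw [powerLagrangian, if_neg ha.not_gt, cutPower, ← ofReal_norm,
    ENNReal.ofReal_pow (norm_nonneg _)]
  congr 1
  by_cases h : a = 0
  · rw [if_pos h, if_pos h.le]
  · rw [if_neg h, if_neg (not_le.2 (lt_of_le_of_ne ha (Ne.symm h)))]

/-- The minimal cost for the Lagrangian `u ^ s + |ξ|²`. -/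
def powerCost (N : ℕ) (s m : ℝ) : ℝ≥0∞ := minimalCost (powerLagrangian N s) m

theorem powerCost_le (s : ℝ) (h : IsW11loc u g) (h0 : ∀ x, 0 ≤ u x) (hi : Integrable u volume) :
    powerCost N s (∫ x, u x) ≤ ∫⁻ x, (cutPower s 0 (u x) + ‖g x‖ₑ ^ 2) := by
  have h1 : powerCost N s (∫ x, u x) ≤ ∫⁻ x, powerLagrangian N s (u x) (g x) :=
    iInf_le_of_le u <| iInf_le_of_le g <| iInf_le_of_le h <| iInf_le_of_le hi <|
      iInf_le_of_le rfl le_rfl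
  refine h1.trans (le_of_eq ?_)
  exact lintegral_congr fun x => powerLagrangian_of_nonneg s (h0 x) _

theorem measurable_powerLagrangian (s : ℝ) (hu : Measurable u) (hg : Measurable g) :
    Measurable fun x => powerLagrangian N s (u x) (g x) := by
  unfold powerLagrangian
  refine Measurable.ite (measurableSet_lt hu measurable_const) measurable_const
    (Measurable.add (Measurable.ite (measurableSet_eq_fun hu measurable_const) measurable_const ?_) ?_)
  · exact (hu.pow_const s).ennreal_ofReal
  · exact (hg.norm.pow_const 2).ennreal_ofReal

/-- Competitors may be taken measurable and nonnegative: negative values have infinite energy, and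
all the conditions depend only on classes almost everywhere. -/
theorem exists_of_powerCost_lt {s m : ℝ} {a : ℝ≥0∞} (h : powerCost N s m < a) :
    ∃ (u : Space N → ℝ) (g : Space N → Space N), IsW11loc u g ∧ Measurable u ∧ Measurable g ∧
      (∀ x, 0 ≤ u x) ∧ Integrable u volume ∧ ∫ x, u x = m ∧
      ∫⁻ x, (cutPower s 0 (u x) + ‖g x‖ₑ ^ 2) < a := by
  simp only [powerCost, minimalCost, iInf_lt_iff] at h
  obtain ⟨u, g, h, hi, hm, ha⟩ := h
  obtain ⟨u', hu', huu'⟩ := hi.aestronglyMeasurable.aemeasurable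
  obtain ⟨g', hg', hgg'⟩ := h.locallyIntegrable_grad.aestronglyMeasurable.aemeasurable
  have e1 : ∫⁻ x, powerLagrangian N s (u x) (g x) = ∫⁻ x, powerLagrangian N s (u' x) (g' x) := by
    refine lintegral_congr_ae ?_
    filter_upwards [huu', hgg'] with x h1 h2
    rw [h1, h2]
  have hfin : ∀ᵐ x, powerLagrangian N s (u' x) (g' x) < ⊤ :=
    ae_lt_top (measurable_powerLagrangian s hu' hg') (by rw [← e1]; exact ha.ne_top)
  have hnn : ∀ᵐ x, max (u' x) 0 = u' x := by
    filter_upwards [hfin] with x hx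
    refine max_eq_left (not_lt.1 fun hlt => ?_)
    rw [powerLagrangian, if_pos hlt] at hx
    exact lt_irrefl _ hx
  have huv : u =ᵐ[volume] fun x => max (u' x) 0 := by
    filter_upwards [huu', hnn] with x h1 h2
    rw [h1, h2]
  refine ⟨fun x => max (u' x) 0, g', h.congr_ae huv hgg', hu'.max measurable_const, hg',
    fun x => le_max_right _ _, hi.congr huv, ?_, ?_⟩
  · rw [← hm]
    exact (integral_congr_ae huv).symm
  · refine lt_of_eq_of_lt ?_ ha
    rw [e1]
    refine lintegral_congr_ae ?_
    filter_upwards [hnn] with x hx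
    rw [← powerLagrangian_of_nonneg s (le_max_right _ _), hx]

theorem powerCost_zero (s : ℝ) : powerCost N s 0 = 0 := by
  have := powerCost_le s (isW11loc_const (N := N) 0) (fun _ => le_rfl) (integrable_zero _ _ _)
  simp only [integral_zero] at this
  refine le_antisymm (this.trans ?_) zero_le
  simp [cutPower]

/-- The exponent `α` in the cost `c m ^ α`. -/
def costExponent (N : ℕ) (s : ℝ) : ℝ := (1 - s / 2 + s / N) / (1 - s / 2 + 1 / N)

theorem costExponent_eq (hN : 1 ≤ N) {s : ℝ} (hs : s ≤ 1) :
    0 < 1 + N * (1 - s / 2) ∧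
      costExponent N s = (s + N * (1 - s / 2)) / (1 + N * (1 - s / 2)) := by
  have hN' : (1 : ℝ) ≤ N := by exact_mod_cast hN
  have h1 : 0 < 1 - s / 2 := by linarith
  have h2 : 0 < 1 + N * (1 - s / 2) := by positivity
  refine ⟨h2, ?_⟩
  rw [costExponent]
  have h3 : (1 - s / 2 + 1 / (N : ℝ)) = (1 + N * (1 - s / 2)) / N := by field_simp; ring
  have h4 : (1 - s / 2 + s / (N : ℝ)) = (s + N * (1 - s / 2)) / N := by field_simp; ring
  rw [h3, h4, div_div_div_cancel_right₀ (by positivity)]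

theorem costExponent_le_one (hN : 1 ≤ N) {s : ℝ} (hs : s ≤ 1) : costExponent N s ≤ 1 := by
  obtain ⟨h1, h2⟩ := costExponent_eq hN hs
  rw [h2, div_le_one h1]; linarith

theorem costExponent_lt_one (hN : 1 ≤ N) {s : ℝ} (hs : s < 1) : costExponent N s < 1 := by
  obtain ⟨h1, h2⟩ := costExponent_eq hN hs.le
  rw [h2, div_lt_one h1]; linarith

theorem costExponent_pos (hN : 1 ≤ N) {s : ℝ} (hs : s ≤ 1) (hs' : -2 < s) :
    0 < costExponent N s := by
  obtain ⟨h1, h2⟩ := costExponent_eq hN hs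
  rw [h2]
  refine div_pos ?_ h1
  have hN' : (1 : ℝ) ≤ N := by exact_mod_cast hN
  nlinarith

theorem cutPower_zero_mul (s : ℝ) {a b : ℝ} (ha : 0 < a) (hb : 0 ≤ b) :
    cutPower s 0 (a * b) = ENNReal.ofReal (a ^ s) * cutPower s 0 b := by
  rcases hb.eq_or_lt with rfl | hb
  · simp [cutPower]
  · rw [cutPower, cutPower, if_neg (not_le.2 (by positivity)), if_neg (not_le.2 hb),
      Real.mul_rpow ha.le hb.le, ENNReal.ofReal_mul (by positivity)]

/-- Rescaling a competitor: amplitude and length are coupled so that both terms of the energy scale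
by the same factor. -/
theorem exists_rescaled_profile (hN : 1 ≤ N) {s : ℝ} (hs : s ≤ 1) {m : ℝ} (hm : 0 < m) :
    ∃ a l : ℝ, 0 < a ∧ 0 < l ∧ a * (l ^ N)⁻¹ = m ∧
      ∀ (u : Space N → ℝ) (g : Space N → Space N), (∀ x, 0 ≤ u x) →
        ∫⁻ x, (cutPower s 0 (a * u (l • (x - 0))) + ‖(a * l) • g (l • (x - 0))‖ₑ ^ 2) =
          ENNReal.ofReal (m ^ costExponent N s) * ∫⁻ x, (cutPower s 0 (u x) + ‖g x‖ₑ ^ 2) := by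
  obtain ⟨hD, hα⟩ := costExponent_eq hN hs
  set D := 1 + N * (1 - s / 2) with hDdef
  -- The amplitude `a` and the inverse length `l` solve `a l ^ (-N) = m` and `(a l) ^ 2 = a ^ s`.
  -- The energy is then multiplied by `a ^ s l ^ (-N) = m ^ α`.
  set a := m ^ (1 / D) with hadef
  have ha : 0 < a := Real.rpow_pos_of_pos hm _
  set l := a ^ ((s - 2) / 2) with hldef
  have hl : 0 < l := Real.rpow_pos_of_pos ha _
  have hlN : (l ^ N)⁻¹ = a ^ (N * (1 - s / 2)) := by
    rw [hldef, ← Real.rpow_natCast, ← Real.rpow_mul ha.le, ← Real.rpow_neg ha.le]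
    congr 1; ring
  have hl2 : (a * l) ^ 2 = a ^ s := by
    rw [mul_pow, hldef, ← Real.rpow_natCast (a ^ ((s - 2) / 2)), ← Real.rpow_mul ha.le,
      ← Real.rpow_natCast a, ← Real.rpow_add ha]
    congr 1; push_cast; ring
  refine ⟨a, l, ha, hl, ?_, fun u g hu => ?_⟩
  · rw [hlN]
    nth_rewrite 1 [← Real.rpow_one a]
    rw [← Real.rpow_add ha, hadef, ← Real.rpow_mul hm.le, one_div_mul_cancel hD.ne', Real.rpow_one]
  · have h1 : ∀ y, cutPower s 0 (a * u y) + ‖(a * l) • g y‖ₑ ^ 2 =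
        ENNReal.ofReal (a ^ s) * (cutPower s 0 (u y) + ‖g y‖ₑ ^ 2) := fun y => by
      rw [cutPower_zero_mul s ha (hu y), enorm_smul, mul_pow, mul_add, ← hl2,
        Real.enorm_eq_ofReal (by positivity), ENNReal.ofReal_pow (by positivity)]
    simp_rw [h1]
    rw [lintegral_const_mul' _ _ ENNReal.ofReal_ne_top,
      lintegral_affine hl 0 fun y => cutPower s 0 (u y) + ‖g y‖ₑ ^ 2, ← mul_assoc,
      ← ENNReal.ofReal_mul (by positivity)]
    congr 2
    rw [hlN, ← Real.rpow_add ha, hadef, ← Real.rpow_mul hm.le, hα]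
    congr 1; field_simp

theorem powerCost_mul_le (hN : 1 ≤ N) {s : ℝ} (hs : s ≤ 1) {m : ℝ} (hm : 0 < m) (m₁ : ℝ) :
    powerCost N s (m * m₁) ≤ ENNReal.ofReal (m ^ costExponent N s) * powerCost N s m₁ := by
  have hc0 : ENNReal.ofReal (m ^ costExponent N s) ≠ 0 := by
    rw [Ne, ENNReal.ofReal_eq_zero, not_le]; positivity
  rw [mul_comm (ENNReal.ofReal _),
    ← ENNReal.div_le_iff_le_mul (Or.inl hc0) (Or.inl ENNReal.ofReal_ne_top)]
  refine le_of_forall_gt fun b hb => ?_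
  obtain ⟨u, g, h, hum, hgm, h0, hi, rfl, hlt⟩ := exists_of_powerCost_lt hb
  obtain ⟨a, l, ha, hl, hal, hE⟩ := exists_rescaled_profile (N := N) hN hs hm
  have hcomp := powerCost_le s (h.affine a hl 0) (fun x => mul_nonneg ha.le (h0 _))
    ((integrable_affine hi hl 0).const_mul a)
  rw [hE u g h0, integral_const_mul, integral_affine hl, ← mul_assoc, hal] at hcomp
  refine lt_of_le_of_lt ?_ hlt
  rw [ENNReal.div_le_iff_le_mul (Or.inl hc0) (Or.inl ENNReal.ofReal_ne_top),
    mul_comm (∫⁻ x, _)]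
  exact hcomp

/-- The minimal cost is a power of the mass. -/
theorem powerCost_eq (hN : 1 ≤ N) {s : ℝ} (hs : s ≤ 1) {m : ℝ} (hm : 0 < m) :
    powerCost N s m = powerCost N s 1 * ENNReal.ofReal (m ^ costExponent N s) := by
  refine le_antisymm ?_ ?_
  · have := powerCost_mul_le hN hs hm 1
    rwa [mul_one, mul_comm] at this
  -- The converse inequality is the same scaling, by `m⁻¹`.
  · have := powerCost_mul_le hN hs (inv_pos.2 hm) m
    rw [inv_mul_cancel₀ hm.ne', Real.inv_rpow hm.le] at this
    calc powerCost N s 1 * ENNReal.ofReal (m ^ costExponent N s)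
        ≤ ENNReal.ofReal (m ^ costExponent N s)⁻¹ * powerCost N s m *
          ENNReal.ofReal (m ^ costExponent N s) := by gcongr
      _ = (ENNReal.ofReal (m ^ costExponent N s)⁻¹ * ENNReal.ofReal (m ^ costExponent N s)) *
          powerCost N s m := by ring
      _ = powerCost N s m := by
        rw [← ENNReal.ofReal_mul (by positivity), inv_mul_cancel₀ (by positivity)]; simp

theorem exists_le_volume_closedBall (hN : 1 ≤ N) {K : ℝ≥0∞} (hK : K ≠ ⊤) :
    ∃ r : ℝ, 0 < r ∧ K ≤ volume (Metric.closedBall (0 : Space N) r) := by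
  set b := volume (Metric.ball (0 : Space N) 1) with hb
  have hb0 : b ≠ 0 := (Metric.measure_ball_pos volume _ one_pos).ne'
  have hbt : b ≠ ⊤ := measure_ball_lt_top.ne
  refine ⟨max 1 (K / b).toReal, by positivity, ?_⟩
  rw [Measure.addHaar_closedBall _ _ (by positivity), finrank_euclideanSpace_fin, ← hb]
  have h1 : (K / b).toReal ≤ max 1 (K / b).toReal ^ N :=
    (le_max_right _ _).trans (le_self_pow₀ (le_max_left _ _) (by omega))
  have hfin : K / b ≠ ⊤ := ENNReal.div_ne_top hK hb0
  calc K = K / b * b := (ENNReal.div_mul_cancel hb0 hbt).symm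
    _ ≤ _ := by
      gcongr
      exact (ENNReal.ofReal_toReal hfin).symm.le.trans (ENNReal.ofReal_le_ofReal h1)

/-- Heights up to one are bounded by the potential because `s ≤ 1`, larger heights by their square.
-/
theorem enorm_le_cutPower_add_sq {s : ℝ} (hs : s ≤ 1) {a : ℝ} (ha : 0 ≤ a) :
    ‖a‖ₑ ≤ cutPower s 0 a + ‖a‖ₑ ^ 2 := by
  rcases ha.eq_or_lt with rfl | ha
  · simp
  rw [Real.enorm_eq_ofReal ha.le]
  rcases le_total a 1 with h1 | h1
  · refine le_add_right ?_
    rw [cutPower, if_neg (not_le.2 ha)]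
    refine ENNReal.ofReal_le_ofReal ?_
    calc a = a ^ (1 : ℝ) := (Real.rpow_one a).symm
      _ ≤ a ^ s := Real.rpow_le_rpow_of_exponent_ge ha h1 hs
  · refine le_add_left ?_
    rw [← ENNReal.ofReal_pow ha.le]
    exact ENNReal.ofReal_le_ofReal (by nlinarith)

theorem lintegral_enorm_of_nonneg (hi : Integrable u volume) (h0 : ∀ x, 0 ≤ u x) :
    ∫⁻ x, ‖u x‖ₑ = ENNReal.ofReal (∫ x, u x) := by
  rw [ofReal_integral_eq_lintegral_ofReal hi (Eventually.of_forall h0)]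
  exact lintegral_congr fun x => Real.enorm_eq_ofReal (h0 x)

/-- Unit masses have positive cost. -/
theorem powerCost_one_pos (hN : 1 ≤ N) {s : ℝ} (hs : s ≤ 1) : 0 < powerCost N s 1 := by
  -- With a ball of volume at least `4` the mass term of Nash's inequality is at most `2 / 4`. An
  -- energy below `c` adds at most `1 / 4`, so the unit mass would be at most `3 / 4`.
  obtain ⟨r, hr, hvol⟩ := exists_le_volume_closedBall (N := N) hN (K := 4) (by simp)
  set c : ℝ≥0∞ := (4 * (1 + 2 * ENNReal.ofReal (r ^ 2)))⁻¹ with hc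
  have hc0 : 0 < c := ENNReal.inv_pos.2 (by finiteness)
  by_contra hcon
  rw [not_lt, nonpos_iff_eq_zero] at hcon
  obtain ⟨u, g, h, hum, hgm, h0, hi, h1, hlt⟩ :=
    exists_of_powerCost_lt (N := N) (s := s) (m := 1) (hcon.symm ▸ hc0)
  set E := ∫⁻ x, (cutPower s 0 (u x) + ‖g x‖ₑ ^ 2) with hE
  have hmass : ∫⁻ x, ‖u x‖ₑ = 1 := by rw [lintegral_enorm_of_nonneg hi h0, h1]; simp
  have hnash := h.nash hum hgm MeasurableSet.univ MeasurableSet.univ hr (by simp)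
  simp only [Measure.restrict_univ, hmass, one_pow, mul_one] at hnash
  have hcm : Measurable fun x => cutPower s 0 (u x) := (measurable_cutPower s 0).comp hum
  have e1 : E = (∫⁻ x, cutPower s 0 (u x)) + ∫⁻ x, ‖g x‖ₑ ^ 2 := lintegral_add_left hcm _
  have e2 : (1 : ℝ≥0∞) ≤ (∫⁻ x, cutPower s 0 (u x)) + ∫⁻ x, ‖u x‖ₑ ^ 2 := by
    rw [← hmass, ← lintegral_add_left hcm]
    exact lintegral_mono fun x => enorm_le_cutPower_add_sq hs (h0 x)
  have hv : (volume (Metric.closedBall (0 : Space N) r))⁻¹ ≤ 4⁻¹ := ENNReal.inv_le_inv.2 hvol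
  have h3 : (1 : ℝ≥0∞) ≤ (1 + 2 * ENNReal.ofReal (r ^ 2)) * E + 2 * 4⁻¹ := by
    calc (1 : ℝ≥0∞) ≤ _ := e2
      _ ≤ E + (2 * ENNReal.ofReal (r ^ 2) * E + 2 * 4⁻¹) := by
        refine add_le_add (by rw [e1]; exact le_self_add) (hnash.trans ?_)
        gcongr
        rw [e1]; exact le_add_self
      _ = _ := by ring
  have h4 : (1 + 2 * ENNReal.ofReal (r ^ 2)) * E ≤ 4⁻¹ := by
    calc (1 + 2 * ENNReal.ofReal (r ^ 2)) * E ≤ (1 + 2 * ENNReal.ofReal (r ^ 2)) * c := by gcongr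
      _ = 4⁻¹ := by
        rw [hc, ENNReal.mul_inv (Or.inl (by simp)) (Or.inl (by simp)), mul_left_comm,
          ENNReal.mul_inv_cancel (by simp) (by finiteness), mul_one]
  have h5 : (1 : ℝ≥0∞) ≤ 4⁻¹ + 2 * 4⁻¹ := h3.trans (by gcongr)
  have h6 : (4⁻¹ : ℝ≥0∞) + 2 * 4⁻¹ = ENNReal.ofReal (3 / 4) := by
    rw [show (4 : ℝ≥0∞)⁻¹ = ENNReal.ofReal (4⁻¹) by
        rw [ENNReal.ofReal_inv_of_pos (by norm_num)]; norm_num,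
      show (2 : ℝ≥0∞) = ENNReal.ofReal 2 by norm_num, ← ENNReal.ofReal_mul (by norm_num),
      ← ENNReal.ofReal_add (by norm_num) (by norm_num)]
    norm_num
  rw [h6, ENNReal.one_le_ofReal] at h5
  norm_num at h5

/-! ### Truncation of small values at a level chosen by averaging -/

theorem lintegral_inv_Ioo {a b : ℝ} (ha : 0 < a) (hab : a < b) :
    ∫⁻ t in Set.Ioo a b, ENNReal.ofReal t⁻¹ = ENNReal.ofReal (Real.log (b / a)) := by
  have h0 : (0 : ℝ) ∉ Set.uIcc a b := by
    rw [Set.uIcc_of_le hab.le]; exact fun h => absurd h.1 (not_le.2 ha)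
  have hi : IntervalIntegrable (fun t : ℝ => t⁻¹) volume a b :=
    intervalIntegral.intervalIntegrable_inv (fun x hx hx0 => h0 (hx0 ▸ hx)) continuousOn_id
  rw [← integral_inv h0, intervalIntegral.integral_of_le hab.le, integral_Ioc_eq_integral_Ioo,
    ofReal_integral_eq_lintegral_ofReal]
  · rw [intervalIntegrable_iff_integrableOn_Ioo_of_le hab.le] at hi
    exact hi
  · refine (ae_restrict_iff' measurableSet_Ioo).2 (Eventually.of_forall fun t ht => ?_)
    exact inv_nonneg.2 (ha.trans ht.1).le

/-- The integrand is singular at `t = v` if `b > 0`, but integrable since `b < 1`; by scaling the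
value does not depend on `v`. -/
theorem lintegral_one_sub_rpow {v b : ℝ} (hv : 0 < v) (hb : b < 1) :
    ∫⁻ t in Set.Ioo 0 v, ENNReal.ofReal (v⁻¹ * (1 - t / v) ^ (-b)) =
      ENNReal.ofReal (1 / (1 - b)) := by
  have hb' : 0 < 1 - b := by linarith
  set G : ℝ → ℝ := fun t => -((1 - t / v) ^ (1 - b)) / (1 - b) with hG
  have hcont : ContinuousOn G (Set.Icc 0 v) := by
    refine ContinuousOn.div_const (ContinuousOn.neg ?_) _
    exact ContinuousOn.rpow_const (by fun_prop) fun x _ => Or.inr hb'.le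
  have hder : ∀ t ∈ Set.Ioo 0 v, HasDerivAt G (v⁻¹ * (1 - t / v) ^ (-b)) t := by
    intro t ht
    have hpos : 0 < 1 - t / v := by
      rw [sub_pos, div_lt_one hv]; exact ht.2
    have h1 : HasDerivAt (fun t : ℝ => 1 - t / v) (-(1 / v)) t :=
      ((hasDerivAt_id t).div_const v).const_sub 1
    have h2 := ((h1.rpow_const (p := 1 - b) (Or.inl hpos.ne')).neg).div_const (1 - b)
    refine h2.congr_deriv ?_
    rw [show 1 - b - 1 = -b by ring]
    field_simp
  have hnn : ∀ t ∈ Set.Ioo 0 v, 0 ≤ v⁻¹ * (1 - t / v) ^ (-b) := by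
    intro t ht
    have hpos : 0 ≤ 1 - t / v := by
      rw [sub_nonneg, div_le_one hv]; exact ht.2.le
    positivity
  have hi : IntegrableOn (fun t => v⁻¹ * (1 - t / v) ^ (-b)) (Set.Ioc 0 v) :=
    intervalIntegral.integrableOn_deriv_of_nonneg hcont hder hnn
  have hint := intervalIntegral.integral_eq_sub_of_hasDerivAt_of_le hv.le hcont hder
    ((intervalIntegrable_iff_integrableOn_Ioc_of_le hv.le).2 hi)
  rw [intervalIntegral.integral_of_le hv.le, integral_Ioc_eq_integral_Ioo] at hint
  rw [← ofReal_integral_eq_lintegral_ofReal (hi.mono_set Set.Ioo_subset_Ioc_self), hint]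
  · congr 1
    simp only [hG, div_self hv.ne', sub_self, Real.zero_rpow hb'.ne', zero_div, sub_zero,
      Real.one_rpow]
    ring
  · exact (ae_restrict_iff' measurableSet_Ioo).2 (Eventually.of_forall hnn)

/-- The weight that bounds the distortion caused by the truncation at level `t`. -/
def truncWeight (b t v : ℝ) : ℝ≥0∞ := if v ≤ t then 0 else ENNReal.ofReal ((1 - t / v) ^ (-b))

/-- The logarithmic average of the distortion of truncations. -/
theorem lintegral_truncWeight_le {a a' b v : ℝ} (ha : 0 < a) (haa' : a < a') (hb : b < 1) :
    ∫⁻ t in Set.Ioo a a', ENNReal.ofReal t⁻¹ * truncWeight b t v ≤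
      if v ≤ a then 0 else ENNReal.ofReal (Real.log (a' / a)) + ENNReal.ofReal (1 / (1 - b)) := by
  split_ifs with hv
  · refine le_of_eq ((setLIntegral_congr_fun measurableSet_Ioo fun t ht => ?_).trans
      lintegral_zero)
    simp only [truncWeight, if_pos (hv.trans ht.1.le), mul_zero]
  · rw [not_le] at hv
    have hv0 : 0 < v := ha.trans hv
    rw [← lintegral_inv_Ioo ha haa', ← lintegral_one_sub_rpow hv0 hb]
    calc ∫⁻ t in Set.Ioo a a', ENNReal.ofReal t⁻¹ * truncWeight b t v
        ≤ ∫⁻ t in Set.Ioo a a', (ENNReal.ofReal t⁻¹ + (Set.Ioo 0 v).indicator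
            (fun t => ENNReal.ofReal (v⁻¹ * (1 - t / v) ^ (-b))) t) := by
          refine setLIntegral_mono' measurableSet_Ioo fun t ht => ?_
          have ht0 : 0 < t := ha.trans ht.1
          rw [truncWeight]
          split_ifs with hvt
          · simp
          · rw [not_le] at hvt
            rw [Set.indicator_of_mem (show t ∈ Set.Ioo 0 v from ⟨ht0, hvt⟩),
              ← ENNReal.ofReal_mul (by positivity)]
            have hx : 0 < 1 - t / v := by rw [sub_pos, div_lt_one hv0]; exact hvt
            rw [← ENNReal.ofReal_add (by positivity) (by positivity)]
            refine ENNReal.ofReal_le_ofReal ?_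
            -- The identity `1 / t = (1 / t) (1 - t / v) + 1 / v` separates a logarithmic part, in
            -- which the factor `1 - t / v` absorbs the weight, from a part whose integral is `1 /
            -- (1 - b)`.
            have h1 : (1 - t / v) ^ (-b) * (1 - t / v) ≤ 1 := by
              nth_rewrite 2 [← Real.rpow_one (1 - t / v)]
              rw [← Real.rpow_add hx]
              refine Real.rpow_le_one hx.le ?_ (by linarith)
              rw [sub_le_self_iff]; positivity
            have h2 : t⁻¹ * (1 - t / v) ^ (-b) =
                t⁻¹ * ((1 - t / v) ^ (-b) * (1 - t / v)) + v⁻¹ * (1 - t / v) ^ (-b) := by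
              field_simp
              ring
            rw [h2]
            have : t⁻¹ * ((1 - t / v) ^ (-b) * (1 - t / v)) ≤ t⁻¹ * 1 := by gcongr
            linarith
      _ ≤ _ := by
          rw [lintegral_add_left (by fun_prop)]
          refine add_le_add le_rfl ((setLIntegral_le_lintegral _ _).trans ?_)
          rw [lintegral_indicator measurableSet_Ioo]

/-- The truncation `((v ^ q - t ^ q)₊) ^ (1 / q)`. -/
def trunc (q t v : ℝ) : ℝ := (max v t ^ q - t ^ q) ^ (1 / q)

/-- The derivative of the truncation. -/
def truncDeriv (q t v : ℝ) : ℝ := if v ≤ t then 0 else (1 - (t / v) ^ q) ^ (1 / q - 1)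

section trunc

variable {q t r : ℝ}

theorem trunc_of_le (hq : 1 < q) (h : r ≤ t) : trunc q t r = 0 := by
  rw [trunc, max_eq_right h, sub_self, Real.zero_rpow (by positivity)]

theorem trunc_of_lt (hq : 1 < q) (ht : 0 < t) (h : t < r) :
    trunc q t r = r * (1 - (t / r) ^ q) ^ (1 / q) ∧ 0 < t / r ∧ t / r < 1 ∧
      1 - t / r ≤ 1 - (t / r) ^ q := by
  have hr : 0 < r := ht.trans h
  have h1 : t / r < 1 := (div_lt_one hr).2 h
  have h0 : 0 < t / r := by positivity
  have h2 : (t / r) ^ q ≤ t / r := by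
    calc (t / r) ^ q ≤ (t / r) ^ (1 : ℝ) := Real.rpow_le_rpow_of_exponent_ge h0 h1.le hq.le
      _ = t / r := Real.rpow_one _
  refine ⟨?_, h0, h1, by linarith⟩
  have h3 : r ^ q - t ^ q = r ^ q * (1 - (t / r) ^ q) := by
    rw [Real.div_rpow ht.le hr.le]
    have : r ^ q ≠ 0 := by positivity
    field_simp
  rw [trunc, max_eq_left h.le, h3, Real.mul_rpow (by positivity) (by linarith),
    ← Real.rpow_mul hr.le, mul_one_div_cancel (by linarith), Real.rpow_one]

theorem trunc_nonneg (hq : 1 < q) (ht : 0 < t) : 0 ≤ trunc q t r := by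
  refine Real.rpow_nonneg (sub_nonneg.2 ?_) _
  exact Real.rpow_le_rpow ht.le (le_max_right _ _) (by linarith)

theorem trunc_le (hq : 1 < q) (ht : 0 < t) (hr : 0 ≤ r) : trunc q t r ≤ r := by
  rcases le_or_gt r t with h | h
  · rwa [trunc_of_le hq h]
  · obtain ⟨h1, h2, h3, h4⟩ := trunc_of_lt hq ht h
    rw [h1]
    refine mul_le_of_le_one_right hr (Real.rpow_le_one (by linarith) ?_ (by positivity))
    have : 0 ≤ (t / r) ^ q := by positivity
    linarith

theorem sub_le_trunc (hq : 1 < q) (ht : 0 < t) : r - t ≤ trunc q t r := by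
  rcases le_or_gt r t with h | h
  · exact (sub_nonpos.2 h).trans (trunc_nonneg hq ht)
  · obtain ⟨h1, h2, h3, h4⟩ := trunc_of_lt hq ht h
    have hr : 0 < r := ht.trans h
    have h5 : 1 - t / r ≤ (1 - (t / r) ^ q) ^ (1 / q) := by
      calc 1 - t / r = (1 - t / r) ^ (1 : ℝ) := (Real.rpow_one _).symm
        _ ≤ (1 - t / r) ^ (1 / q) := Real.rpow_le_rpow_of_exponent_ge (by linarith) (by linarith)
            (by rw [div_le_one (by linarith)]; exact hq.le)
        _ ≤ _ := Real.rpow_le_rpow (by linarith) h4 (by positivity)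
    rw [h1]
    calc r - t = r * (1 - t / r) := by field_simp
      _ ≤ _ := by gcongr

theorem isSingularPrimitive_trunc (hq : 1 < q) (ht : 0 < t) :
    IsSingularPrimitive t (trunc q t) (truncDeriv q t) where
  eq_zero r hr := trunc_of_le hq hr
  deriv_eq_zero r hr := by rw [truncDeriv, if_pos hr]
  deriv_nonneg r := by
    rw [truncDeriv]
    split_ifs with h
    · exact le_rfl
    · obtain ⟨h1, h2, h3, h4⟩ := trunc_of_lt hq ht (not_le.1 h)
      exact Real.rpow_nonneg (by linarith) _
  continuousOn_deriv := by
    have : ContinuousOn (fun v : ℝ => (1 - (t / v) ^ q) ^ (1 / q - 1)) (Set.Ioi t) := by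
      intro r hr
      obtain ⟨h1, h2, h3, h4⟩ := trunc_of_lt hq ht hr
      have hr0 : r ≠ 0 := (ht.trans hr).ne'
      refine ContinuousAt.continuousWithinAt (ContinuousAt.rpow_const ?_ (Or.inl (by linarith)))
      refine continuousAt_const.sub (ContinuousAt.rpow_const ?_ (Or.inl h2.ne'))
      exact continuousAt_const.div continuousAt_id hr0
    refine this.congr fun r hr => ?_
    rw [truncDeriv, if_neg (not_le.2 hr)]
  continuous := by
    unfold trunc
    refine Continuous.rpow_const (Continuous.sub (Continuous.rpow_const (by fun_prop) fun x => ?_)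
      continuous_const) fun x => Or.inr (by positivity)
    exact Or.inl (lt_max_of_lt_right ht).ne'
  hasDerivAt r hr := by
    obtain ⟨h1, h2, h3, h4⟩ := trunc_of_lt hq ht hr
    have hr0 : 0 < r := ht.trans hr
    have hq0 : 0 < q := by linarith
    have h5 : r ^ q - t ^ q = r ^ q * (1 - (t / r) ^ q) := by
      rw [Real.div_rpow ht.le hr0.le]
      have : r ^ q ≠ 0 := by positivity
      field_simp
    have hpos : 0 < 1 - (t / r) ^ q := by linarith
    have hd : HasDerivAt (fun v : ℝ => (v ^ q - t ^ q) ^ (1 / q))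
        (q * r ^ (q - 1) * (1 / q) * (r ^ q - t ^ q) ^ (1 / q - 1)) r := by
      have h6 := (Real.hasDerivAt_rpow_const (p := q) (Or.inl hr0.ne')).sub_const (t ^ q)
      exact h6.rpow_const (Or.inl (by rw [h5]; positivity))
    have heq : (fun v : ℝ => (v ^ q - t ^ q) ^ (1 / q)) =ᶠ[𝓝 r] trunc q t := by
      filter_upwards [Ioi_mem_nhds hr] with v hv
      rw [trunc, max_eq_left (le_of_lt hv)]
    refine (hd.congr_of_eventuallyEq heq.symm).congr_deriv ?_
    rw [truncDeriv, if_neg (not_le.2 hr), h5, Real.mul_rpow (by positivity) hpos.le,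
      ← Real.rpow_mul hr0.le]
    have h7 : r ^ (q - 1) * r ^ (q * (1 / q - 1)) = 1 := by
      rw [← Real.rpow_add hr0]
      have : q - 1 + q * (1 / q - 1) = 0 := by field_simp; ring
      rw [this, Real.rpow_zero]
    calc q * r ^ (q - 1) * (1 / q) * (r ^ (q * (1 / q - 1)) * (1 - (t / r) ^ q) ^ (1 / q - 1))
        = (q * (1 / q)) * (r ^ (q - 1) * r ^ (q * (1 / q - 1))) *
          (1 - (t / r) ^ q) ^ (1 / q - 1) := by ring
      _ = _ := by rw [h7, mul_one_div_cancel hq0.ne']; ring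

theorem rpow_neg_le_of_le {x y a b : ℝ} (hx : 0 < x) (hxy : x ≤ y) (hx1 : x ≤ 1) (ha : 0 ≤ a)
    (hab : a ≤ b) : y ^ (-a) ≤ x ^ (-b) :=
  (Real.rpow_le_rpow_of_nonpos hx hxy (by linarith)).trans
    (Real.rpow_le_rpow_of_exponent_ge hx hx1 (by linarith))

/-- Squaring turns the exponent `1 / q - 1` into `-(2 - 2 / q)`, and `(t / r) ^ q ≤ t / r` allows
the simpler base `1 - t / r`. -/
theorem truncDeriv_sq_le {b : ℝ} (hq : 1 < q) (ht : 0 < t) (hb : 2 - 2 / q ≤ b) :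
    ‖truncDeriv q t r‖ₑ ^ 2 ≤ truncWeight b t r := by
  rw [truncDeriv, truncWeight]
  split_ifs with h
  · simp
  · obtain ⟨h1, h2, h3, h4⟩ := trunc_of_lt hq ht (not_le.1 h)
    have hpos : 0 < 1 - (t / r) ^ q := by linarith
    rw [Real.enorm_eq_ofReal (by positivity), ← ENNReal.ofReal_pow (by positivity)]
    refine ENNReal.ofReal_le_ofReal ?_
    rw [← Real.rpow_natCast, ← Real.rpow_mul hpos.le]
    have : (1 / q - 1) * ((2 : ℕ) : ℝ) = -(2 - 2 / q) := by push_cast; ring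
    rw [this]
    refine rpow_neg_le_of_le (by linarith) h4 (by linarith) ?_ hb
    rw [sub_nonneg, div_le_iff₀ (by linarith)]
    linarith

/-- For `s < 0` the potential of the truncated value blows up like `(1 - (t / r) ^ q) ^ (s / q)`. A
larger `q` weakens this singularity at the expense of that of the derivative. -/
theorem cutPower_trunc_le {b s : ℝ} (hq : 1 < q) (ht : 0 < t) (hb0 : 0 ≤ b) (hb : -s / q ≤ b) :
    cutPower s 0 (trunc q t r) ≤ truncWeight b t r * ENNReal.ofReal (r ^ s) := by
  rw [truncWeight]
  split_ifs with h
  · rw [trunc_of_le hq h]; simp [cutPower]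
  · rw [not_le] at h
    obtain ⟨h1, h2, h3, h4⟩ := trunc_of_lt hq ht h
    have hr : 0 < r := ht.trans h
    have hpos : 0 < 1 - (t / r) ^ q := by linarith
    have hT : 0 < trunc q t r := by rw [h1]; positivity
    rw [cutPower, if_neg (not_le.2 hT), ← ENNReal.ofReal_mul (by
      exact Real.rpow_nonneg (by linarith) _)]
    refine ENNReal.ofReal_le_ofReal ?_
    rw [h1, Real.mul_rpow hr.le (by positivity), ← Real.rpow_mul hpos.le, mul_comm]
    gcongr
    rcases le_total 0 s with hs | hs
    · calc (1 - (t / r) ^ q) ^ (1 / q * s) ≤ 1 := by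
            refine Real.rpow_le_one hpos.le ?_ (by positivity)
            have : 0 ≤ (t / r) ^ q := by positivity
            linarith
        _ ≤ _ := Real.one_le_rpow_of_pos_of_le_one_of_nonpos (by linarith) (by linarith)
            (by linarith)
    · have : 1 / q * s = -(-s / q) := by ring
      rw [this]
      exact rpow_neg_le_of_le (by linarith) h4 (by linarith)
        (div_nonneg (by linarith) (by linarith)) hb

end trunc

theorem locallyIntegrable_of_lintegral_sq {E : Type*} [NormedAddCommGroup E] {f : Space N → E}
    (hf : AEStronglyMeasurable f volume) (h : ∫⁻ x, ‖f x‖ₑ ^ 2 ≠ ⊤) :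
    LocallyIntegrable f volume := by
  have : MemLp f 2 volume := by
    refine ⟨hf, ?_⟩
    rw [eLpNorm_lt_top_iff_lintegral_rpow_enorm_lt_top (by simp) (by simp)]
    simpa using h.lt_top
  exact this.locallyIntegrable (by norm_num)

theorem measurable_truncWeight (b : ℝ) (hu : Measurable u) :
    Measurable fun p : ℝ × Space N => truncWeight b p.1 (u p.2) := by
  unfold truncWeight
  have hu2 : Measurable fun p : ℝ × Space N => u p.2 := hu.comp measurable_snd
  refine Measurable.ite (measurableSet_le hu2 measurable_fst) measurable_const ?_
  exact ((measurable_const.sub (measurable_fst.div hu2)).pow_const _).ennreal_ofReal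

/-- Truncation: small values of `u` can be removed at the cost of a factor close to one. -/
theorem exists_truncation {s : ℝ} (hs : -2 < s) :
    ∃ C : ℝ, 0 ≤ C ∧ ∀ {N : ℕ} {u : Space N → ℝ} {g : Space N → Space N}, IsW11loc u g →
      Measurable u → Measurable g → (∀ x, 0 ≤ u x) → ∀ τ τ' : ℝ, 0 < τ → τ < τ' →
      ∫⁻ x, (cutPower s τ (u x) + ‖g x‖ₑ ^ 2) ≠ ⊤ →
      ∃ (w : Space N → ℝ) (k : Space N → Space N), IsW11loc w k ∧ Measurable w ∧ Measurable k ∧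
        (∀ x, 0 ≤ w x ∧ w x ≤ u x ∧ u x - τ' ≤ w x) ∧
        ∫⁻ x, (cutPower s 0 (w x) + ‖k x‖ₑ ^ 2) ≤ ENNReal.ofReal (1 + C / Real.log (τ' / τ)) *
          ∫⁻ x, (cutPower s τ (u x) + ‖g x‖ₑ ^ 2) := by
  -- The condition `q < 2` makes the exponent `2 - 2 / q` of the gradient weight smaller than one,
  -- and `q > -s` does so for the exponent `-s / q` of the potential. Both can be met because `s >
  -- -2`.
  obtain ⟨q, hq1, hq2, hqs⟩ : ∃ q : ℝ, 1 < q ∧ q < 2 ∧ -s < q := by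
    obtain ⟨q, h1, h2⟩ := exists_between (show max 1 (-s) < 2 from max_lt (by norm_num) (by linarith))
    exact ⟨q, (le_max_left _ _).trans_lt h1, h2, (le_max_right _ _).trans_lt h1⟩
  have hq0 : 0 < q := by linarith
  set b := max (2 - 2 / q) (-s / q) with hb
  have hb1 : b < 1 := by
    refine max_lt ?_ ?_
    · have : 1 < 2 / q := by rw [lt_div_iff₀ hq0]; linarith
      linarith
    · rw [div_lt_one hq0]; exact hqs
  have hb0 : 0 ≤ b := by
    refine le_max_of_le_left ?_
    rw [sub_nonneg, div_le_iff₀ hq0]; linarith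
  have hC0 : 0 ≤ 1 / (1 - b) := by
    have : 0 < 1 - b := by linarith
    positivity
  refine ⟨1 / (1 - b), hC0, ?_⟩
  intro N u g h hum hgm h0 τ τ' hτ hττ' hE
  set E := ∫⁻ x, (cutPower s τ (u x) + ‖g x‖ₑ ^ 2) with hEdef
  set Lr := Real.log (τ' / τ) with hLr
  have hL0 : 0 < Lr := Real.log_pos ((one_lt_div hτ).2 hττ')
  set e : Space N → ℝ≥0∞ := fun x => ENNReal.ofReal (u x ^ s) + ‖g x‖ₑ ^ 2 with he
  have hem : Measurable e := (hum.pow_const s).ennreal_ofReal.add (hgm.enorm.pow_const 2)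
  have hwm := measurable_truncWeight b hum
  set J : ℝ → ℝ≥0∞ := fun t => ∫⁻ x, truncWeight b t (u x) * e x with hJ
  have hJm : Measurable J := Measurable.lintegral_prod_right'
    (f := fun p : ℝ × Space N => truncWeight b p.1 (u p.2) * e p.2)
    (hwm.mul (hem.comp measurable_snd))
  -- Levels are averaged with respect to `dt / t`, of total mass `log (τ' / τ)` on `(τ, τ')`. The
  -- bounded excess `1 / (1 - b)` is negligible when this logarithm is large, and some level does no
  -- worse than the average.
  set ν : Measure ℝ := (volume.restrict (Set.Ioo τ τ')).withDensity fun t => ENNReal.ofReal t⁻¹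
    with hν
  have hνu : ν Set.univ = ENNReal.ofReal Lr := by
    rw [hν, withDensity_apply _ MeasurableSet.univ, Measure.restrict_univ,
      lintegral_inv_Ioo hτ hττ']
  have hνf : IsFiniteMeasure ν := ⟨by rw [hνu]; exact ENNReal.ofReal_lt_top⟩
  have hν0 : ν ≠ 0 := fun h => by
    have : ν Set.univ = 0 := by rw [h]; simp
    rw [hνu, ENNReal.ofReal_eq_zero] at this
    linarith
  have hνn : ν (Set.Ioo τ τ')ᶜ = 0 := by
    refine withDensity_absolutelyContinuous _ _ ?_
    rw [Measure.restrict_apply measurableSet_Ioo.compl]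
    simp
  have hJint : ∫⁻ t, J t ∂ν ≤ (ENNReal.ofReal Lr + ENNReal.ofReal (1 / (1 - b))) * E := by
    rw [hν, lintegral_withDensity_eq_lintegral_mul _ (by fun_prop) hJm]
    simp only [Pi.mul_apply, hJ]
    calc ∫⁻ t in Set.Ioo τ τ', ENNReal.ofReal t⁻¹ * ∫⁻ x, truncWeight b t (u x) * e x
        = ∫⁻ t in Set.Ioo τ τ', ∫⁻ x, ENNReal.ofReal t⁻¹ * truncWeight b t (u x) * e x := by
          refine lintegral_congr fun t => ?_
          rw [← lintegral_const_mul' _ _ ENNReal.ofReal_ne_top]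
          simp_rw [mul_assoc]
      _ = ∫⁻ x, ∫⁻ t in Set.Ioo τ τ', ENNReal.ofReal t⁻¹ * truncWeight b t (u x) * e x := by
          rw [lintegral_lintegral_swap]
          refine Measurable.aemeasurable ?_
          exact ((measurable_fst.inv.ennreal_ofReal).mul hwm).mul (hem.comp measurable_snd)
      _ ≤ ∫⁻ x, (ENNReal.ofReal Lr + ENNReal.ofReal (1 / (1 - b))) *
            (cutPower s τ (u x) + ‖g x‖ₑ ^ 2) := by
          refine lintegral_mono fun x => ?_
          have hmt : Measurable fun t : ℝ => ENNReal.ofReal t⁻¹ * truncWeight b t (u x) :=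
            measurable_inv.ennreal_ofReal.mul (hwm.comp (measurable_id.prodMk measurable_const))
          rw [lintegral_mul_const _ hmt]
          refine (mul_le_mul_left (lintegral_truncWeight_le hτ hττ' hb1) _).trans ?_
          simp only [he, cutPower]
          split_ifs with hx
          · simp
          · exact le_rfl
      _ = _ := lintegral_const_mul' _ _ (by finiteness)
  obtain ⟨t, ht, hJt⟩ := exists_notMem_null_le_laverage hν0 hJm.aemeasurable hνn
  rw [Set.notMem_compl_iff] at ht
  have ht0 : 0 < t := hτ.trans ht.1
  have hLne : ENNReal.ofReal Lr ≠ 0 := by rw [Ne, ENNReal.ofReal_eq_zero, not_le]; exact hL0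
  have hJle : J t ≤ ENNReal.ofReal (1 + 1 / (1 - b) / Lr) * E := by
    refine hJt.trans ?_
    rw [laverage_eq, hνu, ENNReal.div_le_iff hLne ENNReal.ofReal_ne_top]
    refine hJint.trans (le_of_eq ?_)
    rw [← ENNReal.ofReal_add hL0.le hC0, mul_right_comm, ← ENNReal.ofReal_mul (by positivity)]
    congr 2
    field_simp
  have hJfin : J t ≠ ⊤ := ne_top_of_le_ne_top (ENNReal.mul_ne_top ENNReal.ofReal_ne_top hE) hJle
  have hTm : Measurable (trunc q t) := (isSingularPrimitive_trunc hq1 ht0).continuous.measurable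
  have hDm : Measurable (truncDeriv q t) := by
    unfold truncDeriv
    exact Measurable.ite measurableSet_Iic measurable_const (by fun_prop)
  have hptw : ∀ x, cutPower s 0 (trunc q t (u x)) + ‖truncDeriv q t (u x) • g x‖ₑ ^ 2 ≤
      truncWeight b t (u x) * e x := fun x => by
    rw [he, mul_add, enorm_smul, mul_pow]
    refine add_le_add (cutPower_trunc_le hq1 ht0 hb0 (le_max_right _ _)) ?_
    gcongr
    exact truncDeriv_sq_le hq1 ht0 (le_max_left _ _)
  have hle : ∫⁻ x, (cutPower s 0 (trunc q t (u x)) + ‖truncDeriv q t (u x) • g x‖ₑ ^ 2) ≤ J t :=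
    lintegral_mono hptw
  have hkm : Measurable fun x => truncDeriv q t (u x) • g x := (hDm.comp hum).smul hgm
  refine ⟨fun x => trunc q t (u x), fun x => truncDeriv q t (u x) • g x, ?_, hTm.comp hum, hkm,
    fun x => ⟨trunc_nonneg hq1 ht0, trunc_le hq1 ht0 (h0 x), ?_⟩, hle.trans hJle⟩
  · refine h.comp_singularPrimitive hgm (isSingularPrimitive_trunc hq1 ht0) ?_ ?_
    · refine h.locallyIntegrable.mono (hTm.comp hum).aestronglyMeasurable
        (Eventually.of_forall fun x => ?_)
      rw [Real.norm_of_nonneg (trunc_nonneg hq1 ht0), Real.norm_of_nonneg (h0 x)]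
      exact trunc_le hq1 ht0 (h0 x)
    · refine locallyIntegrable_of_lintegral_sq hkm.aestronglyMeasurable
        (ne_top_of_le_ne_top hJfin (le_trans ?_ hle))
      exact lintegral_mono fun x => le_add_self
  · have := sub_le_trunc (r := u x) hq1 ht0
    linarith [ht.2]

/-- Unit masses have finite cost if `s > -2`. -/
theorem powerCost_one_lt_top (hN : 1 ≤ N) {s : ℝ} (hs : -2 < s) (hs1 : s ≤ 1) :
    powerCost N s 1 < ⊤ := by
  obtain ⟨C, hC, hex⟩ := exists_truncation hs
  let χ : ContDiffBump (0 : Space N) := ⟨1, 2, one_pos, one_lt_two⟩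
  have hχ : ContDiff ℝ 1 χ := χ.contDiff
  have hgc : Continuous (gradient χ) :=
    (InnerProductSpace.toDual ℝ (Space N)).symm.continuous.comp (hχ.continuous_fderiv (by simp))
  have hgz : ∀ x ∉ Metric.closedBall (0 : Space N) 2, gradient χ x = 0 := fun x hx => by
    have : fderiv ℝ χ x = 0 := image_eq_zero_of_notMem_tsupport fun h => hx (by
      have := tsupport_fderiv_subset ℝ h
      rwa [χ.tsupport_eq] at this)
    simp [gradient, this]
  have hχz : ∀ x ∉ Metric.closedBall (0 : Space N) 2, χ x = 0 := fun x hx =>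
    image_eq_zero_of_notMem_tsupport (by rwa [χ.tsupport_eq])
  obtain ⟨D, hD⟩ := (isCompact_closedBall (0 : Space N) 2).exists_bound_of_continuousOn
    hgc.continuousOn
  have hfin : ∫⁻ x, (cutPower s (1 / 4) (χ x) + ‖gradient χ x‖ₑ ^ 2) ≠ ⊤ := by
    have hb : ∀ x, cutPower s (1 / 4) (χ x) + ‖gradient χ x‖ₑ ^ 2 ≤
        (Metric.closedBall (0 : Space N) 2).indicator
          (fun _ => ENNReal.ofReal (max 1 ((1 / 4) ^ s)) + ENNReal.ofReal D ^ 2) x := fun x => by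
      by_cases hx : x ∈ Metric.closedBall (0 : Space N) 2
      · rw [Set.indicator_of_mem hx]
        gcongr
        · rw [cutPower]
          split_ifs with h
          · exact zero_le
          · rw [not_le] at h
            refine ENNReal.ofReal_le_ofReal ?_
            rcases le_total 0 s with h' | h'
            · exact (Real.rpow_le_one χ.nonneg χ.le_one h').trans (le_max_left _ _)
            · exact (Real.rpow_le_rpow_of_nonpos (by norm_num) h.le h').trans (le_max_right _ _)
        · rw [← ofReal_norm]
          exact ENNReal.ofReal_le_ofReal (hD x hx)
      · rw [Set.indicator_of_notMem hx, hχz x hx, hgz x hx, cutPower, if_pos (by norm_num)]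
        simp
    refine ne_top_of_le_ne_top ?_ (lintegral_mono hb)
    rw [lintegral_indicator measurableSet_closedBall, setLIntegral_const]
    exact ENNReal.mul_ne_top (by finiteness) measure_closedBall_lt_top.ne
  -- For `s < 0` the bump itself may have infinite energy near the boundary of its support. Its
  -- truncation has finite energy and keeps a positive mass, which scaling turns into mass one.
  obtain ⟨w, k, hwk, hwm, hkm, hw, hle⟩ := hex (isW11loc_of_contDiff hχ) hχ.continuous.measurable
    hgc.measurable (fun x => χ.nonneg) (1 / 4) (1 / 2) (by norm_num) (by norm_num) hfin
  have hwi : Integrable w volume := by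
    refine (χ.continuous.integrable_of_hasCompactSupport χ.hasCompactSupport).mono
      hwm.aestronglyMeasurable (Eventually.of_forall fun x => ?_)
    rw [Real.norm_of_nonneg (hw x).1, Real.norm_of_nonneg χ.nonneg]
    exact (hw x).2.1
  have hpos : 0 < ∫ x, w x := by
    rw [integral_pos_iff_support_of_nonneg (fun x => (hw x).1) hwi]
    refine (Metric.measure_ball_pos volume (0 : Space N) one_pos).trans_le (measure_mono ?_)
    intro x hx
    have h1 : χ x = 1 := χ.one_of_mem_closedBall (Metric.ball_subset_closedBall hx)
    have := (hw x).2.2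
    rw [h1] at this
    exact (show (0 : ℝ) < w x by linarith).ne'
  have hfin2 : powerCost N s (∫ x, w x) ≠ ⊤ :=
    ne_top_of_le_ne_top (ENNReal.mul_ne_top ENNReal.ofReal_ne_top hfin)
      ((powerCost_le s hwk (fun x => (hw x).1) hwi).trans hle)
  have := powerCost_mul_le hN hs1 (inv_pos.2 hpos) (∫ x, w x)
  rw [inv_mul_cancel₀ hpos.ne'] at this
  exact this.trans_lt (ENNReal.mul_lt_top ENNReal.ofReal_lt_top hfin2.lt_top)

/-! ### Localization in space by a cutoff with an averaged level -/

/-- The profile `(z / (z + σ)) ^ β` of a cutoff, where `z = (r - θ)₊`. -/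
def cutoff (β σ θ r : ℝ) : ℝ := (max (r - θ) 0 / (max (r - θ) 0 + σ)) ^ β

/-- The derivative of the cutoff profile. -/
def cutoffDeriv (β σ θ r : ℝ) : ℝ :=
  if r ≤ θ then 0 else β * ((r - θ) / (r - θ + σ)) ^ (β - 1) * (σ / (r - θ + σ) ^ 2)

/-- The weight that bounds the distortion caused by the cutoff. -/
def cutoffWeight (b σ θ r : ℝ) : ℝ≥0∞ :=
  if r ≤ θ then 0 else ENNReal.ofReal (1 + (σ / (r - θ)) ^ b)

section cutoff

variable {β σ θ r b : ℝ}

theorem cutoff_of_le (hβ : 0 < β) (h : r ≤ θ) : cutoff β σ θ r = 0 := by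
  rw [cutoff, max_eq_right (by linarith), zero_div, Real.zero_rpow hβ.ne']

theorem cutoff_nonneg (hσ : 0 < σ) : 0 ≤ cutoff β σ θ r :=
  Real.rpow_nonneg (div_nonneg (le_max_right _ _) (add_nonneg (le_max_right _ _) hσ.le)) _

theorem cutoff_le_one (hσ : 0 < σ) (hβ : 0 < β) : cutoff β σ θ r ≤ 1 := by
  have h0 : 0 ≤ max (r - θ) 0 := le_max_right _ _
  refine Real.rpow_le_one (div_nonneg h0 (add_nonneg h0 hσ.le)) ?_ hβ.le
  rw [div_le_one (by positivity)]
  linarith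

theorem isSingularPrimitive_cutoff (hσ : 0 < σ) (hβ : 0 < β) :
    IsSingularPrimitive θ (cutoff β σ θ) (cutoffDeriv β σ θ) where
  eq_zero r hr := cutoff_of_le hβ hr
  deriv_eq_zero r hr := by rw [cutoffDeriv, if_pos hr]
  deriv_nonneg r := by
    rw [cutoffDeriv]
    split_ifs with h
    · exact le_rfl
    · have : 0 < r - θ := by rw [not_le] at h; linarith
      positivity
  continuousOn_deriv := by
    have : ContinuousOn (fun r : ℝ => β * ((r - θ) / (r - θ + σ)) ^ (β - 1) *
        (σ / (r - θ + σ) ^ 2)) (Set.Ioi θ) := by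
      intro r hr
      have hz : 0 < r - θ := sub_pos.2 hr
      refine ContinuousAt.continuousWithinAt ((continuousAt_const.mul
        (ContinuousAt.rpow_const (ContinuousAt.div ?_ ?_ ?_)
        (Or.inl (div_pos hz (add_pos hz hσ)).ne'))).mul
        (ContinuousAt.div continuousAt_const ?_ (pow_pos (add_pos hz hσ) 2).ne'))
      · fun_prop
      · fun_prop
      · exact (add_pos hz hσ).ne'
      · fun_prop
    refine this.congr fun r hr => ?_
    rw [cutoffDeriv, if_neg (not_le.2 hr)]
  continuous := by
    unfold cutoff
    refine Continuous.rpow_const (Continuous.div (by fun_prop) (by fun_prop) fun x => ?_)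
      fun x => Or.inr hβ.le
    have : 0 ≤ max (x - θ) 0 := le_max_right _ _
    positivity
  hasDerivAt r hr := by
    have hz : 0 < r - θ := sub_pos.2 hr
    have h1 : HasDerivAt (fun r : ℝ => r - θ) 1 r := (hasDerivAt_id r).sub_const θ
    have h2 : HasDerivAt (fun r : ℝ => r - θ + σ) 1 r := h1.add_const σ
    have h3 := (h1.div h2 (add_pos hz hσ).ne').rpow_const (p := β)
      (Or.inl (div_pos hz (add_pos hz hσ)).ne')
    have heq : (fun r : ℝ => ((r - θ) / (r - θ + σ)) ^ β) =ᶠ[𝓝 r] cutoff β σ θ := by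
      filter_upwards [Ioi_mem_nhds hr] with v hv
      rw [cutoff, max_eq_left (sub_pos.2 hv).le]
    refine (h3.congr_of_eventuallyEq heq.symm).congr_deriv ?_
    rw [cutoffDeriv, if_neg (not_le.2 hr)]
    simp only [Pi.div_apply]
    have e1 : (1 * (r - θ + σ) - (r - θ) * 1) / (r - θ + σ) ^ 2 = σ / (r - θ + σ) ^ 2 := by
      congr 1; ring
    rw [e1]; ring

theorem one_add_rpow_le {y a b : ℝ} (hy : 0 ≤ y) (hab : a ≤ b) (hb0 : 0 ≤ b) (hb1 : b ≤ 1) :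
    (1 + y) ^ a ≤ 1 + y ^ b := by
  calc (1 + y) ^ a ≤ (1 + y) ^ b := Real.rpow_le_rpow_of_exponent_le (by linarith) hab
    _ ≤ 1 ^ b + y ^ b := Real.rpow_add_le_add_rpow zero_le_one hy hb0 hb1
    _ = _ := by rw [Real.one_rpow]

theorem div_rpow_neg_le {z a : ℝ} (hz : 0 < z) (hσ : 0 < σ) (hab : a ≤ b) (hb0 : 0 ≤ b)
    (hb1 : b ≤ 1) : (z / (z + σ)) ^ (-a) ≤ 1 + (σ / z) ^ b := by
  rw [Real.rpow_neg (by positivity), ← Real.inv_rpow (by positivity), inv_div]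
  have : (z + σ) / z = 1 + σ / z := by field_simp
  rw [this]
  exact one_add_rpow_le (by positivity) hab hb0 hb1

/-- The factor `σ⁻¹ ^ 2` is the price of a profile that rises over a width `σ`; the singular factor
`(z / (z + σ)) ^ (2 β - 2)` is left to the average over levels. -/
theorem cutoffDeriv_sq_le (hσ : 0 < σ) (hβ0 : 0 < β) (hβ1 : β ≤ 1) (hb : 2 - 2 * β ≤ b)
    (hb1 : b ≤ 1) :
    ‖cutoffDeriv β σ θ r‖ₑ ^ 2 ≤ ENNReal.ofReal (σ⁻¹ ^ 2) * cutoffWeight b σ θ r := by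
  rw [cutoffDeriv, cutoffWeight]
  split_ifs with h
  · simp
  · have hz : 0 < r - θ := by rw [not_le] at h; linarith
    rw [Real.enorm_eq_ofReal (by positivity), ← ENNReal.ofReal_pow (by positivity),
      ← ENNReal.ofReal_mul (by positivity)]
    refine ENNReal.ofReal_le_ofReal ?_
    set z := r - θ with hzdef
    have h1 : β * (z / (z + σ)) ^ (β - 1) * (σ / (z + σ) ^ 2) ≤ σ⁻¹ * (z / (z + σ)) ^ (β - 1) := by
      have : σ / (z + σ) ^ 2 ≤ σ⁻¹ := by
        rw [div_le_iff₀ (by positivity), inv_mul_eq_div, le_div_iff₀ hσ]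
        nlinarith
      calc β * (z / (z + σ)) ^ (β - 1) * (σ / (z + σ) ^ 2)
          ≤ 1 * (z / (z + σ)) ^ (β - 1) * σ⁻¹ := by gcongr
        _ = _ := by ring
    calc (β * (z / (z + σ)) ^ (β - 1) * (σ / (z + σ) ^ 2)) ^ 2
        ≤ (σ⁻¹ * (z / (z + σ)) ^ (β - 1)) ^ 2 := by gcongr
      _ = σ⁻¹ ^ 2 * (z / (z + σ)) ^ (-(2 - 2 * β)) := by
        rw [mul_pow, ← Real.rpow_natCast ((z / (z + σ)) ^ (β - 1)), ← Real.rpow_mul (by positivity)]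
        congr 2
        push_cast; ring
      _ ≤ _ := by
        gcongr
        exact div_rpow_neg_le hz hσ hb (by linarith) hb1

/-- If `s < 0`, lowering a height increases its potential, here by the factor `φ ^ s` with `φ` the
cutoff. Heights that fall to `τ` or below cost nothing. -/
theorem cutPower_cutoff_le {s τ a : ℝ} (hσ : 0 < σ) (hβ0 : 0 < β) (hb : -(β * s) ≤ b) (hb0 : 0 ≤ b)
    (hb1 : b ≤ 1) (hτ : 0 ≤ τ) (ha : 0 ≤ a) :
    cutPower s τ (cutoff β σ θ r * a) ≤ cutoffWeight b σ θ r * cutPower s τ a := by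
  rw [cutoffWeight]
  split_ifs with h
  · rw [cutoff_of_le hβ0 h, zero_mul, cutPower, if_pos hτ]; simp
  · have hz : 0 < r - θ := by rw [not_le] at h; linarith
    have hc1 := cutoff_le_one (θ := θ) (r := r) hσ hβ0
    have hc0 := cutoff_nonneg (β := β) (θ := θ) (r := r) hσ
    rw [cutPower]
    split_ifs with h'
    · exact zero_le
    · rw [not_le] at h'
      have ha1 : cutoff β σ θ r * a ≤ a := mul_le_of_le_one_left ha hc1
      rw [cutPower, if_neg (not_le.2 (h'.trans_le ha1)), ← ENNReal.ofReal_mul (by positivity)]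
      refine ENNReal.ofReal_le_ofReal ?_
      rw [Real.mul_rpow hc0 ha]
      gcongr
      rw [cutoff, max_eq_left hz.le, ← Real.rpow_mul (by positivity),
        show β * s = -(-(β * s)) by ring]
      exact div_rpow_neg_le hz hσ hb hb0 hb1

/-- The constant summand of the weight contributes at most the length `1 / 2` of the interval of
levels. The singular one contributes a multiple of `σ ^ b`; the assumption `r ≤ 1` enters through `r
^ (-b) ≤ r⁻¹`. -/
theorem lintegral_cutoffWeight_le (hσ : 0 < σ) (hb1 : b < 1) (hr : r ≤ 1) :
    ∫⁻ θ in Set.Ioo (0 : ℝ) (1 / 2), cutoffWeight b σ θ r ≤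
      ENNReal.ofReal (1 / 2 + σ ^ b / (1 - b)) := by
  have hb' : 0 < 1 - b := by linarith
  rcases le_or_gt r 0 with h | hr0
  · refine le_trans (le_of_eq ((setLIntegral_congr_fun measurableSet_Ioo fun t ht => ?_).trans
      lintegral_zero)) zero_le
    simp only [cutoffWeight, if_pos (h.trans ht.1.le)]
  calc ∫⁻ θ in Set.Ioo (0 : ℝ) (1 / 2), cutoffWeight b σ θ r
      ≤ ∫⁻ θ in Set.Ioo (0 : ℝ) (1 / 2), (1 + (Set.Ioo 0 r).indicator
          (fun t => ENNReal.ofReal (σ ^ b) * ENNReal.ofReal (r⁻¹ * (1 - t / r) ^ (-b))) θ) := by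
        refine setLIntegral_mono' measurableSet_Ioo fun t ht => ?_
        rw [cutoffWeight]
        split_ifs with h
        · exact zero_le
        · rw [not_le] at h
          rw [Set.indicator_of_mem (show t ∈ Set.Ioo 0 r from ⟨ht.1, h⟩),
            ENNReal.ofReal_add zero_le_one (by have := sub_pos.2 h; positivity), ENNReal.ofReal_one,
            ← ENNReal.ofReal_mul (by positivity)]
          refine add_le_add le_rfl (ENNReal.ofReal_le_ofReal ?_)
          have hx : 0 < 1 - t / r := by rw [sub_pos, div_lt_one hr0]; exact h
          have e1 : σ / (r - t) = σ * (r⁻¹ * (1 - t / r)⁻¹) := by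
            have : r - t ≠ 0 := by linarith
            have h2 : 1 - t / r ≠ 0 := hx.ne'
            rw [← mul_inv, mul_sub, mul_one, mul_div_cancel₀ _ hr0.ne']
            rfl
          rw [e1, Real.mul_rpow hσ.le (by positivity), Real.mul_rpow (by positivity) (by positivity),
            Real.inv_rpow hx.le, ← Real.rpow_neg hx.le]
          gcongr
          rw [Real.inv_rpow hr0.le, inv_le_inv₀ (by positivity) hr0]
          calc r = r ^ (1 : ℝ) := (Real.rpow_one r).symm
            _ ≤ r ^ b := Real.rpow_le_rpow_of_exponent_ge hr0 hr hb1.le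
    _ ≤ ENNReal.ofReal (1 / 2) + ENNReal.ofReal (σ ^ b) * ENNReal.ofReal (1 / (1 - b)) := by
        rw [lintegral_add_left measurable_const]
        refine add_le_add ?_ ((setLIntegral_le_lintegral _ _).trans ?_)
        · rw [setLIntegral_const, Real.volume_Ioo, one_mul, sub_zero]
        · rw [lintegral_indicator measurableSet_Ioo, lintegral_const_mul' _ _ ENNReal.ofReal_ne_top,
            lintegral_one_sub_rpow hr0 hb1]
    _ = _ := by
        rw [← ENNReal.ofReal_mul (by positivity), ← ENNReal.ofReal_add (by positivity)
          (by positivity), mul_one_div]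

end cutoff

theorem enorm_add_sq_le_weighted {E : Type*} [NormedAddCommGroup E] {κ : ℝ} (hκ : 0 < κ) (x y : E) :
    ‖x + y‖ₑ ^ 2 ≤ ENNReal.ofReal (1 + κ) * ‖x‖ₑ ^ 2 + ENNReal.ofReal (1 + κ⁻¹) * ‖y‖ₑ ^ 2 := by
  simp only [← ofReal_norm]
  rw [← ENNReal.ofReal_pow (norm_nonneg _), ← ENNReal.ofReal_pow (norm_nonneg _),
    ← ENNReal.ofReal_pow (norm_nonneg _), ← ENNReal.ofReal_mul (by positivity),
    ← ENNReal.ofReal_mul (by positivity), ← ENNReal.ofReal_add (by positivity) (by positivity)]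
  refine ENNReal.ofReal_le_ofReal ?_
  have h1 : ‖x + y‖ ^ 2 ≤ (‖x‖ + ‖y‖) ^ 2 := by gcongr; exact norm_add_le _ _
  have h2 : 0 ≤ κ⁻¹ * (κ * ‖x‖ - ‖y‖) ^ 2 := by positivity
  have h3 : κ⁻¹ * (κ * ‖x‖ - ‖y‖) ^ 2 = κ * ‖x‖ ^ 2 - 2 * ‖x‖ * ‖y‖ + κ⁻¹ * ‖y‖ ^ 2 := by
    field_simp
    ring
  nlinarith

theorem measurable_cutoffWeight (b σ : ℝ) {χ : Space N → ℝ} (hχ : Measurable χ) :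
    Measurable fun p : ℝ × Space N => cutoffWeight b σ p.1 (χ p.2) := by
  unfold cutoffWeight
  have hχ2 : Measurable fun p : ℝ × Space N => χ p.2 := hχ.comp measurable_snd
  refine Measurable.ite (measurableSet_le hχ2 measurable_fst) measurable_const ?_
  exact (measurable_const.add ((measurable_const.div
    (hχ2.sub measurable_fst)).pow_const _)).ennreal_ofReal

/-- Localization: `u` can be cut off at the cost of a factor close to one and of a term controlled
by the gradient of the cutoff. -/
theorem exists_localization {s κ : ℝ} (hs : -2 < s) (hκ : 0 < κ) :
    ∃ D : ℝ, 0 ≤ D ∧ ∀ {N : ℕ} {u : Space N → ℝ} {g : Space N → Space N}, IsW11loc u g →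
      Measurable u → Measurable g → (∀ x, 0 ≤ u x) → ∀ {χ : Space N → ℝ}, ContDiff ℝ 1 χ →
      (∀ x, χ x ≤ 1) → ∀ {c : ℝ}, (∀ x, ‖gradient χ x‖ ≤ c) →
      ∀ {A : Set (Space N)}, MeasurableSet A → (∀ x ∉ A, χ x ≤ 0) → ∀ {τ : ℝ}, 0 ≤ τ →
      ∫⁻ x in A, (cutPower s τ (u x) + ‖g x‖ₑ ^ 2) ≠ ⊤ → ∫⁻ x in A, ‖u x‖ₑ ^ 2 ≠ ⊤ →
      ∃ (w : Space N → ℝ) (k : Space N → Space N), IsW11loc w k ∧ Measurable w ∧ Measurable k ∧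
        (∀ x, 0 ≤ w x ∧ w x ≤ u x) ∧ (∀ x, χ x = 1 → (1 - κ) * u x ≤ w x) ∧
        (∀ x ∉ A, w x = 0 ∧ k x = 0) ∧
        ∫⁻ x, (cutPower s τ (w x) + ‖k x‖ₑ ^ 2) ≤
          ENNReal.ofReal (1 + κ) * (∫⁻ x in A, (cutPower s τ (u x) + ‖g x‖ₑ ^ 2)) +
          ENNReal.ofReal (D * c ^ 2) * ∫⁻ x in A, ‖u x‖ₑ ^ 2 := by
  -- The same exponent as for truncations: with `β = q⁻¹` the two conditions read `2 - 2 β < 1` and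
  -- `-(β s) < 1`.
  obtain ⟨q, hq1, hq2, hqs⟩ : ∃ q : ℝ, 1 < q ∧ q < 2 ∧ -s < q := by
    obtain ⟨q, h1, h2⟩ := exists_between (show max 1 (-s) < 2 from max_lt (by norm_num) (by linarith))
    exact ⟨q, (le_max_left _ _).trans_lt h1, h2, (le_max_right _ _).trans_lt h1⟩
  have hq0 : 0 < q := by linarith
  set β := q⁻¹ with hβ
  have hβ0 : 0 < β := inv_pos.2 hq0
  have hβ1 : β < 1 := inv_lt_one_of_one_lt₀ hq1
  have hβ2 : 1 / 2 < β := by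
    rw [hβ, one_div]
    exact (inv_lt_inv₀ (by norm_num) hq0).2 hq2
  set b := max (2 - 2 * β) (-(β * s)) with hb
  have hb1 : b < 1 := by
    refine max_lt (by linarith) ?_
    rw [hβ, ← mul_neg, inv_mul_eq_div, div_lt_one hq0]; exact hqs
  have hb0 : 0 < b := lt_max_of_lt_left (by linarith)
  have hb' : 0 < 1 - b := by linarith
  -- The levels form an interval of length `1 / 2`, so the integral bound `(1 + κ) / 2` means an
  -- average weight of at most `1 + κ`. The bound `2 σ ≤ κ` keeps the cutoff above `1 - κ` where `χ
  -- = 1`.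
  obtain ⟨σ, hσ, hσκ, hσb⟩ : ∃ σ : ℝ, 0 < σ ∧ 2 * σ ≤ κ ∧ 1 / 2 + σ ^ b / (1 - b) ≤ (1 + κ) / 2 := by
    have h1 : Tendsto (fun σ : ℝ => 1 / 2 + σ ^ b / (1 - b)) (𝓝[>] 0) (𝓝 (1 / 2)) := by
      have : Tendsto (fun σ : ℝ => 1 / 2 + σ ^ b / (1 - b)) (𝓝 0)
          (𝓝 (1 / 2 + (0 : ℝ) ^ b / (1 - b))) :=
        ((Real.continuousAt_rpow_const 0 b (Or.inr hb0.le)).tendsto.div_const _).const_add _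
      rw [Real.zero_rpow hb0.ne', zero_div, add_zero] at this
      exact this.mono_left nhdsWithin_le_nhds
    have h2 : ∀ᶠ σ : ℝ in 𝓝[>] 0, 2 * σ ≤ κ := by
      have : ∀ᶠ σ : ℝ in 𝓝 0, σ ≤ κ / 2 := eventually_le_nhds (by positivity)
      filter_upwards [nhdsWithin_le_nhds this] with σ hσ
      linarith
    obtain ⟨σ, h3, h5⟩ := (((h1.eventually_le_const
      (show (1 : ℝ) / 2 < (1 + κ) / 2 by linarith)).and h2).and self_mem_nhdsWithin).exists
    exact ⟨σ, h5, h3.2, h3.1⟩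
  set K := (1 + κ⁻¹) * σ⁻¹ ^ 2 with hK
  have hK0 : 0 ≤ K := by positivity
  refine ⟨(1 + κ) * K, by positivity, ?_⟩
  intro N u g h hum hgm h0 χ hχ hχ1 c hc A hA hAχ τ hτ hE hM
  have hc0 : 0 ≤ c := (norm_nonneg _).trans (hc 0)
  have hχm : Measurable χ := hχ.continuous.measurable
  have hgrm : Measurable (gradient χ) :=
    ((InnerProductSpace.toDual ℝ (Space N)).symm.continuous.comp
      (hχ.continuous_fderiv (by simp))).measurable
  have hwm := measurable_cutoffWeight b σ hχm
  have hcm : Measurable fun x => cutPower s τ (u x) := (measurable_cutPower s τ).comp hum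
  have hg2 : Measurable fun x => ‖g x‖ₑ ^ 2 := hgm.enorm.pow_const 2
  have hu2 : Measurable fun x => ‖u x‖ₑ ^ 2 := hum.enorm.pow_const 2
  -- The term with `K c ^ 2` accounts for `u ∇φ`, where `φ` is the cutoff. The other part `φ ∇u` of
  -- the gradient needs no weight, since `φ ≤ 1`.
  set p : Space N → ℝ≥0∞ := fun x => cutPower s τ (u x) + ENNReal.ofReal (K * c ^ 2) * ‖u x‖ₑ ^ 2
    with hp
  have hpm : Measurable p := hcm.add (hu2.const_mul _)
  set J : ℝ → ℝ≥0∞ := fun θ => ∫⁻ x in A, cutoffWeight b σ θ (χ x) * p x with hJ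
  have hJm : Measurable J := Measurable.lintegral_prod_right'
    (f := fun y : ℝ × Space N => cutoffWeight b σ y.1 (χ y.2) * p y.2)
    (hwm.mul (hpm.comp measurable_snd))
  have hJint : ∫⁻ θ in Set.Ioo (0 : ℝ) (1 / 2), J θ ≤
      ENNReal.ofReal ((1 + κ) / 2) * ∫⁻ x in A, p x := by
    simp only [hJ]
    rw [lintegral_lintegral_swap (hwm.mul (hpm.comp measurable_snd)).aemeasurable,
      ← lintegral_const_mul' _ _ ENNReal.ofReal_ne_top]
    refine lintegral_mono fun x => ?_
    have hmt : Measurable fun t : ℝ => cutoffWeight b σ t (χ x) :=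
      hwm.comp (measurable_id.prodMk measurable_const)
    rw [lintegral_mul_const _ hmt]
    gcongr
    exact (lintegral_cutoffWeight_le hσ hb1 (hχ1 x)).trans (ENNReal.ofReal_le_ofReal hσb)
  have hvol : volume (Set.Ioo (0 : ℝ) (1 / 2)) = ENNReal.ofReal (1 / 2) := by
    rw [Real.volume_Ioo, sub_zero]
  have h12 : ENNReal.ofReal (1 / 2) ≠ 0 := by
    rw [Ne, ENNReal.ofReal_eq_zero]; norm_num
  obtain ⟨θ, hθ, hJθ⟩ := exists_le_setLAverage (μ := volume) (s := Set.Ioo (0 : ℝ) (1 / 2))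
    (by rw [hvol]; exact h12) (by rw [hvol]; exact ENNReal.ofReal_ne_top) hJm.aemeasurable
  have hJle : J θ ≤ ENNReal.ofReal (1 + κ) * ∫⁻ x in A, p x := by
    refine hJθ.trans ?_
    rw [setLAverage_eq, hvol, ENNReal.div_le_iff h12 ENNReal.ofReal_ne_top]
    refine hJint.trans (le_of_eq ?_)
    rw [mul_right_comm, ← ENNReal.ofReal_mul (by positivity)]
    congr 2; ring
  have hpint : ∫⁻ x in A, p x = (∫⁻ x in A, cutPower s τ (u x)) +
      ENNReal.ofReal (K * c ^ 2) * ∫⁻ x in A, ‖u x‖ₑ ^ 2 := by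
    rw [← lintegral_const_mul _ hu2, ← lintegral_add_left hcm]
  have hEeq : ∫⁻ x in A, (cutPower s τ (u x) + ‖g x‖ₑ ^ 2) =
      (∫⁻ x in A, cutPower s τ (u x)) + ∫⁻ x in A, ‖g x‖ₑ ^ 2 := lintegral_add_left hcm _
  set φ : Space N → ℝ := fun x => cutoff β σ θ (χ x) with hφ
  have hφ0 : ∀ x, 0 ≤ φ x := fun x => cutoff_nonneg hσ
  have hφ1 : ∀ x, φ x ≤ 1 := fun x => cutoff_le_one hσ hβ0
  have hprim := isSingularPrimitive_cutoff (θ := θ) hσ hβ0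
  have hφm : Measurable φ := hprim.continuous.measurable.comp hχm
  have hdm : Measurable (cutoffDeriv β σ θ) := by
    unfold cutoffDeriv
    exact Measurable.ite measurableSet_Iic measurable_const (by fun_prop)
  have hk2m : Measurable fun x => (u x * cutoffDeriv β σ θ (χ x)) • gradient χ x :=
    (hum.mul (hdm.comp hχm)).smul hgrm
  have hk1m : Measurable fun x => φ x • g x := hφm.smul hgm
  set k : Space N → Space N := fun x => φ x • g x +
    (u x * cutoffDeriv β σ θ (χ x)) • gradient χ x with hkdef
  have hsq2 : ∀ x, ‖(u x * cutoffDeriv β σ θ (χ x)) • gradient χ x‖ₑ ^ 2 ≤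
      cutoffWeight b σ θ (χ x) * (ENNReal.ofReal (σ⁻¹ ^ 2 * c ^ 2) * ‖u x‖ₑ ^ 2) := fun x => by
    have hgx : ‖gradient χ x‖ₑ ^ 2 ≤ ENNReal.ofReal (c ^ 2) := by
      rw [← ofReal_norm, ← ENNReal.ofReal_pow (norm_nonneg _)]
      exact ENNReal.ofReal_le_ofReal (pow_le_pow_left₀ (norm_nonneg _) (hc x) 2)
    rw [enorm_smul, enorm_mul, mul_pow, mul_pow, ENNReal.ofReal_mul (by positivity)]
    calc ‖u x‖ₑ ^ 2 * ‖cutoffDeriv β σ θ (χ x)‖ₑ ^ 2 * ‖gradient χ x‖ₑ ^ 2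
        ≤ ‖u x‖ₑ ^ 2 * (ENNReal.ofReal (σ⁻¹ ^ 2) * cutoffWeight b σ θ (χ x)) *
          ENNReal.ofReal (c ^ 2) := by
          gcongr
          exact cutoffDeriv_sq_le hσ hβ0 hβ1.le (le_max_left _ _) hb1.le
      _ = _ := by ring
  have hz : ∀ x ∉ A, φ x = 0 ∧ cutoffDeriv β σ θ (χ x) = 0 := fun x hx => by
    have hle : χ x ≤ θ := (hAχ x hx).trans hθ.1.le
    exact ⟨cutoff_of_le hβ0 hle, by rw [cutoffDeriv, if_pos hle]⟩
  have hptw : ∀ x, cutPower s τ (φ x * u x) + ‖k x‖ₑ ^ 2 ≤ A.indicator (fun x =>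
      cutoffWeight b σ θ (χ x) * p x + ENNReal.ofReal (1 + κ) * ‖g x‖ₑ ^ 2) x := fun x => by
    by_cases hx : x ∈ A
    · rw [Set.indicator_of_mem hx]
      have h1 : cutPower s τ (φ x * u x) ≤ cutoffWeight b σ θ (χ x) * cutPower s τ (u x) :=
        cutPower_cutoff_le hσ hβ0 (le_max_right _ _) hb0.le hb1.le hτ (h0 x)
      have h2 : ‖φ x • g x‖ₑ ^ 2 ≤ ‖g x‖ₑ ^ 2 := by
        gcongr
        rw [enorm_smul]
        refine mul_le_of_le_one_left zero_le ?_
        rw [Real.enorm_eq_ofReal (hφ0 x), ENNReal.ofReal_le_one]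
        exact hφ1 x
      calc cutPower s τ (φ x * u x) + ‖k x‖ₑ ^ 2
          ≤ cutoffWeight b σ θ (χ x) * cutPower s τ (u x) +
            (ENNReal.ofReal (1 + κ) * ‖g x‖ₑ ^ 2 + ENNReal.ofReal (1 + κ⁻¹) *
            (cutoffWeight b σ θ (χ x) * (ENNReal.ofReal (σ⁻¹ ^ 2 * c ^ 2) * ‖u x‖ₑ ^ 2))) := by
            refine add_le_add h1 ((enorm_add_sq_le_weighted hκ _ _).trans ?_)
            gcongr
            exact hsq2 x
        _ = _ := by
            simp only [hp, hK]
            rw [show (1 + κ⁻¹) * σ⁻¹ ^ 2 * c ^ 2 = (1 + κ⁻¹) * (σ⁻¹ ^ 2 * c ^ 2) by ring,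
              ENNReal.ofReal_mul (p := 1 + κ⁻¹) (by positivity)]
            ring
    · rw [Set.indicator_of_notMem hx, hkdef]
      simp only [(hz x hx).1, (hz x hx).2]
      rw [zero_mul, cutPower, if_pos hτ]
      simp
  have hwt : Measurable fun x => cutoffWeight b σ θ (χ x) * p x :=
    (hwm.comp (measurable_const.prodMk measurable_id)).mul hpm
  have htot : ∫⁻ x, (cutPower s τ (φ x * u x) + ‖k x‖ₑ ^ 2) ≤
      J θ + ENNReal.ofReal (1 + κ) * ∫⁻ x in A, ‖g x‖ₑ ^ 2 := by
    refine (lintegral_mono hptw).trans (le_of_eq ?_)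
    rw [lintegral_indicator hA, lintegral_add_left hwt, lintegral_const_mul _ hg2]
  have hfin2 : ∫⁻ x, ‖(u x * cutoffDeriv β σ θ (χ x)) • gradient χ x‖ₑ ^ 2 ≠ ⊤ := by
    have h1 : ∫⁻ x, ‖(u x * cutoffDeriv β σ θ (χ x)) • gradient χ x‖ₑ ^ 2 ≤
        ENNReal.ofReal (1 + κ) * ∫⁻ x in A, p x := by
      refine le_trans ?_ hJle
      simp only [hJ]
      rw [← lintegral_indicator hA]
      refine lintegral_mono fun x => ?_
      by_cases hx : x ∈ A
      · rw [Set.indicator_of_mem hx]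
        refine (hsq2 x).trans ?_
        gcongr
        refine le_trans ?_ le_add_self
        gcongr
        have : σ⁻¹ ^ 2 ≤ K := by
          rw [hK]
          refine le_mul_of_one_le_left (by positivity) ?_
          have : 0 < κ⁻¹ := inv_pos.2 hκ
          linarith
        exact this
      · rw [Set.indicator_of_notMem hx, (hz x hx).2]; simp
    refine ne_top_of_le_ne_top (ENNReal.mul_ne_top ENNReal.ofReal_ne_top ?_) h1
    rw [hpint]
    rw [hEeq] at hE
    exact ENNReal.add_ne_top.2 ⟨(ENNReal.add_ne_top.1 hE).1,
      ENNReal.mul_ne_top ENNReal.ofReal_ne_top hM⟩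
  refine ⟨fun x => φ x * u x, k, ?_, hφm.mul hum, hk1m.add hk2m,
    fun x => ⟨mul_nonneg (hφ0 x) (h0 x), mul_le_of_le_one_left (h0 x) (hφ1 x)⟩, fun x hx => ?_,
    fun x hx => ?_, ?_⟩
  · refine h.mul_singularPrimitive hgm hprim hχ ?_ ?_
      (locallyIntegrable_of_lintegral_sq hk2m.aestronglyMeasurable hfin2)
    · refine h.locallyIntegrable.mono (hφm.mul hum).aestronglyMeasurable
        (Eventually.of_forall fun x => ?_)
      rw [norm_mul, Real.norm_of_nonneg (hφ0 x)]
      exact mul_le_of_le_one_left (norm_nonneg _) (hφ1 x)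
    · refine h.locallyIntegrable_grad.mono hk1m.aestronglyMeasurable
        (Eventually.of_forall fun x => ?_)
      rw [norm_smul, Real.norm_of_nonneg (hφ0 x)]
      exact mul_le_of_le_one_left (norm_nonneg _) (hφ1 x)
  · refine mul_le_mul_of_nonneg_right ?_ (h0 x)
    have hz2 : 1 / 2 < 1 - θ := by linarith [hθ.2]
    simp only [hφ, hx]
    rw [cutoff, max_eq_left (by linarith)]
    have hzpos : 0 < 1 - θ := by linarith
    have e1 : (1 - θ) / (1 - θ + σ) ≤ 1 := by rw [div_le_one (by positivity)]; linarith
    calc 1 - κ ≤ 1 - 2 * σ := by linarith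
      _ ≤ (1 - θ) / (1 - θ + σ) := by
        rw [le_div_iff₀ (by positivity)]
        nlinarith
      _ = ((1 - θ) / (1 - θ + σ)) ^ (1 : ℝ) := (Real.rpow_one _).symm
      _ ≤ _ := Real.rpow_le_rpow_of_exponent_ge (by positivity) e1 hβ1.le
  · simp [hkdef, (hz x hx).1, (hz x hx).2]
  · refine htot.trans ?_
    calc J θ + ENNReal.ofReal (1 + κ) * ∫⁻ x in A, ‖g x‖ₑ ^ 2
        ≤ ENNReal.ofReal (1 + κ) * (∫⁻ x in A, p x) +
          ENNReal.ofReal (1 + κ) * ∫⁻ x in A, ‖g x‖ₑ ^ 2 := by gcongr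
      _ = _ := by
        rw [hpint, hEeq, mul_assoc (1 + κ), ENNReal.ofReal_mul (p := 1 + κ) (by positivity)]
        ring

/-! ### A capacity estimate and infinite cost for `s ≤ -2` -/

/-- The logarithm `log (r / a)` truncated to nonnegative values. -/
def logAbove (a r : ℝ) : ℝ := Real.log (max r a) - Real.log a

/-- The derivative of `logAbove a`. -/
def logAboveDeriv (a r : ℝ) : ℝ := if r ≤ a then 0 else r⁻¹

theorem isSingularPrimitive_logAbove {a : ℝ} (ha : 0 < a) :
    IsSingularPrimitive a (logAbove a) (logAboveDeriv a) where
  eq_zero r hr := by rw [logAbove, max_eq_right hr, sub_self]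
  deriv_eq_zero r hr := by rw [logAboveDeriv, if_pos hr]
  deriv_nonneg r := by
    rw [logAboveDeriv]
    split_ifs with h
    · exact le_rfl
    · exact inv_nonneg.2 (ha.le.trans (not_le.1 h).le)
  continuousOn_deriv := by
    have : ContinuousOn (fun r : ℝ => r⁻¹) (Set.Ioi a) :=
      continuousOn_inv₀.mono fun r hr => (ha.trans hr).ne'
    refine this.congr fun r hr => ?_
    rw [logAboveDeriv, if_neg (not_le.2 hr)]
  continuous := by
    unfold logAbove
    exact (Continuous.log (by fun_prop) fun r => (lt_max_of_lt_right ha).ne').sub continuous_const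
  hasDerivAt r hr := by
    have heq : (fun r : ℝ => Real.log r - Real.log a) =ᶠ[𝓝 r] logAbove a := by
      filter_upwards [Ioi_mem_nhds hr] with v hv
      rw [logAbove, max_eq_left (le_of_lt hv)]
    rw [logAboveDeriv, if_neg (not_le.2 hr)]
    exact ((Real.hasDerivAt_log (ha.trans hr).ne').sub_const _).congr_of_eventuallyEq heq.symm

theorem IsW11loc.logAbove (h : IsW11loc u g) (hum : Measurable u) (hgm : Measurable g)
    {a : ℝ} (ha : 0 < a) :
    IsW11loc (fun x => logAbove a (u x)) (fun x => logAboveDeriv a (u x) • g x) := by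
  have hT := isSingularPrimitive_logAbove ha
  have hθm : Measurable (logAboveDeriv a) := by
    unfold logAboveDeriv
    exact Measurable.ite measurableSet_Iic measurable_const measurable_inv
  refine h.comp_singularPrimitive hgm hT ?_ ?_
  · refine (h.locallyIntegrable.smul a⁻¹).mono (hT.continuous.measurable.comp hum).aestronglyMeasurable
      (Eventually.of_forall fun x => ?_)
    rcases le_or_gt (u x) a with hx | hx
    · simp only [hT.eq_zero _ hx, norm_zero]; exact norm_nonneg _
    · have hx0 : 0 < u x := ha.trans hx
      have e1 : Droplets.logAbove a (u x) = Real.log (u x / a) := by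
        rw [Droplets.logAbove, max_eq_left hx.le, Real.log_div hx0.ne' ha.ne']
      have h1 : 0 ≤ Real.log (u x / a) := Real.log_nonneg (by rw [le_div_iff₀ ha]; linarith)
      have h2 := Real.log_le_sub_one_of_pos (div_pos hx0 ha)
      simp only [e1, Pi.smul_apply, smul_eq_mul]
      rw [Real.norm_of_nonneg h1, Real.norm_of_nonneg (by positivity), inv_mul_eq_div]
      linarith
  · refine (h.locallyIntegrable_grad.smul a⁻¹).mono ((hθm.comp hum).smul hgm).aestronglyMeasurable
      (Eventually.of_forall fun x => ?_)
    simp only [Pi.smul_apply, norm_smul]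
    gcongr
    rw [Real.norm_of_nonneg (hT.deriv_nonneg _), Real.norm_of_nonneg (by positivity), logAboveDeriv]
    split_ifs with hx
    · positivity
    · exact inv_anti₀ ha (not_le.1 hx).le

/-- A capacity estimate: on a set of small measure, reaching the height `a` from the height `τ`
costs at least `log (a / τ)`. -/
theorem IsW11loc.volume_mul_log_le (h : IsW11loc u g) (hum : Measurable u) (hgm : Measurable g)
    {s τ a R : ℝ} (hs : s ≤ -2) (hτ : 0 < τ) (hτa : τ < a) (ha : a ≤ 1)
    (hR : 0 < R) {A A' : Set (Space N)} (hA : MeasurableSet A) (hA' : MeasurableSet A')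
    (hAA' : ∀ x ∈ A, ∀ e : Space N, ‖e‖ ≤ R → x + e ∈ A')
    (hvol : 2 * volume (A' ∩ {x | τ < u x}) ≤ volume (Metric.closedBall (0 : Space N) R)) :
    volume (A ∩ {x | a ≤ u x}) * ENNReal.ofReal (Real.log (a / τ)) ≤
      2 * ENNReal.ofReal R * ∫⁻ x in A', (cutPower s τ (u x) + ‖g x‖ₑ ^ 2) := by
  have ha0 : 0 < a := hτ.trans hτa
  -- The function `w` is `log (u / τ)` clamped between `0` and `log (a / τ)`. For `u ≤ 1` and `s ≤
  -- -2` one has `|∇u| / u ≤ u ^ (-2) + |∇u|² ≤ u ^ s + |∇u|²`, so the energy bounds the integral of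
  -- `|∇w|`.
  have hw := (h.logAbove hum hgm hτ).add ((h.logAbove hum hgm ha0).const_mul (-1))
  set B := Metric.closedBall (0 : Space N) R with hB
  set w : Space N → ℝ := fun x => Droplets.logAbove τ (u x) + -1 * Droplets.logAbove a (u x) with hwdef
  set k : Space N → Space N := fun x => logAboveDeriv τ (u x) • g x +
    (-1 : ℝ) • logAboveDeriv a (u x) • g x with hkdef
  have hθm : ∀ a, Measurable (logAboveDeriv a) := fun a => by
    unfold logAboveDeriv
    exact Measurable.ite measurableSet_Iic measurable_const measurable_inv
  have hwm : Measurable w :=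
    ((isSingularPrimitive_logAbove hτ).continuous.measurable.comp hum).add
      (((isSingularPrimitive_logAbove ha0).continuous.measurable.comp hum).const_mul _)
  have hkm : Measurable k := (((hθm τ).comp hum).smul hgm).add
    (((((hθm a).comp hum).smul hgm)).const_smul (-1 : ℝ))
  have hklez : ∀ x, ‖k x‖ₑ ≤ cutPower s τ (u x) + ‖g x‖ₑ ^ 2 := fun x => by
    simp only [hkdef]
    rcases le_or_gt (u x) τ with hx | hx
    · simp [logAboveDeriv, hx, hx.trans hτa.le]
    rcases le_or_gt (u x) a with hx' | hx'
    · have hx0 : 0 < u x := hτ.trans hx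
      simp only [logAboveDeriv, if_pos hx', if_neg (not_le.2 hx), zero_smul, smul_zero, add_zero]
      rw [cutPower, if_neg (not_le.2 hx), ← ofReal_norm, ← ofReal_norm,
        ← ENNReal.ofReal_pow (norm_nonneg _), ← ENNReal.ofReal_add (by positivity) (by positivity)]
      refine ENNReal.ofReal_le_ofReal ?_
      rw [norm_smul, Real.norm_of_nonneg (by positivity)]
      have h1 : (u x)⁻¹ ^ 2 ≤ u x ^ s := by
        calc (u x)⁻¹ ^ 2 = u x ^ (-2 : ℝ) := by
              rw [Real.rpow_neg hx0.le, inv_pow]; norm_cast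
          _ ≤ u x ^ s := Real.rpow_le_rpow_of_exponent_ge hx0 (hx'.trans ha) hs
      nlinarith [sq_nonneg ((u x)⁻¹ - ‖g x‖), sq_nonneg (u x)⁻¹, sq_nonneg ‖g x‖]
    · have : k x = 0 := by
        simp only [hkdef, logAboveDeriv, if_neg (not_le.2 hx'), if_neg (not_le.2 hx)]
        rw [neg_one_smul, add_neg_cancel]
      simp only [hkdef] at this
      rw [this]; simp
  have hw0 : ∀ x, u x ≤ τ → w x = 0 := fun x hx => by
    simp only [hwdef, (isSingularPrimitive_logAbove hτ).eq_zero _ hx,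
      (isSingularPrimitive_logAbove ha0).eq_zero _ (hx.trans hτa.le)]
    norm_num
  have hw1 : ∀ x, a ≤ u x → w x = Real.log (a / τ) := fun x hx => by
    simp only [hwdef, Droplets.logAbove, max_eq_left hx, max_eq_left (hτa.le.trans hx)]
    rw [Real.log_div ha0.ne' hτ.ne']; ring
  have hlog : 0 ≤ Real.log (a / τ) := Real.log_nonneg (by rw [le_div_iff₀ hτ]; linarith)
  have hBt : volume B ≠ ⊤ := measure_closedBall_lt_top.ne
  have hB0 : volume B ≠ 0 := (Metric.measure_closedBall_pos volume _ hR).ne'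
  have hup : ∫⁻ x in A, ∫⁻ e in B, ‖w (x + e) - w x‖ₑ ≤
      volume B * (ENNReal.ofReal R * ∫⁻ x in A', ‖k x‖ₑ) := by
    rw [lintegral_lintegral_swap]
    · calc ∫⁻ e in B, ∫⁻ x in A, ‖w (x + e) - w x‖ₑ
          ≤ ∫⁻ _e in B, ENNReal.ofReal R * ∫⁻ x in A', ‖k x‖ₑ := by
            refine setLIntegral_mono' Metric.isClosed_closedBall.measurableSet fun e he => ?_
            rw [hB, mem_closedBall_zero_iff] at he
            refine (hw.lintegral_translate_sub_le hkm hA hA' e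
              (segment_mem_of_closedBall hAA' he)).trans ?_
            gcongr
            rw [← ofReal_norm]
            exact ENNReal.ofReal_le_ofReal he
        _ = _ := by rw [setLIntegral_const, mul_comm]
    · exact ((hwm.comp (measurable_fst.add measurable_snd)).sub
        (hwm.comp measurable_fst)).enorm.aemeasurable
  have hS : MeasurableSet {x | a ≤ u x} := measurableSet_le measurable_const hum
  -- Since `{τ < u}` fills at most half of the volume of `B`, at least half of the translates `x +
  -- e` lie where `w = 0`, while `w x = log (a / τ)`.
  have hlow : volume (A ∩ {x | a ≤ u x}) * (ENNReal.ofReal (Real.log (a / τ)) * (volume B / 2)) ≤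
      ∫⁻ x in A, ∫⁻ e in B, ‖w (x + e) - w x‖ₑ := by
    calc volume (A ∩ {x | a ≤ u x}) * (ENNReal.ofReal (Real.log (a / τ)) * (volume B / 2))
        = ∫⁻ _x in A ∩ {x | a ≤ u x}, ENNReal.ofReal (Real.log (a / τ)) * (volume B / 2) := by
          rw [setLIntegral_const, mul_comm]
      _ ≤ ∫⁻ x in A ∩ {x | a ≤ u x}, ∫⁻ e in B, ‖w (x + e) - w x‖ₑ := by
          refine setLIntegral_mono' (hA.inter hS) fun x hx => ?_
          set G := {e : Space N | u (x + e) ≤ τ} with hG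
          have hGm : MeasurableSet G :=
            measurableSet_le (hum.comp (measurable_const.add measurable_id)) measurable_const
          have hBG : volume B / 2 ≤ volume (B ∩ G) := by
            have h1 : volume (B \ G) ≤ volume B / 2 := by
              rw [ENNReal.le_div_iff_mul_le (Or.inl (by simp)) (Or.inl (by simp)), mul_comm]
              refine le_trans ?_ hvol
              gcongr 2 * ?_
              calc volume (B \ G) ≤ volume ((fun e => x + e) ⁻¹' (A' ∩ {x | τ < u x})) := by
                    refine measure_mono fun e he => ⟨hAA' x hx.1 e ?_, (not_le.1 he.2 : τ < u (x + e))⟩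
                    have := he.1
                    rwa [hB, mem_closedBall_zero_iff] at this
                _ = _ := measure_preimage_add _ _ _
            have h2 : volume (B ∩ G) + volume (B \ G) = volume B := measure_inter_add_sdiff _ hGm
            have h3 : volume B / 2 + volume B / 2 ≤ volume (B ∩ G) + volume B / 2 := by
              rw [ENNReal.add_halves, ← h2]
              gcongr
              rw [h2]; exact h1
            exact (ENNReal.add_le_add_iff_right (ENNReal.div_ne_top hBt (by simp))).1 h3
          calc ENNReal.ofReal (Real.log (a / τ)) * (volume B / 2)
              ≤ ENNReal.ofReal (Real.log (a / τ)) * volume (B ∩ G) := by gcongr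
            _ = ∫⁻ e in B ∩ G, ‖w (x + e) - w x‖ₑ := by
                rw [← setLIntegral_const]
                refine setLIntegral_congr_fun (Metric.isClosed_closedBall.measurableSet.inter hGm)
                  fun e he => ?_
                simp only [hw0 _ he.2, hw1 x hx.2]
                rw [zero_sub, enorm_neg, Real.enorm_eq_ofReal hlog]
            _ ≤ _ := lintegral_mono_set Set.inter_subset_left
      _ ≤ _ := lintegral_mono_set Set.inter_subset_left
  have hfin : volume B * (volume (A ∩ {x | a ≤ u x}) * ENNReal.ofReal (Real.log (a / τ))) ≤
      volume B * (2 * ENNReal.ofReal R * ∫⁻ x in A', (cutPower s τ (u x) + ‖g x‖ₑ ^ 2)) := by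
    calc volume B * (volume (A ∩ {x | a ≤ u x}) * ENNReal.ofReal (Real.log (a / τ)))
        = 2 * (volume (A ∩ {x | a ≤ u x}) *
          (ENNReal.ofReal (Real.log (a / τ)) * (volume B / 2))) := by
          rw [show (2 : ℝ≥0∞) * (volume (A ∩ {x | a ≤ u x}) *
            (ENNReal.ofReal (Real.log (a / τ)) * (volume B / 2))) =
            volume (A ∩ {x | a ≤ u x}) * ENNReal.ofReal (Real.log (a / τ)) * (2 * (volume B / 2)) by
              ring, ENNReal.mul_div_cancel (by simp) (by simp), mul_comm]
      _ ≤ 2 * (volume B * (ENNReal.ofReal R * ∫⁻ x in A', ‖k x‖ₑ)) := by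
          gcongr 2 * ?_
          exact hlow.trans hup
      _ ≤ 2 * (volume B * (ENNReal.ofReal R *
          ∫⁻ x in A', (cutPower s τ (u x) + ‖g x‖ₑ ^ 2))) := by
          gcongr 2 * (_ * (_ * ?_))
          exact lintegral_mono hklez
      _ = _ := by ring
  exact (ENNReal.mul_le_mul_iff_right hB0 hBt).1 hfin

theorem cutPower_anti (s : ℝ) {τ τ' : ℝ} (h : τ ≤ τ') (a : ℝ) :
    cutPower s τ' a ≤ cutPower s τ a := by
  rw [cutPower, cutPower]
  split_ifs with h1 h2 h3
  · exact le_rfl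
  · exact zero_le
  · exact absurd (h3.trans h) h1
  · exact le_rfl

theorem one_le_cutPower {s τ a : ℝ} (hs : s ≤ 0) (hτ : 0 ≤ τ) (h1 : τ < a) (h2 : a ≤ 1) :
    1 ≤ cutPower s τ a := by
  rw [cutPower, if_neg (not_le.2 h1), ENNReal.one_le_ofReal]
  exact Real.one_le_rpow_of_pos_of_le_one_of_nonpos (hτ.trans_lt h1) h2 hs

/-- Heights in `(τ, 1]` have potential at least one because `s ≤ 0`; larger heights are counted by
the mass. -/
theorem indicator_lt_le_cutPower {s τ : ℝ} (hs : s ≤ 0) (hτ : 0 ≤ τ) (a : ℝ) :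
    (Set.Ioi τ).indicator 1 a ≤ cutPower s τ a + ‖a‖ₑ := by
  by_cases h : τ < a
  · rw [Set.indicator_of_mem (show a ∈ Set.Ioi τ from h), Pi.one_apply]
    rcases le_total a 1 with h1 | h1
    · exact le_add_right (one_le_cutPower hs hτ h h1)
    · refine le_add_left ?_
      rwa [Real.enorm_eq_ofReal (by linarith), ENNReal.one_le_ofReal]
  · rw [Set.indicator_of_notMem (show a ∉ Set.Ioi τ from h)]
    exact zero_le

theorem volume_lt_le {s τ : ℝ} (hs : s ≤ 0) (hτ : 0 ≤ τ) (hum : Measurable u)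
    {A : Set (Space N)} :
    volume (A ∩ {x | τ < u x}) ≤ (∫⁻ x in A, cutPower s τ (u x)) + ∫⁻ x in A, ‖u x‖ₑ := by
  have hS : MeasurableSet {x | τ < u x} := measurableSet_lt measurable_const hum
  calc volume (A ∩ {x | τ < u x}) = ∫⁻ x in A, {x | τ < u x}.indicator 1 x := by
        rw [lintegral_indicator_one hS, Measure.restrict_apply hS, Set.inter_comm]
    _ ≤ ∫⁻ x in A, (cutPower s τ (u x) + ‖u x‖ₑ) :=
        lintegral_mono fun x => indicator_lt_le_cutPower hs hτ (u x)
    _ = _ := lintegral_add_right _ hum.enorm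

theorem eq_zero_of_forall_mul_ofReal_le {X M : ℝ≥0∞} (hM : M ≠ ⊤)
    (h : ∀ L : ℝ, 0 < L → X * ENNReal.ofReal L ≤ M) : X = 0 := by
  by_contra hX
  have h1 : Tendsto (fun L : ℝ => X * ENNReal.ofReal L) atTop (𝓝 (X * ⊤)) :=
    ENNReal.Tendsto.const_mul ENNReal.tendsto_ofReal_atTop (Or.inl ENNReal.top_ne_zero)
  rw [ENNReal.mul_top hX] at h1
  exact hM (top_le_iff.1 (le_of_tendsto h1 ((eventually_gt_atTop 0).mono h)))

/-- As `τ → 0` in the capacity estimate the energy stays bounded while the logarithm grows. Every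
set `{a ≤ u}` with `0 < a ≤ 1` is therefore negligible for a competitor of finite energy, which
contradicts its unit mass. -/
theorem powerCost_one_eq_top (hN : 1 ≤ N) {s : ℝ} (hs : s ≤ -2) : powerCost N s 1 = ⊤ := by
  by_contra hne
  obtain ⟨u, g, h, hum, hgm, h0, hi, h1, hE⟩ :=
    exists_of_powerCost_lt (lt_top_iff_ne_top.2 hne)
  set E := ∫⁻ x, (cutPower s 0 (u x) + ‖g x‖ₑ ^ 2) with hEdef
  have hmass : ∫⁻ x, ‖u x‖ₑ = 1 := by rw [lintegral_enorm_of_nonneg hi h0, h1, ENNReal.ofReal_one]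
  -- The sets `{τ < u}` have volume at most `E + 1`, so one radius serves all levels `τ`.
  obtain ⟨R, hR, hvol⟩ := exists_le_volume_closedBall (N := N) hN (K := 2 * (E + 1)) (by finiteness)
  have hτE : ∀ τ, 0 < τ → ∫⁻ x, (cutPower s τ (u x) + ‖g x‖ₑ ^ 2) ≤ E := fun τ hτ =>
    lintegral_mono fun x => add_le_add (cutPower_anti s hτ.le _) le_rfl
  have hzero : ∀ a : ℝ, 0 < a → a ≤ 1 → volume {x | a ≤ u x} = 0 := fun a ha ha1 => by
    refine eq_zero_of_forall_mul_ofReal_le (M := 2 * ENNReal.ofReal R * E) (by finiteness)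
      fun L hL => ?_
    have hexp : Real.exp (-L) < 1 := by rw [Real.exp_lt_one_iff]; linarith
    have hτ : 0 < a * Real.exp (-L) := by positivity
    have hlog : Real.log (a / (a * Real.exp (-L))) = L := by
      rw [div_mul_cancel_left₀ ha.ne', ← Real.exp_neg, neg_neg, Real.log_exp]
    have key := h.volume_mul_log_le hum hgm hs hτ (mul_lt_of_lt_one_right ha hexp) ha1 hR
      MeasurableSet.univ MeasurableSet.univ (fun _ _ _ _ => Set.mem_univ _) (by
        refine le_trans ?_ hvol
        gcongr
        refine (volume_lt_le (s := s) (by linarith) hτ.le hum).trans ?_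
        rw [Measure.restrict_univ, hmass]
        gcongr
        exact (lintegral_mono fun x => le_self_add).trans (hτE _ hτ))
    rw [hlog, Measure.restrict_univ, Set.univ_inter] at key
    refine key.trans ?_
    gcongr
    exact hτE _ hτ
  have : ∫⁻ x, ‖u x‖ₑ = 0 := by
    rw [lintegral_eq_zero_iff hum.enorm]
    have : ∀ᵐ x, ∀ n : ℕ, ¬ ((1 : ℝ) / (n + 1) ≤ u x) := by
      rw [ae_all_iff]
      intro n
      have := hzero (1 / (n + 1)) (by positivity) (by
        rw [div_le_one (by positivity)]; linarith [n.cast_nonneg (α := ℝ)])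
      rw [ae_iff]
      simpa using this
    filter_upwards [this] with x hx
    rw [Pi.zero_apply, enorm_eq_zero]
    refine le_antisymm (le_of_forall_pos_le_add fun ε hε => ?_) (h0 x)
    obtain ⟨n, hn⟩ := exists_nat_one_div_lt hε
    linarith [not_le.1 (hx n)]
  rw [hmass] at this
  exact one_ne_zero this

/-! ### Blow-up of the droplet functional and bounds on the potential -/

/-- The integrand of the droplet functional. -/
def dropletDensity (N : ℕ) (W : ℝ≥0 → ℝ≥0) (s ε r : ℝ) (ξ : Space N) : ℝ≥0∞ :=
  ENNReal.ofReal (ε ^ (-dropletExponent N s)) *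
    ((W r.toNNReal : ℝ≥0∞) + ENNReal.ofReal (ε * ‖ξ‖ ^ 2))

/-- The length scale of the droplets. -/
def dropletScale (N : ℕ) (s ε : ℝ) : ℝ := ε ^ ((N + 2 + N * (1 - s))⁻¹ : ℝ)

theorem dropletScale_pos {s ε : ℝ} (hε : 0 < ε) : 0 < dropletScale N s ε := Real.rpow_pos_of_pos hε _

theorem dropletScale_denom_pos {s : ℝ} (hs : s < 1) : 0 < (N + 2 + N * (1 - s) : ℝ) := by
  have : 0 < 1 - s := by linarith
  positivity

theorem tendsto_dropletScale {s : ℝ} (hs : s < 1) :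
    Tendsto (dropletScale N s) (𝓝[>] 0) (𝓝[>] 0) := by
  have hp := inv_pos.2 (dropletScale_denom_pos (N := N) hs)
  refine tendsto_nhdsWithin_iff.2 ⟨?_, ?_⟩
  · have := (Real.continuousAt_rpow_const 0 _ (Or.inr hp.le)).tendsto
    rw [Real.zero_rpow hp.ne'] at this
    exact this.mono_left nhdsWithin_le_nhds
  · filter_upwards [self_mem_nhdsWithin] with ε hε using dropletScale_pos hε

theorem rpow_dropletExponent {s ε : ℝ} (hε : 0 < ε) :
    ε ^ dropletExponent N s = (dropletScale N s ε ^ N) ^ (1 - s) := by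
  have hδ := dropletScale_pos (N := N) (s := s) hε
  rw [← Real.rpow_natCast, ← Real.rpow_mul hδ.le, dropletScale, ← Real.rpow_mul hε.le,
    dropletExponent]
  congr 1
  field_simp

theorem dropletScale_energy {s ε : ℝ} (hs : s < 1) (hε : 0 < ε) :
    ε ^ (-dropletExponent N s) * ε = dropletScale N s ε ^ (N + 2) := by
  have hd := dropletScale_denom_pos (N := N) hs
  rw [← Real.rpow_add_one hε.ne', dropletScale, ← Real.rpow_natCast, ← Real.rpow_mul hε.le,
    dropletExponent]
  congr 1
  push_cast
  field_simp
  ring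

/-- With `δ` the droplet scale, `ε ^ ρ = δ ^ (N (1 - s))` and `ε ^ (1 - ρ) = δ ^ (N + 2)`. For `u =
δ ^ (-N) v (· / δ)` both terms are then of order one in terms of `v`. -/
theorem ofReal_mul_dropletDensity (W : ℝ≥0 → ℝ≥0) {s ε : ℝ} (hs : s < 1) (hε : 0 < ε) (r : ℝ)
    (ξ : Space N) :
    ENNReal.ofReal (dropletScale N s ε ^ N) * dropletDensity N W s ε r ξ =
      ENNReal.ofReal ((dropletScale N s ε ^ N) ^ s) * (W r.toNNReal : ℝ≥0∞) +
        ‖(dropletScale N s ε ^ N * dropletScale N s ε) • ξ‖ₑ ^ 2 := by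
  have hδ := dropletScale_pos (N := N) (s := s) hε
  set δ := dropletScale N s ε with hδdef
  rw [dropletDensity, mul_add, mul_add]
  congr 1
  · rw [← mul_assoc, ← ENNReal.ofReal_mul (by positivity)]
    congr 2
    rw [Real.rpow_neg hε.le, rpow_dropletExponent hε, ← hδdef, ← Real.rpow_neg (by positivity),
      mul_comm, ← Real.rpow_add_one (by positivity)]
    congr 1; ring
  · rw [← ENNReal.ofReal_mul (by positivity), ← ENNReal.ofReal_mul (by positivity), ← ofReal_norm,
      ← ENNReal.ofReal_pow (norm_nonneg _), norm_smul, Real.norm_of_nonneg (by positivity),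
      ← mul_assoc (ε ^ _), dropletScale_energy hs hε]
    congr 1; ring

/-- Near zero the linear bound comes from the lower limit of `W u / u`, on a compact interval of
positive heights from a positive minimum given by lower semicontinuity. Above `K` the equivalence at
infinity applies. -/
theorem exists_lower_bounds {W : ℝ≥0 → ℝ≥0} {s κ : ℝ} (hκ : 0 < κ) (hlsc : LowerSemicontinuous W)
    (hzero : ∀ u : ℝ≥0, W u = 0 ↔ u = 0)
    (hequiv : Asymptotics.IsEquivalent atTop (fun u : ℝ≥0 => (W u : ℝ)) (fun u : ℝ≥0 => (u : ℝ) ^ s))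
    (hlim : 0 < liminf (fun u : ℝ≥0 => (W u : ℝ≥0∞) / (u : ℝ≥0∞)) (𝓝[>] 0)) :
    ∃ K c : ℝ, 0 < K ∧ 0 < c ∧ (∀ r : ℝ, 0 ≤ r → r ≤ K → c * r ≤ W r.toNNReal) ∧
      ∀ r : ℝ, K < r → (1 - κ) * r ^ s ≤ W r.toNNReal := by
  obtain ⟨K₁, hK₁⟩ := eventually_atTop.1 (hequiv.isLittleO.def hκ)
  obtain ⟨c₁, hc₁, hc₁'⟩ := ENNReal.lt_iff_exists_nnreal_btwn.1 hlim
  have hev := eventually_lt_of_lt_liminf hc₁'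
  obtain ⟨u₀, hu₀, hsub⟩ := mem_nhdsGT_iff_exists_Ioo_subset.1 hev
  set K : ℝ≥0 := max K₁ (max 1 u₀) with hK
  have hKu : u₀ ≤ K := (le_max_right _ _).trans (le_max_right _ _)
  obtain ⟨z, hz, hmin⟩ := LowerSemicontinuousOn.exists_isMinOn (f := W)
    (Set.nonempty_Icc.2 hKu) isCompact_Icc (hlsc.lowerSemicontinuousOn _)
  have hu₀' : 0 < u₀ := hu₀
  have hz0 : 0 < W z := by
    rw [pos_iff_ne_zero, Ne, hzero]
    exact (hu₀'.trans_le hz.1).ne'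
  have hK0 : 0 < K := hu₀'.trans_le hKu
  have hc₁0 : 0 < c₁ := by exact_mod_cast hc₁
  refine ⟨K, min c₁ (W z / K), by exact_mod_cast hK0, lt_min (by exact_mod_cast hc₁0)
    (div_pos (by exact_mod_cast hz0) (by exact_mod_cast hK0)), fun r hr hrK => ?_, fun r hr => ?_⟩
  · lift r to ℝ≥0 using hr
    rw [Real.toNNReal_coe]
    have hrK' : r ≤ K := by exact_mod_cast hrK
    rcases eq_or_ne r 0 with rfl | hr0
    · simp
    rcases lt_or_ge r u₀ with h | h
    · have h1 : (c₁ : ℝ≥0∞) < W r / r := hsub ⟨pos_iff_ne_zero.2 hr0, h⟩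
      rw [ENNReal.lt_div_iff_mul_lt (Or.inl (by exact_mod_cast hr0)) (Or.inl (by simp))] at h1
      have h2 : (c₁ : ℝ) * r ≤ W r := by exact_mod_cast h1.le
      exact (mul_le_mul_of_nonneg_right (min_le_left _ _) r.coe_nonneg).trans h2
    · have h1 : (W z : ℝ) ≤ W r := by exact_mod_cast hmin (show r ∈ Set.Icc u₀ K from ⟨h, hrK'⟩)
      have hK0' : (0 : ℝ) < K := by exact_mod_cast hK0
      calc min (c₁ : ℝ) (W z / K) * r ≤ W z / K * K :=
            mul_le_mul (min_le_right _ _) hrK r.coe_nonneg (by positivity)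
        _ = W z := by field_simp
        _ ≤ _ := h1
  · have hr0 : 0 ≤ r := le_trans (by positivity) hr.le
    lift r to ℝ≥0 using hr0
    rw [Real.toNNReal_coe]
    have h1 := hK₁ r ((le_max_left _ _).trans (by exact_mod_cast hr.le))
    simp only [Pi.sub_apply] at h1
    rw [Real.norm_of_nonneg (Real.rpow_nonneg r.coe_nonneg s)] at h1
    have := neg_le_of_abs_le h1
    linarith

section lower

variable {W : ℝ≥0 → ℝ≥0} {s κ K c : ℝ}

/-- The asymptotics of `W` are available only above `K`, that is above `K δ ^ N` after the blow-up.
Below this height the potential is dropped, which is the purpose of the threshold in `cutPower`. -/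
theorem cutPower_add_sq_le_dropletDensity (hs : s < 1) (hκ0 : 0 ≤ κ) (hκ : κ < 1) (hK0 : 0 ≤ K)
    (hK : ∀ r : ℝ, K < r → (1 - κ) * r ^ s ≤ W r.toNNReal) {ε : ℝ} (hε : 0 < ε) {r : ℝ}
    (ξ : Space N) :
    ENNReal.ofReal (1 - κ) * (cutPower s (K * dropletScale N s ε ^ N) (dropletScale N s ε ^ N * r) +
      ‖(dropletScale N s ε ^ N * dropletScale N s ε) • ξ‖ₑ ^ 2) ≤
      ENNReal.ofReal (dropletScale N s ε ^ N) * dropletDensity N W s ε r ξ := by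
  have hδ := dropletScale_pos (N := N) (s := s) hε
  rw [ofReal_mul_dropletDensity W hs hε]
  set δ := dropletScale N s ε with hδdef
  have hδN : 0 < δ ^ N := by positivity
  rw [mul_add]
  refine add_le_add ?_ (mul_le_of_le_one_left zero_le
    (by rw [ENNReal.ofReal_le_one]; linarith))
  rw [cutPower]
  split_ifs with h
  · simp
  · have hr : K < r := by
      rw [not_le, mul_comm] at h
      exact lt_of_mul_lt_mul_left h hδN.le
    rw [← ENNReal.ofReal_mul (by linarith), ← ENNReal.ofReal_coe_nnreal,
      ← ENNReal.ofReal_mul (by positivity)]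
    refine ENNReal.ofReal_le_ofReal ?_
    rw [Real.mul_rpow hδN.le (hK0.trans hr.le)]
    have := mul_le_mul_of_nonneg_left (hK r hr) (Real.rpow_nonneg hδN.le s)
    linarith

/-- Low heights are expensive per unit of mass. Up to `K` one has `r ≤ W r / c`; beyond, `r = r ^ (1
- s) r ^ s` and `r ^ (1 - s) ≤ (θ / δ ^ N) ^ (1 - s)`. Since `s < 1`, the coefficient is small with
`ε` and `θ`. -/
theorem ofReal_le_dropletDensity (hs : s < 1) (hκ : κ < 1) (hc : 0 < c) (hK0 : 0 ≤ K)
    (hcK : ∀ r : ℝ, 0 ≤ r → r ≤ K → c * r ≤ W r.toNNReal)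
    (hK : ∀ r : ℝ, K < r → (1 - κ) * r ^ s ≤ W r.toNNReal) {ε : ℝ} (hε : 0 < ε) {θ : ℝ}
    (hθ : 0 ≤ θ) {r : ℝ} (hr : 0 ≤ r) (hrθ : dropletScale N s ε ^ N * r ≤ θ) (ξ : Space N) :
    ENNReal.ofReal r ≤ ENNReal.ofReal (ε ^ dropletExponent N s / c + θ ^ (1 - s) / (1 - κ)) *
      dropletDensity N W s ε r ξ := by
  have hκ' : 0 < 1 - κ := by linarith
  have hδ := dropletScale_pos (N := N) (s := s) hε
  set δ := dropletScale N s ε with hδdef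
  have hδN : 0 < δ ^ N := by positivity
  have hp : 0 < ε ^ dropletExponent N s := by positivity
  refine le_trans ?_ (mul_le_mul_right (mul_le_mul_right le_self_add _) _)
  rw [← ENNReal.ofReal_coe_nnreal, ← ENNReal.ofReal_mul (by positivity),
    ← ENNReal.ofReal_mul (by positivity)]
  refine ENNReal.ofReal_le_ofReal ?_
  rw [Real.rpow_neg hε.le, ← mul_assoc, add_mul]
  have hW0 : (0 : ℝ) ≤ W r.toNNReal := (W r.toNNReal).coe_nonneg
  rcases le_or_gt r K with h | h
  · have h1 := hcK r hr h
    calc r ≤ W r.toNNReal / c := by rw [le_div_iff₀ hc]; linarith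
      _ = ε ^ dropletExponent N s / c * (ε ^ dropletExponent N s)⁻¹ * W r.toNNReal := by field_simp
      _ ≤ _ := by
        gcongr
        have : 0 ≤ θ ^ (1 - s) / (1 - κ) * (ε ^ dropletExponent N s)⁻¹ := by positivity
        linarith
  · have hr0 : 0 < r := hK0.trans_lt h
    have h1 := hK r h
    have h2 : r ^ (1 - s) ≤ θ ^ (1 - s) * (ε ^ dropletExponent N s)⁻¹ := by
      rw [rpow_dropletExponent hε, ← hδdef, ← div_eq_mul_inv, ← Real.div_rpow hθ hδN.le]
      refine Real.rpow_le_rpow hr ?_ (by linarith)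
      rw [le_div_iff₀ hδN]; linarith
    have h3 : r = r ^ (1 - s) * r ^ s := by
      rw [← Real.rpow_add hr0]; simp
    calc r = r ^ (1 - s) * r ^ s := h3
      _ ≤ (θ ^ (1 - s) * (ε ^ dropletExponent N s)⁻¹) * (W r.toNNReal / (1 - κ)) := by
        gcongr
        rw [le_div_iff₀ hκ']; linarith
      _ = θ ^ (1 - s) / (1 - κ) * (ε ^ dropletExponent N s)⁻¹ * W r.toNNReal := by ring
      _ ≤ _ := by
        gcongr
        have : 0 ≤ ε ^ dropletExponent N s / c * (ε ^ dropletExponent N s)⁻¹ := by positivity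
        linarith

end lower

/-- From a function with finite local energy one obtains a competitor of the minimal cost which
carries almost all of its mass. -/
theorem exists_competitor {s κ : ℝ} (hs : -2 < s) (hκ : 0 < κ) :
    ∃ C D : ℝ, 0 ≤ C ∧ 0 ≤ D ∧ ∀ {N : ℕ} {u : Space N → ℝ} {g : Space N → Space N}, IsW11loc u g →
      Measurable u → Measurable g → (∀ x, 0 ≤ u x) → ∀ {χ : Space N → ℝ}, ContDiff ℝ 1 χ →
      (∀ x, χ x ≤ 1) → ∀ {c : ℝ}, (∀ x, ‖gradient χ x‖ ≤ c) →
      ∀ {A A' : Set (Space N)}, MeasurableSet A → MeasurableSet A' → (∀ x ∉ A, χ x ≤ 0) →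
      (∀ x ∈ A, ∀ e : Space N, ‖e‖ ≤ 1 → x + e ∈ A') → ∀ {τ : ℝ}, 0 < τ → τ < 1 →
      ∫⁻ x in A', (cutPower s τ (u x) + ‖g x‖ₑ ^ 2) ≠ ⊤ → ∫⁻ x in A', ‖u x‖ₑ ≠ ⊤ →
      ∃ (w : Space N → ℝ) (k : Space N → Space N), IsW11loc w k ∧ (∀ x, 0 ≤ w x) ∧
        Integrable w volume ∧ (∀ x, χ x = 1 → √τ ≤ κ * u x → (1 - 2 * κ) * u x ≤ w x) ∧
        ∫⁻ x, (cutPower s 0 (w x) + ‖k x‖ₑ ^ 2) ≤ ENNReal.ofReal (1 + C / Real.log (√τ / τ)) *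
          (ENNReal.ofReal (1 + κ) * (∫⁻ x in A', (cutPower s τ (u x) + ‖g x‖ₑ ^ 2)) +
          ENNReal.ofReal (D * c ^ 2) * (2 * (∫⁻ x in A', (cutPower s τ (u x) + ‖g x‖ₑ ^ 2)) +
          2 * (volume (Metric.closedBall (0 : Space N) 1))⁻¹ * (∫⁻ x in A', ‖u x‖ₑ) ^ 2)) := by
  obtain ⟨C, hC, htr⟩ := exists_truncation hs
  obtain ⟨D, hD, hloc⟩ := exists_localization hs hκ
  refine ⟨C, D, hC, hD, ?_⟩
  intro N u g h hum hgm h0 χ hχ hχ1 c hc A A' hA hA' hχA hAA' τ hτ0 hτ1 hE hM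
  set E := ∫⁻ x in A', (cutPower s τ (u x) + ‖g x‖ₑ ^ 2) with hEdef
  set M := ∫⁻ x in A', ‖u x‖ₑ with hMdef
  set B := volume (Metric.closedBall (0 : Space N) 1) with hB
  have hB0 : B ≠ 0 := (Metric.measure_closedBall_pos volume _ one_pos).ne'
  have hsub : A ⊆ A' := fun x hx => by simpa using hAA' x hx 0 (by simp)
  have hEA : ∫⁻ x in A, (cutPower s τ (u x) + ‖g x‖ₑ ^ 2) ≤ E := lintegral_mono_set hsub
  -- The cutoff error involves `∫ u²`, which the local Nash inequality bounds by the energy and the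
  -- mass on `A'`.
  have hN2 : ∫⁻ x in A, ‖u x‖ₑ ^ 2 ≤ 2 * E + 2 * B⁻¹ * M ^ 2 := by
    refine (h.nash hum hgm hA hA' one_pos hAA').trans ?_
    rw [one_pow, ENNReal.ofReal_one, mul_one]
    gcongr
    exact lintegral_mono fun x => le_add_self
  have hN2t : 2 * E + 2 * B⁻¹ * M ^ 2 ≠ ⊤ := by
    have : B⁻¹ ≠ ⊤ := ENNReal.inv_ne_top.2 hB0
    finiteness
  obtain ⟨w, k, hw, hwm, hkm, hw0, hw1, hwA, hwE⟩ := hloc h hum hgm h0 hχ hχ1 hc hA hχA hτ0.le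
    (ne_top_of_le_ne_top hE hEA) (ne_top_of_le_ne_top hN2t hN2)
  have hwE' : ∫⁻ x, (cutPower s τ (w x) + ‖k x‖ₑ ^ 2) ≤ ENNReal.ofReal (1 + κ) * E +
      ENNReal.ofReal (D * c ^ 2) * (2 * E + 2 * B⁻¹ * M ^ 2) := hwE.trans (by gcongr)
  have hττ : τ < √τ := by
    rw [Real.lt_sqrt hτ0.le]; nlinarith
  -- Between `τ` and `√τ` the ratio of the two levels tends to infinity as `τ → 0`, so the factor
  -- tends to one, although the heights removed tend to zero.
  obtain ⟨w', k', hw', hwm', hkm', hww', hE'⟩ := htr hw hwm hkm (fun x => (hw0 x).1) τ (√τ) hτ0 hττ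
    (ne_top_of_le_ne_top (by finiteness) hwE')
  refine ⟨w', k', hw', fun x => (hww' x).1, ⟨hwm'.aestronglyMeasurable, ?_⟩, fun x hx hx' => ?_,
    hE'.trans (by gcongr)⟩
  · refine lt_of_le_of_lt ?_ (lt_top_iff_ne_top.2 hM)
    refine le_trans ?_ (lintegral_mono_set hsub)
    rw [← lintegral_indicator hA]
    refine lintegral_mono fun x => ?_
    by_cases hx : x ∈ A
    · rw [Set.indicator_of_mem hx, Real.enorm_eq_ofReal (hww' x).1, Real.enorm_eq_ofReal (h0 x)]
      exact ENNReal.ofReal_le_ofReal ((hww' x).2.1.trans (hw0 x).2)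
    · have : w' x = 0 := le_antisymm ((hww' x).2.1.trans (hwA x hx).1.le) (hww' x).1
      rw [this]; simp
  · have h1 := hw1 x hx
    have h2 := (hww' x).2.2
    linarith

theorem setLIntegral_affine {δ : ℝ} (hδ : 0 < δ) {S : Set (Space N)} (hS : MeasurableSet S)
    (f : Space N → ℝ≥0∞) :
    ∫⁻ y in {y : Space N | δ • (y - 0) ∈ S}, f (δ • (y - 0)) =
      ENNReal.ofReal ((δ ^ N)⁻¹) * ∫⁻ x in S, f x := by
  have hm : MeasurableSet {y : Space N | δ • (y - 0) ∈ S} :=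
    hS.preimage (by fun_prop : Measurable fun y : Space N => δ • (y - 0))
  rw [← lintegral_indicator hS, ← lintegral_affine hδ 0, ← lintegral_indicator hm]
  rfl

theorem lintegral_rescaled_mass {δ : ℝ} (hδ : 0 < δ) {S : Set (Space N)} (hS : MeasurableSet S) :
    ∫⁻ y in {y : Space N | δ • (y - 0) ∈ S}, ‖δ ^ N * u (δ • (y - 0))‖ₑ = ∫⁻ x in S, ‖u x‖ₑ := by
  simp only [enorm_mul]
  rw [lintegral_const_mul' _ _ enorm_ne_top, setLIntegral_affine hδ hS (fun x => ‖u x‖ₑ), ← mul_assoc,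
    Real.enorm_eq_ofReal (by positivity), ← ENNReal.ofReal_mul (by positivity),
    mul_inv_cancel₀ (by positivity), ENNReal.ofReal_one, one_mul]

theorem lintegral_rescaled_le {W : ℝ≥0 → ℝ≥0} {s κ K : ℝ} (hs : s < 1) (hκ0 : 0 ≤ κ) (hκ : κ < 1)
    (hK0 : 0 ≤ K) (hK : ∀ r : ℝ, K < r → (1 - κ) * r ^ s ≤ W r.toNNReal) {ε : ℝ} (hε : 0 < ε)
    {S : Set (Space N)} (hS : MeasurableSet S) :
    ENNReal.ofReal (1 - κ) * (∫⁻ y in {y : Space N | dropletScale N s ε • (y - 0) ∈ S},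
      (cutPower s (K * dropletScale N s ε ^ N)
        (dropletScale N s ε ^ N * u (dropletScale N s ε • (y - 0))) +
      ‖(dropletScale N s ε ^ N * dropletScale N s ε) • g (dropletScale N s ε • (y - 0))‖ₑ ^ 2)) ≤
      ∫⁻ x in S, dropletDensity N W s ε (u x) (g x) := by
  have hδ := dropletScale_pos (N := N) (s := s) hε
  rw [← lintegral_const_mul' _ _ ENNReal.ofReal_ne_top]
  refine (lintegral_mono fun y =>
    cutPower_add_sq_le_dropletDensity hs hκ0 hκ hK0 hK hε _).trans (le_of_eq ?_)
  rw [lintegral_const_mul' _ _ ENNReal.ofReal_ne_top,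
    setLIntegral_affine hδ hS (fun x => dropletDensity N W s ε (u x) (g x)), ← mul_assoc,
    ← ENNReal.ofReal_mul (by positivity), mul_inv_cancel₀ (by positivity), ENNReal.ofReal_one,
    one_mul]

theorem lintegral_enorm_small_le {W : ℝ≥0 → ℝ≥0} {s κ K c : ℝ} (hs : s < 1) (hκ : κ < 1)
    (hc : 0 < c) (hK0 : 0 ≤ K) (hcK : ∀ r : ℝ, 0 ≤ r → r ≤ K → c * r ≤ W r.toNNReal)
    (hK : ∀ r : ℝ, K < r → (1 - κ) * r ^ s ≤ W r.toNNReal) {ε : ℝ} (hε : 0 < ε) {θ : ℝ}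
    (hθ : 0 ≤ θ) (hum : Measurable u) (h0 : ∀ x, 0 ≤ u x) (S : Set (Space N)) :
    ∫⁻ x in S ∩ {x | dropletScale N s ε ^ N * u x ≤ θ}, ‖u x‖ₑ ≤
      ENNReal.ofReal (ε ^ dropletExponent N s / c + θ ^ (1 - s) / (1 - κ)) *
        ∫⁻ x in S, dropletDensity N W s ε (u x) (g x) := by
  have hT : MeasurableSet {x | dropletScale N s ε ^ N * u x ≤ θ} :=
    measurableSet_le (hum.const_mul _) measurable_const
  rw [← lintegral_const_mul' _ _ ENNReal.ofReal_ne_top, Set.inter_comm, ← Measure.restrict_restrict hT]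
  refine (setLIntegral_mono' hT fun x hx => ?_).trans (setLIntegral_le_lintegral _ _)
  rw [Real.enorm_eq_ofReal (h0 x)]
  exact ofReal_le_dropletDensity hs hκ hc hK0 hcK hK hε hθ (h0 x) hx _

/-! ### Weak convergence tested on compact sets; cutoff functions -/

theorem WeakConverges.tendsto_integral {μs : ℝ → FiniteMeasure (Space N)}
    {μ : FiniteMeasure (Space N)} (h : WeakConverges μs μ) {f : C(Space N, ℝ)}
    (hf : HasCompactSupport f) :
    Tendsto (fun ε => ∫ x, f x ∂(μs ε : Measure (Space N))) (𝓝[>] 0)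
      (𝓝 (∫ x, f x ∂(μ : Measure (Space N)))) :=
  h ⟨f, hf.is_zero_at_infty⟩

theorem measure_le_ofReal_integral (μ : Measure (Space N)) [IsFiniteMeasure μ] {f : C(Space N, ℝ)}
    (hf : HasCompactSupport f) (h0 : ∀ x, 0 ≤ f x) {S : Set (Space N)} (hS : ∀ x ∈ S, f x = 1) :
    μ S ≤ ENNReal.ofReal (∫ x, f x ∂μ) := by
  rw [ofReal_integral_eq_lintegral_ofReal (f.continuous.integrable_of_hasCompactSupport hf)
    (Eventually.of_forall h0)]
  have h1 : S ⊆ {x | 1 ≤ ENNReal.ofReal (f x)} := fun x hx => by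
    show 1 ≤ ENNReal.ofReal (f x)
    rw [hS x hx, ENNReal.ofReal_one]
  calc μ S ≤ 1 * μ {x | 1 ≤ ENNReal.ofReal (f x)} := by rw [one_mul]; exact measure_mono h1
    _ ≤ _ := mul_meas_ge_le_lintegral f.continuous.measurable.ennreal_ofReal 1

theorem ofReal_integral_le_measure (μ : Measure (Space N)) [IsFiniteMeasure μ] {f : C(Space N, ℝ)}
    (hf : HasCompactSupport f) (h0 : ∀ x, f x ∈ Set.Icc 0 1) {S : Set (Space N)}
    (hSm : MeasurableSet S) (hS : ∀ x ∉ S, f x = 0) :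
    ENNReal.ofReal (∫ x, f x ∂μ) ≤ μ S := by
  rw [ofReal_integral_eq_lintegral_ofReal (f.continuous.integrable_of_hasCompactSupport hf)
    (Eventually.of_forall fun x => (h0 x).1), ← lintegral_indicator_one hSm]
  refine lintegral_mono fun x => ?_
  by_cases hx : x ∈ S
  · rw [Set.indicator_of_mem hx, Pi.one_apply, ENNReal.ofReal_le_one]; exact (h0 x).2
  · rw [hS x hx]; simp

/-- A portmanteau inequality between a compact set and an open neighbourhood; it holds even if mass
escapes to infinity. -/
theorem WeakConverges.eventually_lt_measure {μs : ℝ → FiniteMeasure (Space N)}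
    {μ : FiniteMeasure (Space N)} (h : WeakConverges μs μ) {C U : Set (Space N)} (hC : IsCompact C)
    (hU : IsOpen U) (hCU : C ⊆ U) {b : ℝ≥0∞} (hb : b < (μ : Measure (Space N)) C) :
    ∀ᶠ ε in 𝓝[>] 0, b < (μs ε : Measure (Space N)) U := by
  obtain ⟨f, hf1, hf0, hfc, hf⟩ := exists_continuous_one_zero_of_isCompact hC hU.isClosed_compl
    (Set.disjoint_compl_right_iff_subset.2 hCU)
  have h1 := ENNReal.tendsto_ofReal (h.tendsto_integral hfc)
  filter_upwards [h1.eventually_const_lt (hb.trans_le (measure_le_ofReal_integral _ hfc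
    (fun x => (hf x).1) hf1))] with ε hε
  exact hε.trans_le (ofReal_integral_le_measure _ hfc hf hU.measurableSet hf0)

theorem WeakConverges.exists_eventually_measure_le {μs : ℝ → FiniteMeasure (Space N)}
    {μ : FiniteMeasure (Space N)} (h : WeakConverges μs μ) {C : Set (Space N)} (hC : IsCompact C) :
    ∃ M : ℝ≥0∞, M ≠ ⊤ ∧ ∀ᶠ ε in 𝓝[>] 0, (μs ε : Measure (Space N)) C ≤ M := by
  obtain ⟨f, hf1, -, hfc, hf⟩ := exists_continuous_one_zero_of_isCompact hC isClosed_empty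
    (Set.disjoint_empty C)
  refine ⟨ENNReal.ofReal (∫ x, f x ∂(μ : Measure (Space N)) + 1), ENNReal.ofReal_ne_top, ?_⟩
  filter_upwards [(h.tendsto_integral hfc).eventually_le_const (lt_add_one _)] with ε hε
  exact (measure_le_ofReal_integral _ hfc (fun x => (hf x).1) hf1).trans
    (ENNReal.ofReal_le_ofReal hε)

theorem exists_cutoff {C : Set (Space N)} (hC : IsCompact C) {r : ℝ} (hr : 0 < r) :
    ∃ (χ : Space N → ℝ) (L : ℝ≥0), ContDiff ℝ 1 χ ∧ (∀ x, χ x ≤ 1) ∧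
      (∀ x ∈ Metric.thickening r C, χ x = 1) ∧ (∀ x ∉ Metric.cthickening (2 * r) C, χ x ≤ 0) ∧
      LipschitzWith L χ := by
  have hd : Disjoint (Metric.thickening (2 * r) C)ᶜ (Metric.cthickening r C) :=
    Set.disjoint_compl_left_iff_subset.2
      (Metric.cthickening_subset_thickening' (by positivity) (by linarith) C)
  obtain ⟨f, hf0, hf1, hf⟩ := exists_contMDiffMap_zero_one_of_isClosed
    (modelWithCornersSelf ℝ (Space N)) (n := 1) Metric.isOpen_thickening.isClosed_compl
    Metric.isClosed_cthickening hd
  have hz : ∀ x ∉ Metric.cthickening (2 * r) C, f x = 0 := fun x hx =>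
    hf0 fun hx' => hx (Metric.thickening_subset_cthickening _ _ hx')
  have hfd : ContDiff ℝ 1 f := f.contMDiff.contDiff
  obtain ⟨L, hL⟩ := hfd.lipschitzWith_of_hasCompactSupport
    (HasCompactSupport.intro hC.cthickening hz) one_ne_zero
  exact ⟨f, L, hfd, fun x => (hf x).2,
    fun x hx => hf1 (Metric.thickening_subset_cthickening _ _ hx), fun x hx => (hz x hx).le, hL⟩

theorem norm_gradient_rescaled_le {χ : Space N → ℝ} {L : ℝ≥0} (hL : LipschitzWith L χ) {δ : ℝ}
    (hδ : 0 < δ) (y : Space N) : ‖gradient (fun y => χ (δ • (y - 0))) y‖ ≤ L * δ := by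
  rw [gradient, LinearIsometryEquiv.norm_map]
  have h1 : LipschitzWith (L * δ.toNNReal) (fun y : Space N => χ (δ • (y - 0))) := by
    refine LipschitzWith.of_dist_le_mul fun x y => (hL.dist_le_mul _ _).trans (le_of_eq ?_)
    rw [dist_smul₀, sub_zero, sub_zero, NNReal.coe_mul, Real.coe_toNNReal _ hδ.le,
      Real.norm_of_nonneg hδ.le, mul_assoc]
  have := norm_fderiv_le_of_lipschitz ℝ h1 (x₀ := y)
  rwa [NNReal.coe_mul, Real.coe_toNNReal _ hδ.le] at this

theorem add_mem_cthickening {C : Set (Space N)} {r r' : ℝ} (hr : 0 ≤ r) (hr' : 0 ≤ r')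
    {x e : Space N} (hx : x ∈ Metric.cthickening r C) (he : ‖e‖ ≤ r') :
    x + e ∈ Metric.cthickening (r' + r) C :=
  Metric.cthickening_cthickening_subset hr' hr C (Metric.closedBall_subset_cthickening hx r' (by
    rw [Metric.mem_closedBall, dist_eq_norm]; simpa using he))

/-! ### Local lower bounds -/

/-- The hypotheses on the potential of the droplet functional. -/
structure IsDropletPotential (W : ℝ≥0 → ℝ≥0) (s : ℝ) : Prop where
  lt_one : s < 1
  lowerSemicontinuous : LowerSemicontinuous W
  eq_zero_iff : ∀ u : ℝ≥0, W u = 0 ↔ u = 0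
  isEquivalent : Asymptotics.IsEquivalent atTop (fun u : ℝ≥0 => (W u : ℝ))
    (fun u : ℝ≥0 => (u : ℝ) ^ s)
  bddAbove : BddAbove ((fun u : ℝ≥0 => W u / u ^ s) '' Set.Ioi 0)
  liminf_pos : 0 < liminf (fun u : ℝ≥0 => (W u : ℝ≥0∞) / (u : ℝ≥0∞)) (𝓝[>] 0)

theorem withDensity_ofReal_apply (h0 : ∀ x, 0 ≤ u x) {S : Set (Space N)} (hS : MeasurableSet S) :
    volume.withDensity (fun x => ENNReal.ofReal (u x)) S = ∫⁻ x in S, ‖u x‖ₑ := by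
  rw [withDensity_apply _ hS]
  exact lintegral_congr fun x => (Real.enorm_eq_ofReal (h0 x)).symm

theorem dropletExponent_pos (hN : 1 ≤ N) {s : ℝ} (hs : s < 1) : 0 < dropletExponent N s := by
  have h1 : 0 < 1 - s := by linarith
  have h2 : (0 : ℝ) < N := by exact_mod_cast hN
  rw [dropletExponent]; positivity

theorem tendsto_rpow_nhdsGT_zero {p : ℝ} (hp : 0 < p) :
    Tendsto (fun t : ℝ => t ^ p) (𝓝[>] 0) (𝓝[>] 0) := by
  refine tendsto_nhdsWithin_iff.2 ⟨?_, ?_⟩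
  · have := (Real.continuousAt_rpow_const 0 _ (Or.inr hp.le)).tendsto
    rw [Real.zero_rpow hp.ne'] at this
    exact this.mono_left nhdsWithin_le_nhds
  · filter_upwards [self_mem_nhdsWithin] with ε hε using Real.rpow_pos_of_pos hε _

theorem tendsto_dropletScale_pow (hN : 1 ≤ N) {s : ℝ} (hs : s < 1) {K : ℝ} (hK : 0 < K) :
    Tendsto (fun ε => K * dropletScale N s ε ^ N) (𝓝[>] 0) (𝓝[>] 0) := by
  refine tendsto_nhdsWithin_iff.2 ⟨?_, ?_⟩
  · have := (((tendsto_dropletScale (N := N) hs).mono_right nhdsWithin_le_nhds).pow N).const_mul K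
    rwa [zero_pow (by omega), mul_zero] at this
  · filter_upwards [self_mem_nhdsWithin] with ε hε
    exact mul_pos hK (pow_pos (dropletScale_pos hε) N)

theorem tendsto_log_sqrt_div : Tendsto (fun τ : ℝ => Real.log (√τ / τ)) (𝓝[>] 0) atTop := by
  have h1 : Tendsto (fun τ : ℝ => (√τ)⁻¹) (𝓝[>] 0) atTop := by
    refine tendsto_inv_nhdsGT_zero.comp (tendsto_nhdsWithin_iff.2 ⟨?_, ?_⟩)
    · have := Real.continuous_sqrt.tendsto 0
      rw [Real.sqrt_zero] at this
      exact this.mono_left nhdsWithin_le_nhds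
    · filter_upwards [self_mem_nhdsWithin] with τ hτ using Real.sqrt_pos.2 hτ
  refine (Real.tendsto_log_atTop.comp h1).congr' ?_
  filter_upwards [self_mem_nhdsWithin] with τ hτ
  rw [Function.comp_apply, Real.sqrt_div_self]

/-- The mass at low height is controlled by the energy. -/
theorem mass_high_ge {W : ℝ≥0 → ℝ≥0} {s κ K c : ℝ} (hs : s < 1) (hκ : κ < 1)
    (hc : 0 < c) (hK0 : 0 ≤ K) (hcK : ∀ r : ℝ, 0 ≤ r → r ≤ K → c * r ≤ W r.toNNReal)
    (hK : ∀ r : ℝ, K < r → (1 - κ) * r ^ s ≤ W r.toNNReal) {ε : ℝ} (hε : 0 < ε) {θ : ℝ}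
    (hθ : 0 ≤ θ) (hum : Measurable u) (h0 : ∀ x, 0 ≤ u x) {S : Set (Space N)} {a b d : ℝ≥0∞}
    (hSb : b + d ≤ ∫⁻ x in S, ‖u x‖ₑ)
    (ha : ∫⁻ x in S, dropletDensity N W s ε (u x) (g x) ≤ a) (hd : d ≠ ⊤)
    (hda : ENNReal.ofReal (ε ^ dropletExponent N s / c + θ ^ (1 - s) / (1 - κ)) * a ≤ d) :
    b ≤ ∫⁻ x in S ∩ {x | θ < dropletScale N s ε ^ N * u x}, ‖u x‖ₑ := by
  have hT : MeasurableSet {x | θ < dropletScale N s ε ^ N * u x} :=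
    measurableSet_lt measurable_const (hum.const_mul _)
  have h1 := lintegral_inter_add_sdiff (μ := volume) (fun x => ‖u x‖ₑ) S hT
  have h2 : S \ {x | θ < dropletScale N s ε ^ N * u x} =
      S ∩ {x | dropletScale N s ε ^ N * u x ≤ θ} := by
    ext x; simp
  have h3 := (lintegral_enorm_small_le (g := g) hs hκ hc hK0 hcK hK hε hθ hum h0 S).trans
    ((mul_le_mul_right ha _).trans hda)
  rw [h2] at h1
  rw [← h1] at hSb
  exact (ENNReal.add_le_add_iff_right hd).1 (hSb.trans (add_le_add le_rfl h3))

theorem tendsto_lowMassCoeff (hN : 1 ≤ N) {s κ c θ₀ : ℝ} (hs : s < 1) {θ : ℝ → ℝ}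
    (hθ : Tendsto θ (𝓝[>] 0) (𝓝 θ₀)) {a : ℝ≥0∞} (ha : a ≠ ⊤) :
    Tendsto (fun ε : ℝ => ENNReal.ofReal (ε ^ dropletExponent N s / c + θ ε ^ (1 - s) / (1 - κ)) * a)
      (𝓝[>] 0) (𝓝 (ENNReal.ofReal (θ₀ ^ (1 - s) / (1 - κ)) * a)) := by
  refine ENNReal.Tendsto.mul_const (ENNReal.tendsto_ofReal ?_) (Or.inr ha)
  have h1 : Tendsto (fun ε : ℝ => ε ^ dropletExponent N s / c) (𝓝[>] 0) (𝓝 0) := by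
    have := ((tendsto_rpow_nhdsGT_zero (dropletExponent_pos hN hs)).mono_right
      nhdsWithin_le_nhds).div_const c
    rwa [zero_div] at this
  have h2 := (hθ.rpow_const (p := 1 - s) (Or.inr (by linarith))).div_const (1 - κ)
  simpa using h1.add h2

/-- The losses of the local lower bound, in mass and in energy, disappear as `κ → 0`, and the
inequality `a < H(m)` is strict. -/
theorem exists_good_factor (hN : 1 ≤ N) {s : ℝ} (hs1 : s ≤ 1) {m : ℝ} (hm : 0 < m) {a : ℝ≥0∞}
    (ha : a < powerCost N s m) (hP : powerCost N s 1 ≠ ⊤) :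
    ∃ κ : ℝ, 0 < κ ∧ κ < 1 / 4 ∧ ENNReal.ofReal ((1 + κ) / (1 - κ)) * a <
      powerCost N s 1 * ENNReal.ofReal (((1 - 2 * κ) * ((1 - κ) * m)) ^ costExponent N s) := by
  rw [powerCost_eq hN hs1 hm] at ha
  have hat : a ≠ ⊤ := (ha.trans_le le_top).ne
  have h1 : Tendsto (fun κ : ℝ => ENNReal.ofReal ((1 + κ) / (1 - κ)) * a) (𝓝[>] 0) (𝓝 a) := by
    have : Tendsto (fun κ : ℝ => (1 + κ) / (1 - κ)) (𝓝 0) (𝓝 ((1 + 0) / (1 - 0))) :=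
      (tendsto_id.const_add 1).div (tendsto_id.const_sub 1) (by norm_num)
    have := ENNReal.Tendsto.mul_const (ENNReal.tendsto_ofReal
      (this.mono_left (nhdsWithin_le_nhds (s := Set.Ioi 0)))) (Or.inr hat)
    simpa using this
  have h2 : Tendsto (fun κ : ℝ => powerCost N s 1 *
      ENNReal.ofReal (((1 - 2 * κ) * ((1 - κ) * m)) ^ costExponent N s)) (𝓝[>] 0)
      (𝓝 (powerCost N s 1 * ENNReal.ofReal (m ^ costExponent N s))) := by
    have hc : Continuous fun κ : ℝ => (1 - 2 * κ) * ((1 - κ) * m) := by fun_prop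
    have := hc.tendsto 0
    simp only [mul_zero, sub_zero, one_mul] at this
    exact ENNReal.Tendsto.const_mul (ENNReal.tendsto_ofReal
      ((this.mono_left nhdsWithin_le_nhds).rpow_const (Or.inl hm.ne'))) (Or.inr hP)
  have h3 : ∀ᶠ κ : ℝ in 𝓝[>] 0, κ < 1 / 4 :=
    nhdsWithin_le_nhds (eventually_lt_nhds (by norm_num))
  obtain ⟨κ, ⟨h4, h5⟩, h6⟩ := (((h1.eventually_lt h2 ha).and h3).and self_mem_nhdsWithin).exists
  exact ⟨κ, h6, h5, h4⟩

/-- Local lower bound for the droplet functional, for finite costs. -/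
theorem IsDropletPotential.eventually_lt_of_neg_two_lt {W : ℝ≥0 → ℝ≥0} {s : ℝ}
    (hW : IsDropletPotential W s) (hN : 1 ≤ N) (hs : -2 < s) {μs : ℝ → FiniteMeasure (Space N)}
    {μ : FiniteMeasure (Space N)} (h : WeakConverges μs μ) {C O : Set (Space N)} (hC : IsCompact C)
    (hO : IsOpen O) (hCO : C ⊆ O) {a : ℝ≥0∞}
    (ha : a < powerCost N s ((μ : Measure (Space N)).real C)) :
    ∀ᶠ ε in 𝓝[>] (0 : ℝ), ∀ (u : Space N → ℝ) (g : Space N → Space N), IsW11loc u g →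
      Measurable u → Measurable g → (∀ x, 0 ≤ u x) →
      (μs ε : Measure (Space N)) = volume.withDensity (fun x => ENNReal.ofReal (u x)) →
      a < ∫⁻ x in O, dropletDensity N W s ε (u x) (g x) := by
  have hs1 := hW.lt_one
  set m := (μ : Measure (Space N)).real C with hmdef
  have hm : 0 < m := by
    rcases (measureReal_nonneg (μ := (μ : Measure (Space N))) (s := C)).eq_or_lt with h0 | h0
    · rw [hmdef, ← h0, powerCost_zero] at ha
      exact absurd ha not_lt_zero
    · exact h0
  have hPt : powerCost N s 1 ≠ ⊤ := (powerCost_one_lt_top hN hs hs1.le).ne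
  obtain ⟨κ, hκ0, hκ4, hY⟩ := exists_good_factor hN hs1.le hm ha hPt
  have hat : a ≠ ⊤ := (ha.trans_le le_top).ne
  have hκ1 : κ < 1 := by linarith
  have h1κ : 0 < 1 - κ := by linarith
  have h2κ : 0 < 1 - 2 * κ := by linarith
  set Y := powerCost N s 1 * ENNReal.ofReal (((1 - 2 * κ) * ((1 - κ) * m)) ^ costExponent N s)
    with hYdef
  obtain ⟨K, c, hK0, hc, hcK, hK⟩ := exists_lower_bounds hκ0 hW.lowerSemicontinuous hW.eq_zero_iff
    hW.isEquivalent hW.liminf_pos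
  obtain ⟨r₀, hr₀, hr₀O⟩ := hC.exists_cthickening_subset_open hO hCO
  set r := r₀ / 3 with hr
  have hr0 : 0 < r := by positivity
  have hr₀' : r + 2 * r = r₀ := by rw [hr]; ring
  obtain ⟨χ, L, hχ, hχ1, hχone, hχzero, hL⟩ := exists_cutoff hC hr0
  obtain ⟨C₁, D, hC₁, hD, hcomp⟩ := exists_competitor hs hκ0
  obtain ⟨M, hMt, hM⟩ := h.exists_eventually_measure_le (hC.cthickening (r := r + 2 * r))
  have hμC : (μ : Measure (Space N)) C = ENNReal.ofReal m := by rw [hmdef, ofReal_measureReal]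
  have hmass := h.eventually_lt_measure hC (Metric.isOpen_thickening (δ := r) (E := C))
    (Metric.self_subset_thickening hr0 C) (b := ENNReal.ofReal ((1 - κ / 2) * m)) (by
      rw [hμC, ENNReal.ofReal_lt_ofReal_iff hm]
      exact mul_lt_of_lt_one_left hm (by linarith))
  set B := volume (Metric.closedBall (0 : Space N) 1) with hB
  have hB0 : B⁻¹ ≠ ⊤ := ENNReal.inv_ne_top.2 (Metric.measure_closedBall_pos volume _ one_pos).ne'
  set a' := ENNReal.ofReal (1 - κ)⁻¹ * a with ha'
  have ha't : a' ≠ ⊤ := by finiteness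
  set τ : ℝ → ℝ := fun ε => K * dropletScale N s ε ^ N with hτdef
  have hτlim : Tendsto τ (𝓝[>] 0) (𝓝[>] 0) := tendsto_dropletScale_pow hN hs1 hK0
  have hτlim0 : Tendsto τ (𝓝[>] 0) (𝓝 0) := hτlim.mono_right nhdsWithin_le_nhds
  have hδlim0 : Tendsto (dropletScale N s) (𝓝[>] 0) (𝓝 0) :=
    (tendsto_dropletScale hs1).mono_right nhdsWithin_le_nhds
  -- This is the energy bound of the competitor. The cutoff has gradient `O(δ)` in the blown-up
  -- variables, so its error vanishes, and the limit lies below `Y`, the cost of the mass that the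
  -- competitor will carry.
  have hZ : Tendsto (fun ε => ENNReal.ofReal (1 + C₁ / Real.log (√(τ ε) / τ ε)) *
      (ENNReal.ofReal (1 + κ) * a' + ENNReal.ofReal (D * (L * dropletScale N s ε) ^ 2) *
        (2 * a' + 2 * B⁻¹ * M ^ 2))) (𝓝[>] 0) (𝓝 (ENNReal.ofReal ((1 + κ) / (1 - κ)) * a)) := by
    have h1 : Tendsto (fun ε => 1 + C₁ / Real.log (√(τ ε) / τ ε)) (𝓝[>] 0) (𝓝 (1 + 0)) :=
      (tendsto_const_nhds.div_atTop (tendsto_log_sqrt_div.comp hτlim)).const_add 1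
    have h2 : Tendsto (fun ε => D * (L * dropletScale N s ε) ^ 2) (𝓝[>] 0) (𝓝 (D * (L * 0) ^ 2)) :=
      ((hδlim0.const_mul _).pow 2).const_mul D
    have hM2 : 2 * a' + 2 * B⁻¹ * M ^ 2 ≠ ⊤ := by finiteness
    have h3 := (ENNReal.Tendsto.mul_const (ENNReal.tendsto_ofReal h2) (Or.inr hM2)).const_add
      (ENNReal.ofReal (1 + κ) * a')
    have h4 := ENNReal.Tendsto.mul (ENNReal.tendsto_ofReal h1) (Or.inr (by finiteness)) h3
      (Or.inr ENNReal.ofReal_ne_top)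
    convert h4 using 2
    rw [mul_zero, zero_pow two_ne_zero, mul_zero, ENNReal.ofReal_zero, zero_mul, add_zero, add_zero,
      ENNReal.ofReal_one, one_mul, ha', ← mul_assoc, ← ENNReal.ofReal_mul (by positivity)]
    rfl
  -- Truncation at `√τ` removes at most the fraction `κ` of heights above `√τ / κ`. As this bound
  -- tends to zero, the heights below it carry little mass.
  have hθlim : Tendsto (fun ε => √(τ ε) / κ) (𝓝[>] 0) (𝓝 0) := by
    have := ((Real.continuous_sqrt.tendsto 0).comp hτlim0).div_const κ
    simpa using this
  have hlow := tendsto_lowMassCoeff hN (κ := κ) (c := c) hs1 hθlim hat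
  rw [Real.zero_rpow (by linarith), zero_div, ENNReal.ofReal_zero, zero_mul] at hlow
  filter_upwards [self_mem_nhdsWithin, hmass, hM, hZ.eventually_lt_const hY,
    hτlim0.eventually_lt_const one_pos, hδlim0.eventually_le_const hr0,
    hlow.eventually_le_const (show 0 < ENNReal.ofReal (κ / 2 * m) by
      rw [ENNReal.ofReal_pos]; positivity)] with ε hε hmε hMε hZε hτ1 hδr hlowε
  intro u g hug hum hgm h0 hμ
  have hδ := dropletScale_pos (N := N) (s := s) hε
  have hτ0 : 0 < τ ε := mul_pos hK0 (pow_pos hδ N)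
  rw [hμ, withDensity_ofReal_apply h0 Metric.isOpen_thickening.measurableSet] at hmε
  rw [hμ, withDensity_ofReal_apply h0 Metric.isClosed_cthickening.measurableSet] at hMε
  -- Otherwise the blow-up `v` has energy at most `a / (1 - κ)` near `C`, and the competitor built
  -- from it is too cheap for its mass.
  by_contra! hcon
  have hA1 : MeasurableSet (Metric.cthickening (r + 2 * r) C) :=
    Metric.isClosed_cthickening.measurableSet
  have hsm : Measurable fun y : Space N => dropletScale N s ε • (y - 0) := by fun_prop
  have hE : ENNReal.ofReal (1 - κ) * _ ≤ a :=
    (lintegral_rescaled_le (u := u) (g := g) hs1 hκ0.le hκ1 hK0.le hK hε hA1).trans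
      ((lintegral_mono_set (by rw [hr₀']; exact hr₀O)).trans hcon)
  have hmr := lintegral_rescaled_mass (u := u) hδ hA1
  set δ := dropletScale N s ε with hδdef
  set v : Space N → ℝ := fun y => δ ^ N * u (δ • (y - 0)) with hv
  set k : Space N → Space N := fun y => (δ ^ N * δ) • g (δ • (y - 0)) with hk
  have hvk : IsW11loc v k := hug.affine (δ ^ N) hδ 0
  have hvm : Measurable v := (hum.comp hsm).const_mul _
  have hkm : Measurable k := (hgm.comp hsm).const_smul (δ ^ N * δ)
  set A' := {y : Space N | δ • (y - 0) ∈ Metric.cthickening (r + 2 * r) C} with hA'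
  set E := ∫⁻ y in A', (cutPower s (τ ε) (v y) + ‖k y‖ₑ ^ 2) with hEdef
  have hEa : E ≤ a' := by
    have h1 : ENNReal.ofReal (1 - κ)⁻¹ * (ENNReal.ofReal (1 - κ) * E) ≤ a' := mul_le_mul_right hE _
    rwa [← mul_assoc, ← ENNReal.ofReal_mul (by positivity), inv_mul_cancel₀ h1κ.ne',
      ENNReal.ofReal_one, one_mul] at h1
  have hMM : ∫⁻ y in A', ‖v y‖ₑ ≤ M := hmr.trans_le hMε
  obtain ⟨w, l, hw, hw0, hwi, hwv, hwE⟩ := hcomp hvk hvm hkm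
    (fun y => mul_nonneg (by positivity) (h0 _))
    (χ := fun y => χ (δ • (y - 0))) (hχ.comp (by fun_prop)) (fun y => hχ1 _)
    (norm_gradient_rescaled_le hL hδ)
    (A := {y : Space N | δ • (y - 0) ∈ Metric.cthickening (2 * r) C}) (A' := A')
    (Metric.isClosed_cthickening.measurableSet.preimage hsm) (hA1.preimage hsm)
    (fun y hy => hχzero _ hy) (fun y hy e he => by
      have : δ • (y + e - 0) = δ • (y - 0) + δ • e := by
        rw [sub_zero, sub_zero, smul_add]
      show δ • (y + e - 0) ∈ Metric.cthickening (r + 2 * r) C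
      rw [this]
      refine add_mem_cthickening (by positivity) hr0.le hy ?_
      rw [norm_smul, Real.norm_of_nonneg hδ.le]
      exact (mul_le_of_le_one_right hδ.le he).trans hδr)
    hτ0 hτ1 (ne_top_of_le_ne_top ha't hEa) (ne_top_of_le_ne_top hMt hMM)
  have hhigh := mass_high_ge (g := g) (b := ENNReal.ofReal ((1 - κ) * m))
    (d := ENNReal.ofReal (κ / 2 * m)) (S := Metric.thickening r C) (a := a) hs1 hκ1 hc hK0.le hcK hK hε
    (θ := √(τ ε) / κ) (by positivity) hum h0 (by
      rw [← ENNReal.ofReal_add (by positivity) (by positivity)]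
      refine le_trans (le_of_eq ?_) hmε.le
      congr 1; ring)
    ((lintegral_mono_set ((Metric.thickening_subset_cthickening_of_le
      (div_le_self hr₀.le (by norm_num)) C).trans
      hr₀O)).trans hcon) ENNReal.ofReal_ne_top hlowε
  have hSm : MeasurableSet (Metric.thickening r C ∩
      {x | √(τ ε) / κ < dropletScale N s ε ^ N * u x}) :=
    Metric.isOpen_thickening.measurableSet.inter
      (measurableSet_lt measurable_const (hum.const_mul _))
  rw [← lintegral_rescaled_mass hδ hSm] at hhigh
  have hwmass : ENNReal.ofReal ((1 - 2 * κ) * ((1 - κ) * m)) ≤ ENNReal.ofReal (∫ x, w x) := by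
    rw [← lintegral_enorm_of_nonneg hwi hw0, ENNReal.ofReal_mul h2κ.le]
    refine (mul_le_mul_right hhigh _).trans ?_
    rw [← lintegral_const_mul' _ _ ENNReal.ofReal_ne_top]
    refine (setLIntegral_mono' (hSm.preimage hsm) fun y hy => ?_).trans
      (setLIntegral_le_lintegral _ _)
    rw [Real.enorm_eq_ofReal (mul_nonneg (by positivity) (h0 _)), Real.enorm_eq_ofReal (hw0 y),
      ← ENNReal.ofReal_mul h2κ.le]
    refine ENNReal.ofReal_le_ofReal (hwv y (hχone _ hy.1) ?_)
    have h3 : √(τ ε) / κ < v y := hy.2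
    rw [div_lt_iff₀ hκ0] at h3
    linarith
  have hpos : 0 < (1 - 2 * κ) * ((1 - κ) * m) := by positivity
  have hwm' : (1 - 2 * κ) * ((1 - κ) * m) ≤ ∫ x, w x :=
    (ENNReal.ofReal_le_ofReal_iff (integral_nonneg hw0)).1 hwmass
  -- The cost is monotone in the mass because its exponent is positive.
  have hfin : Y < Y := by
    calc Y ≤ powerCost N s (∫ x, w x) := by
          rw [powerCost_eq hN hs1.le (hpos.trans_le hwm'), hYdef]
          gcongr
          exact (costExponent_pos hN hs1.le hs).le
      _ ≤ _ := powerCost_le s hw hw0 hwi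
      _ ≤ _ := hwE
      _ ≤ _ := by gcongr
      _ < Y := hZε
  exact lt_irrefl _ hfin

/-- Local lower bound for the droplet functional, for infinite costs. -/
theorem IsDropletPotential.eventually_lt_of_le_neg_two {W : ℝ≥0 → ℝ≥0} {s : ℝ}
    (hW : IsDropletPotential W s) (hN : 1 ≤ N) (hs : s ≤ -2) {μs : ℝ → FiniteMeasure (Space N)}
    {μ : FiniteMeasure (Space N)} (h : WeakConverges μs μ) {C O : Set (Space N)} (hC : IsCompact C)
    (hO : IsOpen O) (hCO : C ⊆ O) (hμC : (μ : Measure (Space N)) C ≠ 0) {a : ℝ≥0∞} (hat : a ≠ ⊤) :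
    ∀ᶠ ε in 𝓝[>] (0 : ℝ), ∀ (u : Space N → ℝ) (g : Space N → Space N), IsW11loc u g →
      Measurable u → Measurable g → (∀ x, 0 ≤ u x) →
      (μs ε : Measure (Space N)) = volume.withDensity (fun x => ENNReal.ofReal (u x)) →
      a < ∫⁻ x in O, dropletDensity N W s ε (u x) (g x) := by
  have hs1 := hW.lt_one
  set m := (μ : Measure (Space N)) C with hmdef
  have hmt : m ≠ ⊤ := measure_ne_top _ _
  obtain ⟨K, c, hK0, hc, hcK, hK⟩ := exists_lower_bounds (κ := 1 / 2) (by norm_num)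
    hW.lowerSemicontinuous hW.eq_zero_iff hW.isEquivalent hW.liminf_pos
  have hκ1 : (1 : ℝ) / 2 < 1 := by norm_num
  obtain ⟨r₀, hr₀, hr₀O⟩ := hC.exists_cthickening_subset_open hO hCO
  set r := r₀ / 2 with hr
  have hr0 : 0 < r := by positivity
  have hr₀' : r + r = r₀ := by rw [hr]; ring
  obtain ⟨M, hMt, hM⟩ := h.exists_eventually_measure_le (hC.cthickening (r := r + r))
  have h4 : m / 4 + m / 4 < m := by
    rw [← ENNReal.add_div, ← two_mul]
    refine (ENNReal.div_lt_iff (by simp) (by simp)).2 ?_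
    rw [mul_comm]
    exact ENNReal.mul_lt_mul_right hμC hmt (by norm_num)
  have hm4 : 0 < m / 4 := ENNReal.div_pos hμC (by simp)
  have hmass := h.eventually_lt_measure hC (Metric.isOpen_thickening (δ := r) (E := C))
    (Metric.self_subset_thickening hr0 C) h4
  set B := volume (Metric.closedBall (0 : Space N) 1) with hB
  have hB0 : B⁻¹ ≠ ⊤ := ENNReal.inv_ne_top.2 (Metric.measure_closedBall_pos volume _ one_pos).ne'
  set a' := 2 * a with ha'
  have ha't : a' ≠ ⊤ := by finiteness
  set τ : ℝ → ℝ := fun ε => K * dropletScale N s ε ^ N with hτdef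
  have hτlim : Tendsto τ (𝓝[>] 0) (𝓝[>] 0) := tendsto_dropletScale_pow hN hs1 hK0
  have hτlim0 : Tendsto τ (𝓝[>] 0) (𝓝 0) := hτlim.mono_right nhdsWithin_le_nhds
  have hδlim0 : Tendsto (dropletScale N s) (𝓝[>] 0) (𝓝 0) :=
    (tendsto_dropletScale hs1).mono_right nhdsWithin_le_nhds
  obtain ⟨R, hR, hvol⟩ := exists_le_volume_closedBall (N := N) hN (K := 2 * (a' + M)) (by finiteness)
  -- Here the level stays fixed as `ε → 0`. For small `ε` the heights below it carry at most `m /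
  -- 4`, and a mass of at least `m / 4` remains above.
  obtain ⟨θ, hθ0, hθ1, hθ⟩ : ∃ θ : ℝ, 0 < θ ∧ θ ≤ 1 ∧
      ENNReal.ofReal (θ ^ (1 - s) / (1 - 1 / 2)) * a < m / 4 := by
    have h1 := ((tendsto_rpow_nhdsGT_zero (show 0 < 1 - s by linarith)).mono_right
      nhdsWithin_le_nhds).div_const (1 - 1 / 2)
    have h2 := ENNReal.Tendsto.mul_const (ENNReal.tendsto_ofReal h1) (Or.inr hat)
    rw [zero_div, ENNReal.ofReal_zero, zero_mul] at h2
    have h3 : ∀ᶠ θ : ℝ in 𝓝[>] 0, θ ≤ 1 := nhdsWithin_le_nhds (eventually_le_nhds one_pos)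
    obtain ⟨θ, ⟨h5, h6⟩, h7⟩ := (((h2.eventually_lt_const hm4).and h3).and self_mem_nhdsWithin).exists
    exact ⟨θ, h7, h6, h5⟩
  have hlow := tendsto_lowMassCoeff hN (κ := 1 / 2) (c := c) hs1
    (tendsto_const_nhds (x := θ) (f := 𝓝[>] (0 : ℝ))) hat
  set M₂ := 2 * a' + 2 * B⁻¹ * M ^ 2 with hM₂
  have hM₂t : M₂ ≠ ⊤ := by finiteness
  -- The source of the contradiction: by Cauchy–Schwarz and Nash, a mass `m / 4` on `{θ ≤ v}` forces
  -- a volume bounded below, whereas the capacity estimate between `τ` and `θ` bounds this volume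
  -- times `log (θ / τ)` from above.
  have hlog : Tendsto (fun ε => (m / 4) ^ 2 * ENNReal.ofReal (Real.log (θ / τ ε))) (𝓝[>] 0) (𝓝 ⊤) := by
    have h1 : Tendsto (fun ε => θ / τ ε) (𝓝[>] 0) atTop :=
      (tendsto_inv_nhdsGT_zero.comp hτlim).const_mul_atTop hθ0
    have h2 := ENNReal.Tendsto.const_mul (a := (m / 4) ^ 2)
      (ENNReal.tendsto_ofReal_atTop.comp (Real.tendsto_log_atTop.comp h1))
      (Or.inl ENNReal.top_ne_zero)
    rwa [ENNReal.mul_top (pow_ne_zero 2 hm4.ne')] at h2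
  have hbig : M₂ * (2 * ENNReal.ofReal R * a') < ⊤ := by finiteness
  filter_upwards [self_mem_nhdsWithin, hmass, hM, hlog.eventually_const_lt hbig,
    hτlim0.eventually_lt_const hθ0, hδlim0.eventually_le_const (div_pos hr0 (lt_max_of_lt_right hR)),
    hlow.eventually_le_const hθ] with ε hε hmε hMε hZε hτ1 hδr hlowε
  intro u g hug hum hgm h0 hμ
  have hδ := dropletScale_pos (N := N) (s := s) hε
  have hτ0 : 0 < τ ε := mul_pos hK0 (pow_pos hδ N)
  rw [hμ, withDensity_ofReal_apply h0 Metric.isOpen_thickening.measurableSet] at hmε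
  rw [hμ, withDensity_ofReal_apply h0 Metric.isClosed_cthickening.measurableSet] at hMε
  by_contra! hcon
  have hA1 : MeasurableSet (Metric.cthickening (r + r) C) :=
    Metric.isClosed_cthickening.measurableSet
  have hsm : Measurable fun y : Space N => dropletScale N s ε • (y - 0) := by fun_prop
  have hE : ENNReal.ofReal (1 - 1 / 2) * _ ≤ a :=
    (lintegral_rescaled_le (u := u) (g := g) hs1 (by norm_num) hκ1 hK0.le hK hε hA1).trans
      ((lintegral_mono_set (by rw [hr₀']; exact hr₀O)).trans hcon)
  have hmr := lintegral_rescaled_mass (u := u) hδ hA1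
  have hhigh := mass_high_ge (g := g) (b := m / 4)
    (d := m / 4) (S := Metric.thickening r C) (a := a) hs1 hκ1 hc hK0.le hcK hK hε
    (θ := θ) hθ0.le hum h0 hmε.le
    ((lintegral_mono_set ((Metric.thickening_subset_cthickening_of_le
      (div_le_self hr₀.le (by norm_num)) C).trans
      hr₀O)).trans hcon) (ENNReal.div_ne_top hmt (by simp)) hlowε
  have hSm : MeasurableSet (Metric.thickening r C ∩ {x | θ < dropletScale N s ε ^ N * u x}) :=
    Metric.isOpen_thickening.measurableSet.inter
      (measurableSet_lt measurable_const (hum.const_mul _))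
  rw [← lintegral_rescaled_mass hδ hSm] at hhigh
  set δ := dropletScale N s ε with hδdef
  set v : Space N → ℝ := fun y => δ ^ N * u (δ • (y - 0)) with hv
  set k : Space N → Space N := fun y => (δ ^ N * δ) • g (δ • (y - 0)) with hk
  have hvk : IsW11loc v k := hug.affine (δ ^ N) hδ 0
  have hvm : Measurable v := (hum.comp hsm).const_mul _
  have hkm : Measurable k := (hgm.comp hsm).const_smul (δ ^ N * δ)
  set A := {y : Space N | δ • (y - 0) ∈ Metric.thickening r C} with hA
  set A' := {y : Space N | δ • (y - 0) ∈ Metric.cthickening (r + r) C} with hA'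
  have hAm : MeasurableSet A := Metric.isOpen_thickening.measurableSet.preimage hsm
  have hAm' : MeasurableSet A' := hA1.preimage hsm
  have hAA' : ∀ y ∈ A, ∀ e : Space N, ‖e‖ ≤ max 1 R → y + e ∈ A' := fun y hy e he => by
    have : δ • (y + e - 0) = δ • (y - 0) + δ • e := by
      rw [sub_zero, sub_zero, smul_add]
    show δ • (y + e - 0) ∈ Metric.cthickening (r + r) C
    rw [this]
    refine add_mem_cthickening hr0.le hr0.le (Metric.thickening_subset_cthickening _ _ hy) ?_
    rw [norm_smul, Real.norm_of_nonneg hδ.le]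
    calc δ * ‖e‖ ≤ r / max 1 R * max 1 R := by gcongr
      _ = r := div_mul_cancel₀ _ (by positivity)
  set E := ∫⁻ y in A', (cutPower s (τ ε) (v y) + ‖k y‖ₑ ^ 2) with hEdef
  have hEa : E ≤ a' := by
    have h1 : 2 * (ENNReal.ofReal (1 - 1 / 2) * E) ≤ a' := mul_le_mul_right hE _
    rwa [← mul_assoc, show (2 : ℝ≥0∞) = ENNReal.ofReal 2 by simp,
      ← ENNReal.ofReal_mul (by positivity), show (2 : ℝ) * (1 - 1 / 2) = 1 by norm_num,
      ENNReal.ofReal_one, one_mul] at h1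
  have hMM : ∫⁻ y in A', ‖v y‖ₑ ≤ M := hmr.trans_le hMε
  have hnash : ∫⁻ y in A, ‖v y‖ₑ ^ 2 ≤ M₂ := by
    refine (hvk.nash hvm hkm hAm hAm' one_pos
      fun y hy e he => hAA' y hy e (he.trans (le_max_left _ _))).trans ?_
    rw [one_pow, ENNReal.ofReal_one, mul_one, hM₂]
    gcongr
    exact (lintegral_mono fun y => le_add_self).trans hEa
  have hcap := hvk.volume_mul_log_le hvm hkm hs hτ0 hτ1 hθ1 hR hAm hAm'
    (fun y hy e he => hAA' y hy e (he.trans (le_max_right _ _))) (by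
      refine le_trans ?_ hvol
      gcongr
      refine (volume_lt_le (s := s) (by linarith) hτ0.le hvm).trans ?_
      gcongr
      exact (lintegral_mono fun x => le_self_add).trans hEa)
  have hsq : (m / 4) ^ 2 ≤ volume (A ∩ {y | θ ≤ v y}) * M₂ := by
    have hsub : {y : Space N | δ • (y - 0) ∈ Metric.thickening r C ∩ {x | θ < δ ^ N * u x}} ⊆
        A ∩ {y | θ ≤ v y} := fun y hy => ⟨hy.1, (show θ < v y from hy.2).le⟩
    calc (m / 4) ^ 2 ≤ (∫⁻ y in A ∩ {y | θ ≤ v y}, ‖v y‖ₑ) ^ 2 := by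
          gcongr
          exact hhigh.trans (lintegral_mono_set hsub)
      _ ≤ volume (A ∩ {y | θ ≤ v y}) * ∫⁻ y in A ∩ {y | θ ≤ v y}, ‖v y‖ₑ ^ 2 := by
          have := sq_lintegral_le (μ := volume.restrict (A ∩ {y | θ ≤ v y}))
            (f := fun y => ‖v y‖ₑ) hvm.enorm.aemeasurable
          rwa [Measure.restrict_apply_univ] at this
      _ ≤ _ := by
          gcongr
          exact (lintegral_mono_set Set.inter_subset_left).trans hnash
  refine absurd hZε (not_lt.2 ?_)
  calc (m / 4) ^ 2 * ENNReal.ofReal (Real.log (θ / τ ε))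
      ≤ volume (A ∩ {y | θ ≤ v y}) * M₂ * ENNReal.ofReal (Real.log (θ / τ ε)) := by gcongr
    _ = M₂ * (volume (A ∩ {y | θ ≤ v y}) * ENNReal.ofReal (Real.log (θ / τ ε))) := by ring
    _ ≤ M₂ * (2 * ENNReal.ofReal R * a') :=
        mul_le_mul_right (hcap.trans (mul_le_mul_right hEa _)) _

/-! ### Superadditivity and the global lower bound -/

/-- Fatou's lemma for the counting measure on `t`. -/
theorem sum_liminf_le {ι β : Type*} {f : Filter β} [f.IsCountablyGenerated] (t : Finset ι)
    (F : ι → β → ℝ≥0∞) : ∑ i ∈ t, liminf (F i) f ≤ liminf (fun b => ∑ i ∈ t, F i b) f := by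
  let _ : MeasurableSpace t := ⊤
  have := lintegral_liminf_le (μ := (Measure.count : Measure t)) (u := f)
    (f := fun b (i : t) => F i b) (fun b => measurable_from_top)
  simp only [lintegral_count, tsum_fintype] at this
  rwa [Finset.sum_coe_sort t (fun i => liminf (F i) f), funext fun b =>
    Finset.sum_coe_sort t (fun i => F i b)] at this

theorem IsW11loc.exists_measurable (h : IsW11loc u g) (h0 : ∀ x, 0 ≤ u x) :
    ∃ (u' : Space N → ℝ) (g' : Space N → Space N), IsW11loc u' g' ∧ Measurable u' ∧ Measurable g' ∧
      (∀ x, 0 ≤ u' x) ∧ u =ᵐ[volume] u' ∧ g =ᵐ[volume] g' := by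
  obtain ⟨u', hu', huu'⟩ := h.locallyIntegrable.aestronglyMeasurable.aemeasurable
  obtain ⟨g', hg', hgg'⟩ := h.locallyIntegrable_grad.aestronglyMeasurable.aemeasurable
  have huu'' : u =ᵐ[volume] fun x => max (u' x) 0 := by
    filter_upwards [huu'] with x hx
    rw [← hx, max_eq_left (h0 x)]
  exact ⟨fun x => max (u' x) 0, g', h.congr_ae huu'' hgg', hu'.max measurable_const, hg',
    fun x => le_max_right _ _, huu'', hgg'⟩

/-- Lower bounds need only be proved for measurable representatives of the density and its gradient.
-/
theorem le_dropletEnergy {W : ℝ≥0 → ℝ≥0} {s ε : ℝ} {μ : FiniteMeasure (Space N)} {a : ℝ≥0∞}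
    (h : ∀ (u : Space N → ℝ) (g : Space N → Space N), IsW11loc u g →
      Measurable u → Measurable g → (∀ x, 0 ≤ u x) →
      (μ : Measure (Space N)) = volume.withDensity (fun x => ENNReal.ofReal (u x)) →
      a ≤ ∫⁻ x, dropletDensity N W s ε (u x) (g x)) : a ≤ dropletEnergy W s ε μ := by
  refine le_iInf fun u => le_iInf fun g => le_iInf fun hug => le_iInf fun h0 => le_iInf fun hμ => ?_
  obtain ⟨u', g', hug', hum, hgm, h0', huu', hgg'⟩ := hug.exists_measurable h0
  refine (h u' g' hug' hum hgm h0' (hμ.trans (withDensity_congr_ae ?_))).trans (le_of_eq ?_)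
  · filter_upwards [huu'] with x hx
    rw [hx]
  · refine lintegral_congr_ae ?_
    filter_upwards [huu', hgg'] with x hu hg
    rw [dropletDensity, hu, hg]

/-- The energy in a set of the best density of a measure. -/
def localEnergy (W : ℝ≥0 → ℝ≥0) (s ε : ℝ) (μ : FiniteMeasure (Space N)) (O : Set (Space N)) : ℝ≥0∞ :=
  ⨅ (u : Space N → ℝ) (g : Space N → Space N) (_ : IsW11loc u g) (_ : Measurable u)
    (_ : Measurable g) (_ : ∀ x, 0 ≤ u x)
    (_ : (μ : Measure (Space N)) = volume.withDensity (fun x => ENNReal.ofReal (u x))),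
    ∫⁻ x in O, dropletDensity N W s ε (u x) (g x)

theorem sum_localEnergy_le {ι : Type*} {W : ℝ≥0 → ℝ≥0} {s ε : ℝ} {μ : FiniteMeasure (Space N)}
    {t : Finset ι} {O : ι → Set (Space N)} (hO : ∀ i ∈ t, MeasurableSet (O i))
    (hd : (t : Set ι).PairwiseDisjoint O) :
    ∑ i ∈ t, localEnergy W s ε μ (O i) ≤ dropletEnergy W s ε μ := by
  refine le_dropletEnergy fun u g hug hum hgm h0 hμ => ?_
  calc ∑ i ∈ t, localEnergy W s ε μ (O i)
      ≤ ∑ i ∈ t, ∫⁻ x in O i, dropletDensity N W s ε (u x) (g x) :=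
        Finset.sum_le_sum fun i _ => iInf_le_of_le u <| iInf_le_of_le g <| iInf_le_of_le hug <|
          iInf_le_of_le hum <| iInf_le_of_le hgm <| iInf_le_of_le h0 <| iInf_le_of_le hμ le_rfl
    _ = ∫⁻ x in ⋃ i ∈ t, O i, dropletDensity N W s ε (u x) (g x) :=
        (lintegral_biUnion_finset hd hO _).symm
    _ ≤ _ := setLIntegral_le_lintegral _ _

theorem IsDropletPotential.powerCost_le_liminf {W : ℝ≥0 → ℝ≥0} {s : ℝ}
    (hW : IsDropletPotential W s) (hN : 1 ≤ N) {μs : ℝ → FiniteMeasure (Space N)}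
    {μ : FiniteMeasure (Space N)} (h : WeakConverges μs μ) {C O : Set (Space N)} (hC : IsCompact C)
    (hO : IsOpen O) (hCO : C ⊆ O) :
    powerCost N s ((μ : Measure (Space N)).real C) ≤
      liminf (fun ε => localEnergy W s ε (μs ε) O) (𝓝[>] 0) := by
  refine le_of_forall_lt fun a ha => ?_
  obtain ⟨b, hab, hb⟩ := exists_between ha
  refine hab.trans_le (le_liminf_of_le (by isBoundedDefault) ?_)
  have hev : ∀ᶠ ε in 𝓝[>] (0 : ℝ), ∀ (u : Space N → ℝ) (g : Space N → Space N), IsW11loc u g →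
      Measurable u → Measurable g → (∀ x, 0 ≤ u x) →
      (μs ε : Measure (Space N)) = volume.withDensity (fun x => ENNReal.ofReal (u x)) →
      b < ∫⁻ x in O, dropletDensity N W s ε (u x) (g x) := by
    rcases lt_or_ge (-2) s with hs | hs
    · exact hW.eventually_lt_of_neg_two_lt hN hs h hC hO hCO hb
    · refine hW.eventually_lt_of_le_neg_two hN hs h hC hO hCO (fun h0 => ?_) (hb.trans_le le_top).ne
      rw [measureReal_def, h0, ENNReal.toReal_zero, powerCost_zero] at hb
      exact not_lt_zero hb
  filter_upwards [hev] with ε hε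
  exact le_iInf fun u => le_iInf fun g => le_iInf fun hug => le_iInf fun hum => le_iInf fun hgm =>
    le_iInf fun h0 => le_iInf fun hμ => (hε u g hug hum hgm h0 hμ).le

theorem exists_disjoint_thickenings {ι : Type*} {t : Finset ι} {C : ι → Set (Space N)}
    (hC : ∀ i ∈ t, IsCompact (C i)) (hd : (t : Set ι).PairwiseDisjoint C) :
    ∃ δ : ℝ, 0 < δ ∧ (t : Set ι).PairwiseDisjoint fun i => Metric.thickening δ (C i) := by
  have : ∀ᶠ δ : ℝ in 𝓝[>] 0, ∀ i ∈ t, ∀ j ∈ t, i ≠ j →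
      Disjoint (Metric.thickening δ (C i)) (Metric.thickening δ (C j)) := by
    rw [eventually_all_finset]
    intro i hi
    rw [eventually_all_finset]
    intro j hj
    by_cases hij : i = j
    · exact Eventually.of_forall fun _ h => absurd hij h
    obtain ⟨δ, hδ, hdis⟩ := (hd hi hj hij).exists_thickenings (hC i hi) (hC j hj).isClosed
    filter_upwards [nhdsWithin_le_nhds (eventually_le_nhds hδ)] with δ' hδ' _
    exact hdis.mono (Metric.thickening_mono hδ' _) (Metric.thickening_mono hδ' _)
  obtain ⟨δ, h1, h2⟩ := (this.and self_mem_nhdsWithin).exists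
  exact ⟨δ, h2, fun i hi j hj hij => h1 i hi j hj hij⟩

/-- Finitely many disjoint compact sets have disjoint neighbourhoods, in which the energies add up.
Singletons will give the atomic part, small compact sets the diffuse part. -/
theorem IsDropletPotential.tsum_powerCost_le_liminf {W : ℝ≥0 → ℝ≥0} {s : ℝ}
    (hW : IsDropletPotential W s) (hN : 1 ≤ N) {μs : ℝ → FiniteMeasure (Space N)}
    {μ : FiniteMeasure (Space N)} (h : WeakConverges μs μ) {ι : Type*} {C : ι → Set (Space N)}
    (hC : ∀ i, IsCompact (C i)) (hd : Pairwise (Function.onFun Disjoint C)) :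
    ∑' i, powerCost N s ((μ : Measure (Space N)).real (C i)) ≤
      liminf (fun ε => dropletEnergy W s ε (μs ε)) (𝓝[>] 0) := by
  rw [ENNReal.tsum_eq_iSup_sum]
  refine iSup_le fun t => ?_
  obtain ⟨δ, hδ, hdis⟩ := exists_disjoint_thickenings (t := t) (fun i _ => hC i)
    (fun i _ j _ hij => hd hij)
  calc ∑ i ∈ t, powerCost N s ((μ : Measure (Space N)).real (C i))
      ≤ ∑ i ∈ t, liminf (fun ε => localEnergy W s ε (μs ε) (Metric.thickening δ (C i))) (𝓝[>] 0) :=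
        Finset.sum_le_sum fun i _ => hW.powerCost_le_liminf hN h (hC i) Metric.isOpen_thickening
          (Metric.self_subset_thickening hδ _)
    _ ≤ _ := sum_liminf_le _ _
    _ ≤ _ := liminf_le_liminf (Eventually.of_forall fun ε =>
        sum_localEnergy_le (fun i _ => Metric.isOpen_thickening.measurableSet) hdis)

theorem tsum_atoms_ne_top (μ : Measure (Space N)) [IsFiniteMeasure μ] :
    ∑' x : Space N, μ {x} ≠ ⊤ :=
  ne_top_of_le_ne_top (measure_ne_top μ Set.univ)
    (tsum_measure_le_measure_univ (fun x => (measurableSet_singleton x).nullMeasurableSet)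
      fun _ _ hxy => (Set.disjoint_singleton.2 hxy).aedisjoint)

theorem countable_atoms (μ : Measure (Space N)) [IsFiniteMeasure μ] :
    {x : Space N | μ {x} ≠ 0}.Countable :=
  Summable.countable_support_ennreal (tsum_atoms_ne_top μ)

theorem measurableSet_diffuse (μ : Measure (Space N)) [IsFiniteMeasure μ] :
    MeasurableSet {x | μ {x} = 0} := by
  convert (countable_atoms μ).measurableSet.compl using 1
  ext x
  simp

/-- A diffuse measure can be concentrated, up to half of its mass, on countably many disjoint
compact sets of small mass. -/
theorem exists_small_compacts (μ : Measure (Space N)) [IsFiniteMeasure μ] {η : ℝ≥0∞} (hη : 0 < η) :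
    ∃ C : ℕ → Set (Space N), (∀ i, IsCompact (C i)) ∧ Pairwise (Function.onFun Disjoint C) ∧
      (∀ i, μ (C i) ≤ η) ∧ μ {x | μ {x} = 0} / 2 ≤ ∑' i, μ (C i) := by
  obtain ⟨b, hb, -, hbas⟩ := TopologicalSpace.exists_countable_basis (Space N)
  have hbne : b.Nonempty := by
    obtain ⟨v, hv, -⟩ := hbas.exists_subset_of_mem_open (Set.mem_univ (0 : Space N)) isOpen_univ
    exact ⟨v, hv⟩
  obtain ⟨f, rfl⟩ := hb.exists_eq_range hbne
  set U : ℕ → Set (Space N) := fun n => if μ (f n) ≤ η then f n else ∅ with hU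
  have hUm : ∀ n, MeasurableSet (U n) := fun n => by
    simp only [hU]
    split_ifs
    · exact (hbas.isOpen (Set.mem_range_self n)).measurableSet
    · exact MeasurableSet.empty
  have hUη : ∀ n, μ (U n) ≤ η := fun n => by
    simp only [hU]
    split_ifs with h
    · exact h
    · simp
  set D := {x | μ {x} = 0} with hD
  have hDm : MeasurableSet D := measurableSet_diffuse μ
  have hcov : D ⊆ ⋃ n, U n := fun x hx => by
    obtain ⟨V, hV, hVo, hVη⟩ := Set.exists_isOpen_lt_of_lt (μ := μ) {x} η (by
      rw [show μ {x} = 0 from hx]; exact hη)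
    obtain ⟨w, ⟨n, rfl⟩, hxw, hwV⟩ := hbas.exists_subset_of_mem_open (hV rfl) hVo
    refine Set.mem_iUnion.2 ⟨n, ?_⟩
    simp only [hU]
    rwa [if_pos ((measure_mono hwV).trans hVη.le)]
  set P : ℕ → Set (Space N) := fun n => D ∩ disjointed U n with hP
  have hPm : ∀ n, MeasurableSet (P n) := fun n => hDm.inter (MeasurableSet.disjointed hUm n)
  -- Half of the mass suffices, because the lower bound derived from it will be infinite.
  have hex : ∀ n, ∃ K ⊆ P n, IsCompact K ∧ μ (P n) / 2 ≤ μ K := fun n => by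
    by_cases h0 : μ (P n) = 0
    · exact ⟨∅, Set.empty_subset _, isCompact_empty, by simp [h0]⟩
    · obtain ⟨K, hK, hKc, hlt⟩ := (hPm n).exists_lt_isCompact
        (ENNReal.half_lt_self h0 (measure_ne_top μ _))
      exact ⟨K, hK, hKc, hlt.le⟩
  choose C hCP hCc hCμ using hex
  have hPd : Pairwise (Function.onFun Disjoint P) := fun i j hij =>
    (disjoint_disjointed U hij).mono Set.inter_subset_right Set.inter_subset_right
  refine ⟨C, hCc, fun i j hij => (hPd hij).mono (hCP i) (hCP j), fun i => ?_, ?_⟩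
  · exact (measure_mono ((hCP i).trans (Set.inter_subset_right.trans
      (disjointed_subset U i)))).trans (hUη i)
  · have hDP : D = ⋃ n, P n := by
      rw [← Set.inter_iUnion, iUnion_disjointed, Set.inter_eq_left.2 hcov]
    calc μ D / 2 = ∑' n, μ (P n) / 2 := by
          rw [hDP, measure_iUnion hPd hPm]
          simp only [div_eq_mul_inv]
          rw [ENNReal.tsum_mul_right]
      _ ≤ _ := ENNReal.tsum_le_tsum hCμ

/-- Since `α ≤ 1`, the ratio `H(m) / m = H(1) m ^ (α - 1)` is nonincreasing, hence at least its
value at `η`. -/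
theorem powerCost_ge_of_le (hN : 1 ≤ N) {s : ℝ} (hs : s ≤ 1) {m η : ℝ} (hη : 0 < η) (hm0 : 0 ≤ m)
    (hm : m ≤ η) :
    powerCost N s 1 * ENNReal.ofReal (η ^ (costExponent N s - 1)) * ENNReal.ofReal m ≤
      powerCost N s m := by
  rcases hm0.eq_or_lt with rfl | hm0
  · simp
  rw [powerCost_eq hN hs hm0, mul_assoc, ← ENNReal.ofReal_mul (by positivity)]
  gcongr
  calc η ^ (costExponent N s - 1) * m ≤ m ^ (costExponent N s - 1) * m := by
        gcongr ?_ * _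
        exact Real.rpow_le_rpow_of_nonpos hm0 hm (by linarith [costExponent_le_one hN hs])
    _ = m ^ costExponent N s := by
        rw [← Real.rpow_add_one hm0.ne', sub_add_cancel]

/-- The lower bound of the `Γ`-convergence. -/
theorem IsDropletPotential.HMass_le_liminf {W : ℝ≥0 → ℝ≥0} {s : ℝ}
    (hW : IsDropletPotential W s) (hN : 1 ≤ N) {μs : ℝ → FiniteMeasure (Space N)}
    {μ : FiniteMeasure (Space N)} (h : WeakConverges μs μ) :
    HMass (powerCost N s) μ ≤ liminf (fun ε => dropletEnergy W s ε (μs ε)) (𝓝[>] 0) := by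
  have hs := hW.lt_one
  set D := {x | (μ : Measure (Space N)) {x} = 0} with hD
  by_cases hD0 : (μ : Measure (Space N)) D = 0
  · rw [HMass, ← hD, hD0, mul_zero, add_zero]
    exact hW.tsum_powerCost_le_liminf hN h (fun x => isCompact_singleton)
      fun x y hxy => Set.disjoint_singleton.2 hxy
  -- A nonzero diffuse part makes the lower limit infinite: pieces of mass at most `η` cost at least
  -- `H(1) η ^ (α - 1)` per unit of mass, and `α < 1`.
  · have hkey : ∀ η : ℝ, 0 < η → powerCost N s 1 * ENNReal.ofReal (η ^ (costExponent N s - 1)) *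
        ((μ : Measure (Space N)) D / 2) ≤
        liminf (fun ε => dropletEnergy W s ε (μs ε)) (𝓝[>] 0) := fun η hη => by
      obtain ⟨C, hC, hCd, hCη, hCμ⟩ := exists_small_compacts (μ : Measure (Space N))
        (ENNReal.ofReal_pos.2 hη)
      refine le_trans ?_ (hW.tsum_powerCost_le_liminf hN h hC hCd)
      refine (mul_le_mul_right hCμ _).trans ?_
      rw [← ENNReal.tsum_mul_left]
      refine ENNReal.tsum_le_tsum fun i => ?_
      rw [← ofReal_measureReal (μ := (μ : Measure (Space N))) (s := C i)]
      exact powerCost_ge_of_le hN hs.le hη measureReal_nonneg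
        (ENNReal.toReal_le_of_le_ofReal hη.le (hCη i))
    have hlim : Tendsto (fun η : ℝ => powerCost N s 1 *
        ENNReal.ofReal (η ^ (costExponent N s - 1)) * ((μ : Measure (Space N)) D / 2)) (𝓝[>] 0)
        (𝓝 (powerCost N s 1 * ⊤ * ((μ : Measure (Space N)) D / 2))) := by
      have hP0 := (powerCost_one_pos (N := N) hN hs.le).ne'
      have hexp : Tendsto (fun η : ℝ => η ^ (costExponent N s - 1)) (𝓝[>] 0) atTop := by
        have h1 := tendsto_inv_nhdsGT_zero.comp (tendsto_rpow_nhdsGT_zero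
          (show 0 < 1 - costExponent N s by linarith [costExponent_lt_one hN hs]))
        refine h1.congr' ?_
        filter_upwards [self_mem_nhdsWithin] with η hη
        rw [Function.comp_apply, ← Real.rpow_neg (le_of_lt hη), neg_sub]
      refine ENNReal.Tendsto.mul_const (ENNReal.Tendsto.const_mul
        (ENNReal.tendsto_ofReal_atTop.comp hexp) (Or.inl ENNReal.top_ne_zero)) (Or.inl ?_)
      rw [ENNReal.mul_top hP0]; exact ENNReal.top_ne_zero
    have hfin : powerCost N s 1 * ⊤ * ((μ : Measure (Space N)) D / 2) = ⊤ := by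
      rw [ENNReal.mul_top (powerCost_one_pos (N := N) hN hs.le).ne',
        ENNReal.top_mul (ENNReal.div_pos hD0 (by simp)).ne']
    rw [hfin] at hlim
    have := le_of_tendsto hlim (eventually_mem_nhdsWithin.mono fun η hη => hkey η hη)
    exact le_top.trans this

/-! ### Recovery droplets: compact profiles and their energy -/

/-- The minimal cost can be approximated by compactly supported competitors. -/
theorem exists_compact_profile (hN : 1 ≤ N) {s : ℝ} (hs : -2 < s) (hs1 : s ≤ 1) {m : ℝ} (hm : 0 < m)
    {b : ℝ≥0∞} (hb : powerCost N s m < b) :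
    ∃ (φ : Space N → ℝ) (k : Space N → Space N) (R : ℝ), IsW11loc φ k ∧ Measurable φ ∧
      Measurable k ∧ (∀ y, 0 ≤ φ y) ∧ Integrable φ volume ∧ ∫ y, φ y = m ∧
      (∀ y, R < ‖y‖ → φ y = 0 ∧ k y = 0) ∧ ∫⁻ y, (cutPower s 0 (φ y) + ‖k y‖ₑ ^ 2) < b := by
  obtain ⟨u, g, h, hum, hgm, h0, hi, hmu, hE⟩ := exists_of_powerCost_lt hb
  set E := ∫⁻ x, (cutPower s 0 (u x) + ‖g x‖ₑ ^ 2) with hEdef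
  have hEt : E ≠ ⊤ := (hE.trans_le le_top).ne
  obtain ⟨κ, hκ0, hκ4, hκ⟩ : ∃ κ : ℝ, 0 < κ ∧ κ < 1 / 4 ∧
      ENNReal.ofReal (1 - 2 * κ)⁻¹ * (ENNReal.ofReal (1 + κ) * E + ENNReal.ofReal κ) < b := by
    have h1 : Tendsto (fun κ : ℝ => (1 - 2 * κ)⁻¹) (𝓝 0) (𝓝 (1 - 2 * 0)⁻¹) :=
      ((tendsto_id.const_mul 2).const_sub 1).inv₀ (by norm_num)
    have h2 : Tendsto (fun κ : ℝ => ENNReal.ofReal (1 + κ) * E + ENNReal.ofReal κ) (𝓝 0)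
        (𝓝 (ENNReal.ofReal (1 + 0) * E + ENNReal.ofReal 0)) :=
      (ENNReal.Tendsto.mul_const (ENNReal.tendsto_ofReal (tendsto_id.const_add 1)) (Or.inr hEt)).add
        (ENNReal.tendsto_ofReal tendsto_id)
    have h3 := (ENNReal.Tendsto.mul (ENNReal.tendsto_ofReal h1) (Or.inr (by finiteness)) h2
      (Or.inr ENNReal.ofReal_ne_top)).mono_left (nhdsWithin_le_nhds (s := Set.Ioi 0))
    simp only [mul_zero, sub_zero, inv_one, ENNReal.ofReal_one, add_zero, one_mul,
      ENNReal.ofReal_zero] at h3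
    have h4 : ∀ᶠ κ : ℝ in 𝓝[>] 0, κ < 1 / 4 :=
      nhdsWithin_le_nhds (eventually_lt_nhds (by norm_num))
    obtain ⟨κ, ⟨h5, h6⟩, h7⟩ := (((h3.eventually_lt_const hE).and h4).and self_mem_nhdsWithin).exists
    exact ⟨κ, h7, h6, h5⟩
  obtain ⟨D, hD, hloc⟩ := exists_localization hs hκ0
  obtain ⟨χ, L, hχ, hχ1, hχone, hχzero, hL⟩ := exists_cutoff (isCompact_singleton (x := (0 : Space N)))
    one_pos
  rw [Metric.thickening_singleton] at hχone
  rw [Metric.cthickening_singleton _ (by norm_num)] at hχzero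
  set M₂ := ∫⁻ x, ‖u x‖ₑ ^ 2 with hM₂
  have hM₂t : M₂ ≠ ⊤ := by
    have hnash := h.nash hum hgm MeasurableSet.univ MeasurableSet.univ one_pos
      (fun _ _ _ _ => Set.mem_univ _)
    simp only [Measure.restrict_univ] at hnash
    rw [lintegral_enorm_of_nonneg hi h0] at hnash
    have hg : ∫⁻ x, ‖g x‖ₑ ^ 2 ≠ ⊤ :=
      ne_top_of_le_ne_top hEt (lintegral_mono fun x => le_add_self)
    have hB : (volume (Metric.closedBall (0 : Space N) 1))⁻¹ ≠ ⊤ :=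
      ENNReal.inv_ne_top.2 (Metric.measure_closedBall_pos volume _ one_pos).ne'
    exact ne_top_of_le_ne_top (by finiteness) hnash
  -- A large radius makes the cutoff error at most `κ` and keeps all but a fraction `κ` of the mass
  -- in the ball where the cutoff function equals one.
  obtain ⟨R, hR0, hRD, hRm⟩ : ∃ R : ℝ, 0 < R ∧
      ENNReal.ofReal (D * (L * R⁻¹) ^ 2) * M₂ ≤ ENNReal.ofReal κ ∧
      (1 - κ) * m ≤ ∫ x in Metric.ball 0 R, u x := by
    have h1 : Tendsto (fun R : ℝ => ENNReal.ofReal (D * (L * R⁻¹) ^ 2) * M₂) atTop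
        (𝓝 (ENNReal.ofReal (D * (L * 0) ^ 2) * M₂)) :=
      ENNReal.Tendsto.mul_const (ENNReal.tendsto_ofReal
        (((tendsto_inv_atTop_zero.const_mul _).pow 2).const_mul D)) (Or.inr hM₂t)
    rw [mul_zero, zero_pow two_ne_zero, mul_zero, ENNReal.ofReal_zero, zero_mul] at h1
    have h2 := (aecover_ball (μ := (volume : Measure (Space N))) (x := 0)
      (tendsto_id (α := ℝ) (x := atTop))).integral_tendsto_of_countably_generated hi
    rw [hmu] at h2
    obtain ⟨R, ⟨h3, h4⟩, h5⟩ := (((h1.eventually_le_const (ENNReal.ofReal_pos.2 hκ0)).and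
      (h2.eventually_const_le (show (1 - κ) * m < m by nlinarith))).and
      (eventually_gt_atTop 0)).exists
    exact ⟨R, h5, h3, h4⟩
  obtain ⟨w, l, hw, hwm, hlm, hwu, hw1, hwz, hwE⟩ := hloc h hum hgm h0
    (χ := fun y => χ (R⁻¹ • (y - 0))) (hχ.comp (by fun_prop)) (fun y => hχ1 _)
    (norm_gradient_rescaled_le hL (inv_pos.2 hR0))
    (A := {y : Space N | R⁻¹ • (y - 0) ∈ Metric.closedBall 0 2})
    (Metric.isClosed_closedBall.measurableSet.preimage
      (by fun_prop : Measurable fun y : Space N => R⁻¹ • (y - 0)))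
    (fun y hy => hχzero _ (by rwa [mul_one])) le_rfl
    (ne_top_of_le_ne_top hEt (setLIntegral_le_lintegral _ _))
    (ne_top_of_le_ne_top hM₂t (setLIntegral_le_lintegral _ _))
  have hwE' : ∫⁻ x, (cutPower s 0 (w x) + ‖l x‖ₑ ^ 2) ≤
      ENNReal.ofReal (1 + κ) * E + ENNReal.ofReal κ := by
    refine hwE.trans (add_le_add ?_ ?_)
    · gcongr; exact setLIntegral_le_lintegral _ _
    · refine le_trans ?_ hRD
      gcongr; exact setLIntegral_le_lintegral _ _
  have hwi : Integrable w volume := hi.mono hwm.aestronglyMeasurable (Eventually.of_forall fun x => by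
    rw [Real.norm_of_nonneg (hwu x).1, Real.norm_of_nonneg (h0 x)]; exact (hwu x).2)
  have h2κ : 0 < 1 - 2 * κ := by linarith
  set p := ∫ x, w x with hp
  have hpm : p ≤ m := by rw [← hmu]; exact integral_mono hwi hi fun x => (hwu x).2
  have hmp : (1 - 2 * κ) * m ≤ p := by
    calc (1 - 2 * κ) * m ≤ (1 - κ) * ((1 - κ) * m) := by nlinarith [sq_nonneg κ]
      _ ≤ (1 - κ) * ∫ x in Metric.ball 0 R, u x :=
        mul_le_mul_of_nonneg_left hRm (by linarith)
      _ = ∫ x in Metric.ball 0 R, (1 - κ) * u x := (integral_const_mul _ _).symm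
      _ ≤ ∫ x in Metric.ball 0 R, w x := by
        refine setIntegral_mono_on (hi.const_mul _).integrableOn hwi.integrableOn
          measurableSet_ball fun x hx => hw1 x (hχone _ ?_)
        rw [mem_ball_zero_iff] at hx ⊢
        rw [sub_zero, norm_smul, Real.norm_of_nonneg (by positivity), inv_mul_lt_iff₀ hR0, mul_one]
        exact hx
      _ ≤ p := setIntegral_le_integral hwi (Eventually.of_forall fun x => (hwu x).1)
  have hp0 : 0 < p := lt_of_lt_of_le (by positivity) hmp
  -- The lost mass is restored by a rescaling, which multiplies the energy by `t ^ α ≤ t ≤ (1 - 2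
  -- κ)⁻¹`.
  set t := m / p with ht
  have ht1 : 1 ≤ t := by rw [ht, le_div_iff₀ hp0]; linarith
  have ht2 : t ≤ (1 - 2 * κ)⁻¹ := by
    rw [ht, div_le_iff₀ hp0, ← div_eq_inv_mul, le_div_iff₀ h2κ]; linarith
  obtain ⟨a, c, ha, hc, hac, hEeq⟩ := exists_rescaled_profile hN hs1 (zero_lt_one.trans_le ht1)
  have hsm : Measurable fun y : Space N => c • (y - 0) := by fun_prop
  refine ⟨fun y => a * w (c • (y - 0)), fun y => (a * c) • l (c • (y - 0)), 2 * R / c,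
    hw.affine a hc 0, (hwm.comp hsm).const_mul _, (hlm.comp hsm).const_smul (a * c),
    fun y => mul_nonneg ha.le (hwu _).1, (integrable_affine hwi hc 0).const_mul a, ?_,
    fun y hy => ?_, ?_⟩
  · rw [integral_const_mul, integral_affine hc 0, ← mul_assoc, hac, ← hp, ht,
      div_mul_cancel₀ _ hp0.ne']
  · have hz := hwz (c • (y - 0)) (fun hmem => ?_)
    · simp only [hz.1, hz.2, mul_zero, smul_zero, and_self]
    · have hmem' : R⁻¹ • (c • (y - 0) - 0) ∈ Metric.closedBall (0 : Space N) 2 := hmem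
      rw [mem_closedBall_zero_iff, sub_zero, sub_zero, norm_smul, norm_smul,
        Real.norm_of_nonneg (by positivity), Real.norm_of_nonneg hc.le,
        inv_mul_le_iff₀ hR0] at hmem'
      rw [div_lt_iff₀ hc] at hy
      linarith
  · rw [hEeq w l fun x => (hwu x).1]
    refine lt_of_le_of_lt ?_ hκ
    gcongr
    calc t ^ costExponent N s ≤ t ^ (1 : ℝ) :=
          Real.rpow_le_rpow_of_exponent_le ht1 (costExponent_le_one hN hs1)
      _ = t := Real.rpow_one t
      _ ≤ _ := ht2

section upper

variable {W : ℝ≥0 → ℝ≥0} {s : ℝ}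

theorem IsDropletPotential.map_zero (hW : IsDropletPotential W s) : W 0 = 0 := (hW.eq_zero_iff 0).2 rfl

theorem IsDropletPotential.exists_upper_bound (hW : IsDropletPotential W s) :
    ∃ C : ℝ, 0 ≤ C ∧ ∀ r : ℝ, 0 < r → (W r.toNNReal : ℝ) ≤ C * r ^ s := by
  obtain ⟨C, hC⟩ := hW.bddAbove
  refine ⟨C, C.coe_nonneg, fun r hr => ?_⟩
  lift r to ℝ≥0 using hr.le
  have hr' : 0 < r := by exact_mod_cast hr
  have h1 : W r / r ^ s ≤ C := hC ⟨r, hr', rfl⟩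
  rw [div_le_iff₀ (NNReal.rpow_pos hr')] at h1
  rw [Real.toNNReal_coe]
  exact_mod_cast h1

/-- Here `d` stands for `δ ^ N`. For fixed `r > 0` the argument of `W` tends to infinity, where `W`
is equivalent to the power. -/
theorem IsDropletPotential.tendsto_rescaled (hW : IsDropletPotential W s) {r : ℝ} (hr : 0 < r) :
    Tendsto (fun d : ℝ => d ^ s * W (d⁻¹ * r).toNNReal) (𝓝[>] 0) (𝓝 (r ^ s)) := by
  have hne : ∀ᶠ x : ℝ≥0 in atTop, ((x : ℝ) ^ s) ≠ 0 := by
    filter_upwards [eventually_gt_atTop 0] with x hx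
    exact (Real.rpow_pos_of_pos (by exact_mod_cast hx) s).ne'
  have h1 := (Asymptotics.isEquivalent_iff_tendsto_one hne).1 hW.isEquivalent
  have h2 : Tendsto (fun d : ℝ => (d⁻¹ * r).toNNReal) (𝓝[>] 0) atTop :=
    tendsto_real_toNNReal_atTop.comp (tendsto_inv_nhdsGT_zero.atTop_mul_const hr)
  have h3 := (h1.comp h2).const_mul (r ^ s)
  rw [mul_one] at h3
  refine h3.congr' ?_
  filter_upwards [self_mem_nhdsWithin] with d hd
  have hd' : 0 < d := hd
  simp only [Function.comp_apply, Pi.div_apply]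
  rw [Real.coe_toNNReal _ (by positivity), Real.mul_rpow (by positivity) hr.le,
    Real.inv_rpow hd'.le]
  have h4 : 0 < d ^ s := by positivity
  have h5 : 0 < r ^ s := by positivity
  field_simp

/-- Dominated convergence: the global bound `W u ≤ C u ^ s` provides the dominating function, and
points with `u = 0` have no potential because `W 0 = 0`. -/
theorem IsDropletPotential.tendsto_energy (hW : IsDropletPotential W s) (hN : 1 ≤ N)
    (hum : Measurable u) (hgm : Measurable g) (h0 : ∀ x, 0 ≤ u x)
    (hE : ∫⁻ x, (cutPower s 0 (u x) + ‖g x‖ₑ ^ 2) ≠ ⊤) :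
    Tendsto (fun ε => ∫⁻ x, (ENNReal.ofReal ((dropletScale N s ε ^ N) ^ s) *
      (W ((dropletScale N s ε ^ N)⁻¹ * u x).toNNReal : ℝ≥0∞) + ‖g x‖ₑ ^ 2)) (𝓝[>] 0)
      (𝓝 (∫⁻ x, (cutPower s 0 (u x) + ‖g x‖ₑ ^ 2))) := by
  obtain ⟨C, hC0, hC⟩ := hW.exists_upper_bound
  have hWm : Measurable W := hW.lowerSemicontinuous.measurable
  have hcm : Measurable fun x => cutPower s 0 (u x) := (measurable_cutPower s 0).comp hum
  have hd : Tendsto (fun ε => dropletScale N s ε ^ N) (𝓝[>] 0) (𝓝[>] 0) := by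
    simpa using tendsto_dropletScale_pow hN hW.lt_one one_pos
  refine tendsto_lintegral_filter_of_dominated_convergence
    (fun x => ENNReal.ofReal C * cutPower s 0 (u x) + ‖g x‖ₑ ^ 2) ?_ ?_ ?_ ?_
  · exact Eventually.of_forall fun ε => ((measurable_coe_nnreal_ennreal.comp (hWm.comp
      (hum.const_mul _).real_toNNReal)).const_mul _).add (hgm.enorm.pow_const 2)
  · filter_upwards [self_mem_nhdsWithin] with ε hε
    refine Eventually.of_forall fun x => add_le_add ?_ le_rfl
    have hδ := dropletScale_pos (N := N) (s := s) hε
    set δ := dropletScale N s ε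
    rcases (h0 x).eq_or_lt with hx | hx
    · rw [← hx, mul_zero, Real.toNNReal_zero, hW.map_zero]; simp
    · rw [cutPower, if_neg (not_le.2 hx), ← ENNReal.ofReal_coe_nnreal,
        ← ENNReal.ofReal_mul (by positivity), ← ENNReal.ofReal_mul hC0]
      refine ENNReal.ofReal_le_ofReal ?_
      have h1 := hC ((δ ^ N)⁻¹ * u x) (by positivity)
      rw [Real.mul_rpow (by positivity) hx.le, Real.inv_rpow (by positivity)] at h1
      have h2 : 0 < (δ ^ N) ^ s := by positivity
      calc (δ ^ N) ^ s * W ((δ ^ N)⁻¹ * u x).toNNReal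
          ≤ (δ ^ N) ^ s * (C * (((δ ^ N) ^ s)⁻¹ * u x ^ s)) := by gcongr
        _ = C * u x ^ s := by field_simp
  · have : ∫⁻ x, (ENNReal.ofReal C * cutPower s 0 (u x) + ‖g x‖ₑ ^ 2) ≤
        (ENNReal.ofReal C + 1) * ∫⁻ x, (cutPower s 0 (u x) + ‖g x‖ₑ ^ 2) := by
      rw [← lintegral_const_mul' _ _ (by finiteness)]
      refine lintegral_mono fun x => ?_
      rw [mul_add, add_mul, add_mul]
      exact add_le_add le_self_add (by rw [one_mul]; exact le_add_self)
    exact ne_top_of_le_ne_top (by finiteness) this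
  · refine Eventually.of_forall fun x => Tendsto.add_const _ ?_
    rcases (h0 x).eq_or_lt with hx | hx
    · simp only [← hx, mul_zero, Real.toNNReal_zero, hW.map_zero, ENNReal.coe_zero]
      rw [cutPower, if_pos le_rfl]
      exact tendsto_const_nhds
    · rw [cutPower, if_neg (not_le.2 hx)]
      refine (ENNReal.tendsto_ofReal ((hW.tendsto_rescaled hx).comp hd)).congr' ?_
      filter_upwards [self_mem_nhdsWithin] with ε hε
      have hδ := dropletScale_pos (N := N) (s := s) hε
      rw [Function.comp_apply, ENNReal.ofReal_mul (by positivity), ENNReal.ofReal_coe_nnreal]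

end upper

/-- `ν` is the sum of measures of mass `m x`, `x ∈ F`, each concentrated within distance `r`
from `x`. -/
def IsConcentrated (F : Finset (Space N)) (m : Space N → ℝ) (r : ℝ) (ν : Measure (Space N)) : Prop :=
  ∃ ν' : Space N → Measure (Space N), ν = ∑ x ∈ F, ν' x ∧
    ∀ x ∈ F, ν' x Set.univ = ENNReal.ofReal (m x) ∧ ν' x (Metric.closedBall x r)ᶜ = 0

theorem dropletDensity_zero {W : ℝ≥0 → ℝ≥0} {s : ℝ} (hW : IsDropletPotential W s) (ε : ℝ) :
    dropletDensity N W s ε 0 0 = 0 := by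
  simp [dropletDensity, hW.map_zero]

theorem lintegral_dropletDensity_affine {W : ℝ≥0 → ℝ≥0} {s ε : ℝ} (hs : s < 1) (hε : 0 < ε)
    (x : Space N) :
    ∫⁻ z, dropletDensity N W s ε
        ((dropletScale N s ε ^ N)⁻¹ * u ((dropletScale N s ε)⁻¹ • (z - x)))
        (((dropletScale N s ε ^ N)⁻¹ * (dropletScale N s ε)⁻¹) •
          g ((dropletScale N s ε)⁻¹ • (z - x))) =
      ∫⁻ y, (ENNReal.ofReal ((dropletScale N s ε ^ N) ^ s) *
        (W ((dropletScale N s ε ^ N)⁻¹ * u y).toNNReal : ℝ≥0∞) + ‖g y‖ₑ ^ 2) := by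
  have hδ := dropletScale_pos (N := N) (s := s) hε
  rw [lintegral_affine (inv_pos.2 hδ) x (fun y => dropletDensity N W s ε
    ((dropletScale N s ε ^ N)⁻¹ * u y)
    (((dropletScale N s ε ^ N)⁻¹ * (dropletScale N s ε)⁻¹) • g y)),
    ← lintegral_const_mul' _ _ ENNReal.ofReal_ne_top, inv_pow, inv_inv]
  refine lintegral_congr fun y => ?_
  rw [ofReal_mul_dropletDensity W hs hε, smul_smul, ← mul_inv, mul_inv_cancel₀ (by positivity),
    one_smul]

theorem withDensity_ofReal_sum (F : Finset (Space N)) {un : Space N → Space N → ℝ}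
    (hm : ∀ x ∈ F, Measurable (un x)) (h0 : ∀ x ∈ F, ∀ z, 0 ≤ un x z) :
    volume.withDensity (fun z => ENNReal.ofReal (∑ x ∈ F, un x z)) =
      ∑ x ∈ F, volume.withDensity (fun z => ENNReal.ofReal (un x z)) := by
  ext S hS
  rw [Measure.finsetSum_apply, withDensity_apply _ hS]
  simp only [withDensity_apply _ hS]
  rw [← lintegral_finsetSum' _ fun x hx => (hm x hx).ennreal_ofReal.aemeasurable]
  exact lintegral_congr fun z => ENNReal.ofReal_sum_of_nonneg fun x hx => h0 x hx z

/-- Droplets of prescribed masses and almost optimal energy around finitely many points. -/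
theorem IsDropletPotential.eventually_exists_droplets {W : ℝ≥0 → ℝ≥0} {s : ℝ}
    (hW : IsDropletPotential W s) (hN : 1 ≤ N) (hs : -2 < s) {F : Finset (Space N)}
    {m : Space N → ℝ} (hm : ∀ x ∈ F, 0 < m x) {b : ℝ≥0∞} (hb : ∑ x ∈ F, powerCost N s (m x) < b)
    {r : ℝ} (hr : 0 < r) :
    ∀ᶠ ε in 𝓝[>] (0 : ℝ), ∃ ν : FiniteMeasure (Space N), dropletEnergy W s ε ν ≤ b ∧
      IsConcentrated F m r (ν : Measure (Space N)) := by
  have hs1 := hW.lt_one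
  have hfin : ∀ x ∈ F, powerCost N s (m x) ≠ ⊤ := fun x hx => by
    rw [powerCost_eq hN hs1.le (hm x hx)]
    exact ENNReal.mul_ne_top (powerCost_one_lt_top hN hs hs1.le).ne ENNReal.ofReal_ne_top
  obtain ⟨t, ht0, ht⟩ : ∃ t : ℝ, 0 < t ∧
      ∑ x ∈ F, (powerCost N s (m x) + ENNReal.ofReal t) < b := by
    have h1 : Tendsto (fun t : ℝ => ∑ x ∈ F, (powerCost N s (m x) + ENNReal.ofReal t)) (𝓝[>] 0)
        (𝓝 (∑ x ∈ F, (powerCost N s (m x) + ENNReal.ofReal 0))) :=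
      tendsto_finsetSum _ fun x _ => (ENNReal.tendsto_ofReal
        (tendsto_id.mono_left nhdsWithin_le_nhds)).const_add _
    simp only [ENNReal.ofReal_zero, add_zero] at h1
    obtain ⟨t, h2, h3⟩ := ((h1.eventually_lt_const hb).and self_mem_nhdsWithin).exists
    exact ⟨t, h3, h2⟩
  have hex : ∀ x, ∃ (φ : Space N → ℝ) (k : Space N → Space N) (R : ℝ), x ∈ F → IsW11loc φ k ∧
      Measurable φ ∧ Measurable k ∧ (∀ y, 0 ≤ φ y) ∧ Integrable φ volume ∧ ∫ y, φ y = m x ∧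
      (∀ y, R < ‖y‖ → φ y = 0 ∧ k y = 0) ∧ ∫⁻ y, (cutPower s 0 (φ y) + ‖k y‖ₑ ^ 2) <
        powerCost N s (m x) + ENNReal.ofReal t := fun x => by
    by_cases hx : x ∈ F
    · obtain ⟨φ, k, R, h⟩ := exists_compact_profile hN hs hs1.le (hm x hx)
        (ENNReal.lt_add_right (hfin x hx) (ENNReal.ofReal_pos.2 ht0).ne')
      exact ⟨φ, k, R, fun _ => h⟩
    · exact ⟨0, 0, 0, fun h => absurd h hx⟩
  choose φ k R hprof using hex
  set R₀ := ∑ x ∈ F, |R x| + 1 with hR₀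
  have hR₀pos : 0 < R₀ := by positivity
  have hRR₀ : ∀ x ∈ F, R x ≤ R₀ := fun x hx => by
    have := Finset.single_le_sum (f := fun x => |R x|) (fun i _ => abs_nonneg _) hx
    linarith [le_abs_self (R x)]
  have hδlim : Tendsto (fun ε => dropletScale N s ε * R₀) (𝓝[>] 0) (𝓝 0) := by
    simpa using ((tendsto_dropletScale (N := N) hs1).mono_right nhdsWithin_le_nhds).mul_const R₀
  -- The droplets live in balls of radius `δ R₀`, which are eventually disjoint.
  have hsep : ∀ᶠ ε in 𝓝[>] (0 : ℝ), ∀ x ∈ F, ∀ y ∈ F, x ≠ y →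
      2 * (dropletScale N s ε * R₀) < dist x y := by
    rw [eventually_all_finset]
    intro x _
    rw [eventually_all_finset]
    intro y _
    by_cases hxy : x = y
    · exact Eventually.of_forall fun _ h => absurd hxy h
    filter_upwards [hδlim.eventually_lt_const (half_pos (dist_pos.2 hxy))] with ε hε _
    linarith
  have hElim := tendsto_finsetSum F fun x hx => hW.tendsto_energy (u := φ x) (g := k x) hN
    (hprof x hx).2.1 (hprof x hx).2.2.1 (hprof x hx).2.2.2.1
    ((hprof x hx).2.2.2.2.2.2.2.trans_le le_top).ne
  have hEb : ∑ x ∈ F, ∫⁻ y, (cutPower s 0 (φ x y) + ‖k x y‖ₑ ^ 2) < b :=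
    (Finset.sum_le_sum fun x hx => (hprof x hx).2.2.2.2.2.2.2.le).trans_lt ht
  filter_upwards [self_mem_nhdsWithin, hsep, hδlim.eventually_le_const hr,
    hElim.eventually_le_const hEb] with ε hε hsepε hrε hbε
  have hε0 : 0 < ε := hε
  rw [← Finset.sum_congr rfl fun x _ =>
    lintegral_dropletDensity_affine (u := φ x) (g := k x) hs1 hε0 x] at hbε
  have hδ := dropletScale_pos (N := N) (s := s) hε0
  set δ := dropletScale N s ε with hδdef
  set un : Space N → Space N → ℝ := fun x z => (δ ^ N)⁻¹ * φ x (δ⁻¹ • (z - x)) with hun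
  set gn : Space N → Space N → Space N := fun x z => ((δ ^ N)⁻¹ * δ⁻¹) • k x (δ⁻¹ • (z - x)) with hgn
  have hW11 : ∀ x ∈ F, IsW11loc (un x) (gn x) := fun x hx =>
    (hprof x hx).1.affine ((δ ^ N)⁻¹) (inv_pos.2 hδ) x
  have hunm : ∀ x ∈ F, Measurable (un x) := fun x hx =>
    ((hprof x hx).2.1.comp (by fun_prop : Measurable fun z : Space N => δ⁻¹ • (z - x))).const_mul _
  have hun0 : ∀ x ∈ F, ∀ z, 0 ≤ un x z := fun x hx z =>
    mul_nonneg (by positivity) ((hprof x hx).2.2.2.1 _)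
  have hvan : ∀ x ∈ F, ∀ z, δ * R₀ < dist z x → un x z = 0 ∧ gn x z = 0 := fun x hx z hz => by
    have := (hprof x hx).2.2.2.2.2.2.1 (δ⁻¹ • (z - x)) (by
      rw [norm_smul, Real.norm_of_nonneg (by positivity), ← dist_eq_norm, lt_inv_mul_iff₀ hδ]
      refine lt_of_le_of_lt ?_ hz
      gcongr
      exact hRR₀ x hx)
    simp only [hun, hgn, this.1, this.2, mul_zero, smul_zero, and_self]
  have hmass : ∀ x ∈ F, volume.withDensity (fun z => ENNReal.ofReal (un x z)) Set.univ =
      ENNReal.ofReal (m x) := fun x hx => by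
    rw [withDensity_apply _ MeasurableSet.univ, Measure.restrict_univ,
      ← ofReal_integral_eq_lintegral_ofReal
        ((integrable_affine (hprof x hx).2.2.2.2.1 (inv_pos.2 hδ) x).const_mul _)
        (Eventually.of_forall (hun0 x hx)), integral_const_mul, integral_affine (inv_pos.2 hδ) x,
      (hprof x hx).2.2.2.2.2.1, inv_pow, inv_inv, ← mul_assoc, inv_mul_cancel₀ (by positivity),
      one_mul]
  have hνeq := withDensity_ofReal_sum F hunm hun0
  have hνfin : IsFiniteMeasure (volume.withDensity fun z => ENNReal.ofReal (∑ x ∈ F, un x z)) := by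
    refine ⟨?_⟩
    rw [hνeq, Measure.finsetSum_apply, Finset.sum_congr rfl hmass]
    exact ENNReal.sum_lt_top.2 fun x _ => ENNReal.ofReal_lt_top
  refine ⟨⟨_, hνfin⟩, ?_, ⟨fun x => volume.withDensity fun z => ENNReal.ofReal (un x z), hνeq,
    fun x hx => ⟨hmass x hx, ?_⟩⟩⟩
  · refine le_trans ?_ hbε
    calc dropletEnergy W s ε ⟨_, hνfin⟩
        ≤ ∫⁻ z, dropletDensity N W s ε (∑ x ∈ F, un x z) (∑ x ∈ F, gn x z) :=
          iInf_le_of_le _ <| iInf_le_of_le _ <| iInf_le_of_le (isW11loc_sum F hW11) <|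
            iInf_le_of_le (fun z => Finset.sum_nonneg fun x hx => hun0 x hx z) <|
            iInf_le_of_le rfl le_rfl
      _ ≤ ∫⁻ z, ∑ x ∈ F, dropletDensity N W s ε (un x z) (gn x z) := by
          refine lintegral_mono fun z => ?_
          -- At each point at most one droplet is present, so the nonlinear density of the sum
          -- reduces to that of a single summand.
          by_cases hz : ∃ x ∈ F, dist z x ≤ δ * R₀
          · obtain ⟨x, hx, hzx⟩ := hz
            have hoth : ∀ y ∈ F, y ≠ x → un y z = 0 ∧ gn y z = 0 := fun y hy hyx => by
              refine hvan y hy z ?_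
              have h1 := hsepε x hx y hy hyx.symm
              have h2 := dist_triangle_left x y z
              linarith
            rw [Finset.sum_eq_single_of_mem x hx fun y hy hyx => (hoth y hy hyx).1,
              Finset.sum_eq_single_of_mem x hx fun y hy hyx => (hoth y hy hyx).2]
            exact Finset.single_le_sum
              (f := fun x => dropletDensity N W s ε (un x z) (gn x z)) (fun _ _ => zero_le) hx
          · push Not at hz
            rw [Finset.sum_eq_zero fun x hx => (hvan x hx z (hz x hx)).1,
              Finset.sum_eq_zero fun x hx => (hvan x hx z (hz x hx)).2, dropletDensity_zero hW]
            exact zero_le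
      _ = _ := by
          refine lintegral_finsetSum' _ fun x hx => ?_
          have hgm : Measurable (gn x) := ((hprof x hx).2.2.1.comp
            (by fun_prop : Measurable fun z : Space N => δ⁻¹ • (z - x))).const_smul
              ((δ ^ N)⁻¹ * δ⁻¹)
          have hWm : Measurable W := hW.lowerSemicontinuous.measurable
          exact (((measurable_coe_nnreal_ennreal.comp
            (hWm.comp (hunm x hx).real_toNNReal)).add
            ((hgm.norm.pow_const 2).const_mul ε).ennreal_ofReal).const_mul _).aemeasurable
  · rw [withDensity_apply _ Metric.isClosed_closedBall.measurableSet.compl]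
    refine (setLIntegral_congr_fun Metric.isClosed_closedBall.measurableSet.compl
      fun z hz => ?_).trans lintegral_zero
    rw [Set.mem_compl_iff, Metric.mem_closedBall, not_le] at hz
    simp only [(hvan x hx z (hrε.trans_lt hz)).1, ENNReal.ofReal_zero]

/-! ### The slope at the origin and the `α`-mass -/

/-- The quotient is `m ^ (α - 1)`, with `α = 1` for `s = 1` and `α < 1` for `s < 1`. That `L ≠ 0`
allows the limit to be multiplied by a possibly infinite cost. -/
theorem exists_tendsto_rpow_div (hN : 1 ≤ N) {s : ℝ} (hs : s ≤ 1) :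
    ∃ L : ℝ≥0∞, L ≠ 0 ∧ (s < 1 → L = ⊤) ∧
      Tendsto (fun m : ℝ => ENNReal.ofReal (m ^ costExponent N s) / ENNReal.ofReal m) (𝓝[>] 0)
        (𝓝 L) := by
  have heq : (fun m : ℝ => ENNReal.ofReal (m ^ (costExponent N s - 1))) =ᶠ[𝓝[>] 0]
      fun m : ℝ => ENNReal.ofReal (m ^ costExponent N s) / ENNReal.ofReal m := by
    filter_upwards [self_mem_nhdsWithin] with m hm
    have hm' : 0 < m := hm
    rw [← ENNReal.ofReal_div_of_pos hm', Real.rpow_sub_one hm'.ne']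
  rcases hs.eq_or_lt with rfl | hs
  · refine ⟨1, one_ne_zero, fun h => absurd h (lt_irrefl _), Tendsto.congr' heq ?_⟩
    have hα : costExponent N 1 = 1 := by
      obtain ⟨h1, h2⟩ := costExponent_eq hN (le_refl 1)
      rw [h2]; exact div_self h1.ne'
    simp [hα]
  · refine ⟨⊤, ENNReal.top_ne_zero, fun _ => rfl, Tendsto.congr' heq ?_⟩
    have h1 := tendsto_inv_nhdsGT_zero.comp (tendsto_rpow_nhdsGT_zero
      (show 0 < 1 - costExponent N s by linarith [costExponent_lt_one hN hs]))
    refine (ENNReal.tendsto_ofReal_atTop.comp h1).congr' ?_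
    filter_upwards [self_mem_nhdsWithin] with η hη
    rw [Function.comp_apply, Function.comp_apply, ← Real.rpow_neg (le_of_lt hη), neg_sub]

theorem tendsto_powerCost_div (hN : 1 ≤ N) {s : ℝ} (hs : s ≤ 1) {L : ℝ≥0∞} (hL : L ≠ 0)
    (h : Tendsto (fun m : ℝ => ENNReal.ofReal (m ^ costExponent N s) / ENNReal.ofReal m) (𝓝[>] 0)
      (𝓝 L)) :
    Tendsto (fun m : ℝ => powerCost N s m / ENNReal.ofReal m) (𝓝[>] 0)
      (𝓝 (powerCost N s 1 * L)) := by
  refine (ENNReal.Tendsto.const_mul h (Or.inl hL)).congr' ?_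
  filter_upwards [self_mem_nhdsWithin] with m hm
  rw [powerCost_eq hN hs hm, mul_div_assoc]

theorem tendsto_slopeZero (hN : 1 ≤ N) {s : ℝ} (hs : s ≤ 1) :
    Tendsto (fun m : ℝ => powerCost N s m / ENNReal.ofReal m) (𝓝[>] 0)
      (𝓝 (slopeZero (powerCost N s))) := by
  obtain ⟨L, hL, -, h⟩ := exists_tendsto_rpow_div hN hs
  have := tendsto_powerCost_div hN hs hL h
  rwa [slopeZero, this.limsup_eq]

theorem slopeZero_eq_top (hN : 1 ≤ N) {s : ℝ} (hs : s < 1) : slopeZero (powerCost N s) = ⊤ := by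
  obtain ⟨L, hL, hLt, h⟩ := exists_tendsto_rpow_div hN hs.le
  rw [slopeZero, (tendsto_powerCost_div hN hs.le hL h).limsup_eq, hLt hs,
    ENNReal.mul_top (powerCost_one_pos hN hs.le).ne']

theorem HMass_eq_mul_alphaMass (hN : 1 ≤ N) {s : ℝ} (hs : -2 < s) (hs1 : s ≤ 1)
    (μ : FiniteMeasure (Space N)) :
    HMass (powerCost N s) μ = powerCost N s 1 * alphaMass (costExponent N s) μ := by
  obtain ⟨L, hL, -, h⟩ := exists_tendsto_rpow_div hN hs1
  rw [alphaMass, HMass, HMass, slopeZero, slopeZero, (tendsto_powerCost_div hN hs1 hL h).limsup_eq,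
    h.limsup_eq, mul_add, ← ENNReal.tsum_mul_left, mul_assoc]
  congr 2
  funext x
  rcases (measureReal_nonneg (μ := (μ : Measure (Space N))) (s := {x})).eq_or_lt with h0 | h0
  -- At points that are not atoms both sides vanish, since `0 ^ α = 0` for `α > 0`.
  · rw [← h0, powerCost_zero, Real.zero_rpow (costExponent_pos hN hs1 hs).ne', ENNReal.ofReal_zero,
      mul_zero]
  · exact powerCost_eq hN hs1 h0

/-! ### Diagonal argument, narrow convergence and recovery families -/

/-- The index is the largest `k ≤ ⌊ε⁻¹⌋₊` with `p k ε`; it is at least `j` once `p j ε` holds and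
`⌊ε⁻¹⌋₊ ≥ j`. The default value `0` of `Nat.findGreatest` is harmless, as `p 0 ε` holds eventually.
-/
theorem exists_diagonal {p : ℕ → ℝ → Prop} (h : ∀ n, ∀ᶠ ε in 𝓝[>] (0 : ℝ), p n ε) :
    ∃ n : ℝ → ℕ, Tendsto n (𝓝[>] 0) atTop ∧ ∀ᶠ ε in 𝓝[>] (0 : ℝ), p (n ε) ε := by
  classical
  refine ⟨fun ε => Nat.findGreatest (fun k => p k ε) ⌊ε⁻¹⌋₊, tendsto_atTop.2 fun j => ?_, ?_⟩
  · filter_upwards [h j, (tendsto_nat_floor_atTop.comp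
      tendsto_inv_nhdsGT_zero).eventually_ge_atTop j] with ε h1 h2
    exact Nat.le_findGreatest h2 h1
  · filter_upwards [h 0] with ε h1
    exact Nat.findGreatest_spec (P := fun k => p k ε) (Nat.zero_le _) h1

theorem summable_atoms (μ : Measure (Space N)) [IsFiniteMeasure μ] :
    Summable fun x : Space N => μ.real {x} :=
  ENNReal.summable_toReal (tsum_atoms_ne_top μ)

theorem integral_eq_tsum_of_atomic {μ : Measure (Space N)} [IsFiniteMeasure μ]
    (hD : μ {x | μ {x} = 0} = 0) {f : Space N → ℝ} (hf : Integrable f μ) :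
    ∫ x, f x ∂μ = ∑' x, μ.real {x} * f x := by
  have h1 : μ.restrict {x : Space N | μ {x} ≠ 0} = μ :=
    Measure.restrict_eq_self_of_ae_mem (by rw [ae_iff]; simpa using hD)
  have h2 := setIntegral_countable f (countable_atoms μ) hf.integrableOn
  rw [h1] at h2
  rw [h2, tsum_subtype {x : Space N | μ {x} ≠ 0} fun x => μ.real {x} • f x]
  refine tsum_congr fun x => ?_
  by_cases hx : μ {x} = 0
  · rw [Set.indicator_of_notMem (by simpa using hx), measureReal_def, hx]; simp
  · rw [Set.indicator_of_mem (show x ∈ {x : Space N | μ {x} ≠ 0} from hx), smul_eq_mul]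

theorem exists_exhaustion {A : Set (Space N)} (hA : A.Countable) :
    ∃ F : ℕ → Finset (Space N), (∀ n, ∀ x ∈ F n, x ∈ A) ∧ ∀ x ∈ A, ∀ᶠ n in atTop, x ∈ F n := by
  obtain ⟨f, hf⟩ := Set.countable_iff_exists_injOn.1 hA
  have hfin : ∀ n : ℕ, (A ∩ f ⁻¹' Set.Iio n).Finite := fun n =>
    Set.Finite.of_finite_image ((Set.finite_Iio n).subset (by
      rintro _ ⟨x, hx, rfl⟩; exact hx.2)) (hf.mono Set.inter_subset_left)
  refine ⟨fun n => (hfin n).toFinset, fun n x hx => ((hfin n).mem_toFinset.1 hx).1, fun x hx => ?_⟩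
  filter_upwards [eventually_gt_atTop (f x)] with n hn
  exact (hfin n).mem_toFinset.2 ⟨hx, hn⟩

/-- The integral of `f` against `ν ε` is a series over the atoms of `μ` with terms bounded by `‖f‖ m
x`. Each term converges by continuity of `f`, and dominated convergence for series applies to every
bounded continuous `f`. -/
theorem tendsto_of_isConcentrated {μ : FiniteMeasure (Space N)}
    (hD : (μ : Measure (Space N)) {x | (μ : Measure (Space N)) {x} = 0} = 0)
    {F : ℝ → Finset (Space N)} (hFA : ∀ ε, ∀ x ∈ F ε, (μ : Measure (Space N)) {x} ≠ 0)
    (hF : ∀ x, (μ : Measure (Space N)) {x} ≠ 0 → ∀ᶠ ε in 𝓝[>] (0 : ℝ), x ∈ F ε)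
    {r : ℝ → ℝ} (hr : Tendsto r (𝓝[>] 0) (𝓝 0)) {ν : ℝ → FiniteMeasure (Space N)}
    (hν : ∀ᶠ ε in 𝓝[>] (0 : ℝ), IsConcentrated (F ε) (fun x => (μ : Measure (Space N)).real {x})
      (r ε) (ν ε : Measure (Space N))) :
    Tendsto ν (𝓝[>] 0) (𝓝 μ) := by
  rw [FiniteMeasure.tendsto_iff_forall_integral_tendsto]
  intro f
  set m : Space N → ℝ := fun x => (μ : Measure (Space N)).real {x} with hm
  have hex : ∀ ε, ∃ ν' : Space N → Measure (Space N), IsConcentrated (F ε) m (r ε)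
      (ν ε : Measure (Space N)) → (ν ε : Measure (Space N)) = ∑ x ∈ F ε, ν' x ∧
      ∀ x ∈ F ε, ν' x Set.univ = ENNReal.ofReal (m x) ∧ ν' x (Metric.closedBall x (r ε))ᶜ = 0 :=
    fun ε => by
      by_cases h : IsConcentrated (F ε) m (r ε) (ν ε : Measure (Space N))
      · obtain ⟨ν', h'⟩ := h
        exact ⟨ν', fun _ => h'⟩
      · exact ⟨0, fun h' => absurd h' h⟩
  choose ν' hν' using hex
  classical
  set c : ℝ → Space N → ℝ := fun ε x => if x ∈ F ε then ∫ z, f z ∂(ν' ε x) else 0 with hc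
  have hfinm : ∀ ε x, ν' ε x Set.univ = ENNReal.ofReal (m x) → IsFiniteMeasure (ν' ε x) :=
    fun ε x h => ⟨by rw [h]; exact ENNReal.ofReal_lt_top⟩
  have hreal : ∀ ε x, ν' ε x Set.univ = ENNReal.ofReal (m x) → (ν' ε x).real Set.univ = m x :=
    fun ε x h => by rw [measureReal_def, h, ENNReal.toReal_ofReal measureReal_nonneg]
  have hsum : (fun ε => ∑' x, c ε x) =ᶠ[𝓝[>] 0] fun ε => ∫ z, f z ∂(ν ε : Measure (Space N)) := by
    filter_upwards [hν] with ε hε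
    obtain ⟨h1, h2⟩ := hν' ε hε
    rw [h1, integral_finsetSum_measure fun x hx => by
      have := hfinm ε x (h2 x hx).1
      exact f.integrable _, tsum_eq_sum (s := F ε) fun x hx => by simp only [hc, if_neg hx]]
    exact Finset.sum_congr rfl fun x hx => by simp only [hc, if_pos hx]
  refine Tendsto.congr' hsum ?_
  rw [integral_eq_tsum_of_atomic hD (f.integrable _)]
  refine tendsto_tsum_of_dominated_convergence (bound := fun x => ‖f‖ * m x)
    ((summable_atoms (μ : Measure (Space N))).mul_left _) (fun x => ?_) ?_
  · by_cases hx : (μ : Measure (Space N)) {x} = 0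
    · have h1 : ∀ ε, c ε x = 0 := fun ε => by
        simp only [hc]
        rw [if_neg fun h => hFA ε x h hx]
      simp only [h1]
      rw [measureReal_def, hx, ENNReal.toReal_zero, zero_mul]
      exact tendsto_const_nhds
    · rw [Metric.tendsto_nhds]
      intro η hη
      have hm0 : 0 ≤ m x := measureReal_nonneg
      have hη' : 0 < η / (m x + 1) := by positivity
      obtain ⟨ρ, hρ, hρf⟩ := Metric.continuousAt_iff.1 f.continuous.continuousAt _ hη'
      filter_upwards [hν, hF x hx, hr.eventually_lt_const hρ] with ε h1 h2 h3
      obtain ⟨-, h4⟩ := hν' ε h1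
      obtain ⟨h5, h6⟩ := h4 x h2
      have := hfinm ε x h5
      simp only [hc, if_pos h2]
      have h7 : (μ : Measure (Space N)).real {x} * f x = ∫ _z, f x ∂(ν' ε x) := by
        rw [integral_const, hreal ε x h5, smul_eq_mul]
      rw [h7, dist_eq_norm, ← integral_sub (f.integrable _) (integrable_const _)]
      have h8 : ∀ᵐ z ∂(ν' ε x), ‖f z - f x‖ ≤ η / (m x + 1) := by
        have : ∀ᵐ z ∂(ν' ε x), z ∈ Metric.closedBall x (r ε) := by
          rw [ae_iff]; exact h6
        filter_upwards [this] with z hz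
        rw [← dist_eq_norm]
        exact (hρf (lt_of_le_of_lt hz h3)).le
      refine (norm_integral_le_of_norm_le_const h8).trans_lt ?_
      rw [hreal ε x h5, div_mul_eq_mul_div, div_lt_iff₀ (by positivity)]
      nlinarith
  · filter_upwards [hν] with ε h1 x
    have hm0 : 0 ≤ m x := measureReal_nonneg
    simp only [hc]
    split_ifs with h2
    · obtain ⟨h5, -⟩ := (hν' ε h1).2 x h2
      have := hfinm ε x h5
      refine (norm_integral_le_of_norm_le_const (Eventually.of_forall fun z =>
        f.norm_coe_le_norm z)).trans ?_
      rw [hreal ε x h5]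
    · rw [norm_zero]; positivity

theorem dropletEnergy_zero {W : ℝ≥0 → ℝ≥0} {s : ℝ} (hW : IsDropletPotential W s) (ε : ℝ)
    {μ : FiniteMeasure (Space N)} (hμ : (μ : Measure (Space N)) = 0) : dropletEnergy W s ε μ = 0 := by
  refine le_antisymm ?_ zero_le
  calc dropletEnergy W s ε μ ≤ ∫⁻ _x : Space N, dropletDensity N W s ε 0 0 :=
        iInf_le_of_le _ <| iInf_le_of_le _ <| iInf_le_of_le (isW11loc_const (N := N) 0) <|
          iInf_le_of_le (fun _ => le_rfl) <| iInf_le_of_le (by simp [hμ]) le_rfl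
    _ = 0 := by rw [dropletDensity_zero hW, lintegral_zero]

/-- The existence of recovery families. -/
theorem IsDropletPotential.exists_recovery {W : ℝ≥0 → ℝ≥0} {s : ℝ} (hW : IsDropletPotential W s)
    (hN : 1 ≤ N) (μ : FiniteMeasure (Space N)) :
    ∃ ν : ℝ → FiniteMeasure (Space N), NarrowConverges ν μ ∧
      limsup (fun ε => dropletEnergy W s ε (ν ε)) (𝓝[>] 0) ≤ HMass (powerCost N s) μ := by
  have hs1 := hW.lt_one
  by_cases hfin : HMass (powerCost N s) μ = ⊤
  -- If the limit value is infinite, the constant family will do.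
  · exact ⟨fun _ => μ, tendsto_const_nhds, by rw [hfin]; exact le_top⟩
  -- A finite value excludes a diffuse part, whose slope factor is infinite.
  have hD : (μ : Measure (Space N)) {x | (μ : Measure (Space N)) {x} = 0} = 0 := by
    by_contra hne
    refine hfin ?_
    rw [HMass, slopeZero_eq_top hN hs1, ENNReal.top_mul hne, add_top]
  have htsum : ∑' x : Space N, powerCost N s ((μ : Measure (Space N)).real {x}) ≤
      HMass (powerCost N s) μ := le_self_add
  have hpos : ∀ x, (μ : Measure (Space N)) {x} ≠ 0 → 0 < (μ : Measure (Space N)).real {x} :=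
    fun x hx => ENNReal.toReal_pos hx (measure_ne_top _ _)
  rcases lt_or_ge (-2) s with hs | hs
  · obtain ⟨F, hFA, hF⟩ := exists_exhaustion (countable_atoms (μ : Measure (Space N)))
    set b : ℕ → ℝ≥0∞ := fun n => HMass (powerCost N s) μ + ENNReal.ofReal (1 / ((n : ℝ) + 1)) with hb
    have hstage : ∀ n, ∀ᶠ ε in 𝓝[>] (0 : ℝ), ∃ ν : FiniteMeasure (Space N),
        dropletEnergy W s ε ν ≤ b n ∧ IsConcentrated (F n)
          (fun x => (μ : Measure (Space N)).real {x}) (1 / ((n : ℝ) + 1)) (ν : Measure (Space N)) :=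
      fun n => hW.eventually_exists_droplets hN hs (fun x hx => hpos x (hFA n x hx))
        (((ENNReal.sum_le_tsum (F n)).trans htsum).trans_lt
          (ENNReal.lt_add_right hfin (ENNReal.ofReal_pos.2 (by positivity)).ne')) (by positivity)
    obtain ⟨n, hn, hnp⟩ := exists_diagonal hstage
    have hex : ∀ ε, ∃ ν : FiniteMeasure (Space N), (∃ ν : FiniteMeasure (Space N),
        dropletEnergy W s ε ν ≤ b (n ε) ∧ IsConcentrated (F (n ε))
          (fun x => (μ : Measure (Space N)).real {x}) (1 / ((n ε : ℝ) + 1))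
          (ν : Measure (Space N))) → dropletEnergy W s ε ν ≤ b (n ε) ∧ IsConcentrated (F (n ε))
          (fun x => (μ : Measure (Space N)).real {x}) (1 / ((n ε : ℝ) + 1))
          (ν : Measure (Space N)) := fun ε => by
      by_cases h : ∃ ν : FiniteMeasure (Space N),
        dropletEnergy W s ε ν ≤ b (n ε) ∧ IsConcentrated (F (n ε))
          (fun x => (μ : Measure (Space N)).real {x}) (1 / ((n ε : ℝ) + 1)) (ν : Measure (Space N))
      · obtain ⟨ν, h'⟩ := h
        exact ⟨ν, fun _ => h'⟩
      · exact ⟨μ, fun h' => absurd h' h⟩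
    choose ν hν using hex
    have hlim : Tendsto (fun ε => 1 / ((n ε : ℝ) + 1)) (𝓝[>] 0) (𝓝 0) :=
      tendsto_one_div_add_atTop_nhds_zero_nat.comp hn
    refine ⟨ν, tendsto_of_isConcentrated hD (F := fun ε => F (n ε)) (fun ε x hx => hFA _ x hx)
      (fun x hx => hn.eventually (hF x hx)) hlim ?_, ?_⟩
    · filter_upwards [hnp] with ε hε using (hν ε hε).2
    · have hblim : Tendsto (fun ε => b (n ε)) (𝓝[>] 0) (𝓝 (HMass (powerCost N s) μ)) := by
        have := (ENNReal.tendsto_ofReal hlim).const_add (HMass (powerCost N s) μ)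
        rwa [ENNReal.ofReal_zero, add_zero] at this
      rw [← hblim.limsup_eq]
      refine limsup_le_limsup ?_
      filter_upwards [hnp] with ε hε using (hν ε hε).1
  -- For `s ≤ -2` every atom costs infinitely much, so only the zero measure has a finite value.
  · have hμ : (μ : Measure (Space N)) = 0 := by
      have hall : {x | (μ : Measure (Space N)) {x} = 0} = Set.univ := by
        refine Set.eq_univ_of_forall fun x => ?_
        by_contra hx
        refine hfin (top_le_iff.1 (le_trans ?_ htsum))
        refine le_trans (le_of_eq ?_) (ENNReal.le_tsum x)
        rw [powerCost_eq hN hs1.le (hpos x hx), powerCost_one_eq_top hN hs, ENNReal.top_mul]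
        exact (ENNReal.ofReal_pos.2 (Real.rpow_pos_of_pos (hpos x hx) _)).ne'
      rw [hall] at hD
      exact Measure.measure_univ_eq_zero.1 hD
    refine ⟨fun _ => μ, tendsto_const_nhds, ?_⟩
    simp only [dropletEnergy_zero hW _ hμ]
    rw [limsup_const]
    exact zero_le

theorem NarrowConverges.weakConverges {μs : ℝ → FiniteMeasure (Space N)}
    {μ : FiniteMeasure (Space N)} (h : NarrowConverges μs μ) : WeakConverges μs μ := fun φ =>
  FiniteMeasure.tendsto_iff_forall_integral_tendsto.1 h φ.toBCF

end Droplets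

end

theorem mainTheorem3 (N : ℕ) (hN : 1 ≤ N) :
    -- Γ-convergence of the droplet functionals, in both topologies
    (∀ (s : ℝ) (W : ℝ≥0 → ℝ≥0), s < 1 →
      LowerSemicontinuous W →
      (∀ u : ℝ≥0, W u = 0 ↔ u = 0) →
      Asymptotics.IsEquivalent atTop (fun u : ℝ≥0 => (W u : ℝ)) (fun u : ℝ≥0 => (u : ℝ) ^ s) →
      BddAbove ((fun u : ℝ≥0 => W u / u ^ s) '' Set.Ioi 0) →
      0 < liminf (fun u : ℝ≥0 => (W u : ℝ≥0∞) / (u : ℝ≥0∞)) (𝓝[>] 0) →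
      Droplets.GammaConverges Droplets.WeakConverges
          (fun ε (μ : FiniteMeasure (Droplets.Space N)) => Droplets.dropletEnergy W s ε μ)
          (Droplets.HMass (Droplets.minimalCost (Droplets.powerLagrangian N s))) ∧
        Droplets.GammaConverges Droplets.NarrowConverges
          (fun ε (μ : FiniteMeasure (Droplets.Space N)) => Droplets.dropletEnergy W s ε μ)
          (Droplets.HMass (Droplets.minimalCost (Droplets.powerLagrangian N s)))) ∧
    -- the slope of the cost at the origin, which enters the limit functional, is a genuine limit
    (∀ s : ℝ, s ≤ 1 →
      Tendsto
        (fun m : ℝ => Droplets.minimalCost (Droplets.powerLagrangian N s) m / ENNReal.ofReal m)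
        (𝓝[>] 0)
        (𝓝 (Droplets.slopeZero (Droplets.minimalCost (Droplets.powerLagrangian N s))))) ∧
    -- the limit functional is a nontrivial multiple of the α-mass
    (∀ s : ℝ, -2 < s → s ≤ 1 → ∃ c : ℝ≥0, 0 < c ∧ ∀ μ : FiniteMeasure (Droplets.Space N),
      Droplets.HMass (Droplets.minimalCost (Droplets.powerLagrangian N s)) μ =
        c * Droplets.alphaMass ((1 - s / 2 + s / N) / (1 - s / 2 + 1 / N)) μ) := by
  refine ⟨fun s W hs hlsc hzero hequiv hbdd hlim => ?_, fun s hs => ?_, fun s hs hs1 => ?_⟩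
  · have hW : Droplets.IsDropletPotential W s := ⟨hs, hlsc, hzero, hequiv, hbdd, hlim⟩
    -- Narrow convergence implies weak convergence: the lower bound is needed only for the weaker
    -- notion, recovery families only for the stronger one.
    refine ⟨⟨fun v u h => hW.HMass_le_liminf hN h, fun u => ?_⟩,
      ⟨fun v u h => hW.HMass_le_liminf hN h.weakConverges, fun u => hW.exists_recovery hN u⟩⟩
    obtain ⟨v, hv, hle⟩ := hW.exists_recovery hN u
    exact ⟨v, hv.weakConverges, hle⟩
  · exact Droplets.tendsto_slopeZero hN hs
  · have hP := (Droplets.powerCost_one_lt_top (N := N) hN hs hs1).ne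
    refine ⟨(Droplets.powerCost N s 1).toNNReal,
      ENNReal.toNNReal_pos (Droplets.powerCost_one_pos hN hs1).ne' hP, fun μ => ?_⟩
    rw [ENNReal.coe_toNNReal hP]
    exact Droplets.HMass_eq_mul_alphaMass hN hs hs1 μ
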